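/- Let $n\ge 1$. Let $(R,E,S)$ be an $n$-polygraph modulo: $R$ is an $n$-polygraph, $R_{n-1}^\ast$ denotes the free $(n-1)$-category on its underlying $(n-1)$-polygraph, $E$ is a set of modulo rules on $R_{n-1}^\ast$ (that is, a cellular extension of $R_{n-1}^\ast$), and $S$ is a cellular extension of $R_{n-1}^\ast$ with $R\subseteq S\subseteq {}_ER_E$, where ${}_ER_E$ is the cellular extension of composable triples $(e,r,e')$ with $e,e'$ in the free $(n,n-1)$-category $E^\top$ and $r=C[\gamma]$ a rewriting step of $R$ ($C$ a whisker of $R_{n-1}^\ast$, $\gamma$ a rule), and a rule $\gamma$ of $R$ is identified with $(1,\gamma,1)$. Let $S^\ast$, $S^\top$ be the free $n$-category and the free $(n,n-1)$-category on $S$. Assume that * $(R,E,S)$ is diconvergent: $E$ is terminating and confluent, ${}_ER_E$ is terminating, and $S$ is confluent modulo $E$, i.e. for all $n$-cells $f,g$ of $S^\ast$ and $e$ of $E^\top$, with $f$ non-trivial and $e$ going from the source of $f$ to the source of $g$, there are $f',g'$ in $S^\ast$ and $e'$ in $E^\top$ such that $f\star_{n-1} f'$ and $g\star_{n-1} g'$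 are defined and $e'$ goes from the target of $f'$ to the target of $g'$; * $\mathrm{Irr}(E)$ is $E$-normalizing with respect to $S$: every $E$-irreducible $(n-1)$-cell of $R_{n-1}^\ast$ has an $S$-normal form that is $E$-irreducible. A square consists of $n$-cells $f$ (top), $g$ (bottom) of a horizontal category and $e$ (left), $e'$ (right) of a vertical category whose sources and targets match. A critical branching is a pair of steps with the same source that is not aspherical (equal steps), not Peiffer (steps acting on the two sides of a $\star_i$-composite, $0\le i\le n-2$), and minimal for the application of whiskers of $R_{n-1}^\ast$; the branchings $(f,g)$ and $(g,f)$ of steps of the same extension are identified. Let * $\Gamma$ be a coherent completion of $S$ modulo $E$: a square extension consisting of exactly one square with top $f\star_{n-1}f'$, bottom $g\star_{n-1}g'$, left an identity and right $e'$, for each critical branching $(f,g)$ with $f$ a step of $S$ and $g$ a step of $R$, and exactly one square with top $f\star_{n-1}f'$, bottom $g'$, left $e$ and right $e'$, for each critical branching $(f,e)$ with $f$ a step of $S$ and $e$ a cell of size one of $E^\top$; here $f',g'$ are cells of $S^\ast$ and $e'$ is a cell of $E^\top$, chosen arbitrarily; * $\mathrm{conf}(E)$ be a coherent completion of $E$: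 exactly one square with identities as top and bottom, left $e\star_{n-1}e_1$ and right $e'\star_{n-1}e_1'$, for each critical branching $(e,e')$ of $E$, where $(e_1,e_1')$ is an arbitrarily chosen confluence in $E^\ast$; * $E\rtimes\Gamma$ be the set of squares with top $e_1f$, bottom $e_2^-g$, left $e_1\star_{n-1} e\star_{n-1} e_2$ and right $e'$, for all squares of $\Gamma$ with top $f$, bottom $g$, left $e$, right $e'$ and all $e_1,e_2$ in $E^\top$ composable with $e$ for which $e_1f$ and $e_2^-g$ are defined; here $e_1f$ is $f$ when $e_1$ is an identity, and otherwise it is any cell $f_1'\star_{n-1}f_2$ of $S^\ast$ such that $f=f_1\star_{n-1}f_2$, where $f_1,f_1'$ are steps of $S$ and $f_1'=e_1\star_{n-1}f_1$ holds in $R^\ast(E)$, the $n$-category generated over $R_{n-1}^\ast$ by $R$, $E$ and formal inverses of $E$; * $\mathrm{Peiffer}(E^\top,S^\ast)$ be the set of squares with faces $(f\star_i v,\ f\star_i v',\ u\star_i e,\ u'\star_i e)$ and $(w\star_i f,\ w'\star_i f,\ e'\star_i u,\ e'\star_i u')$ (top, bottom, left, right), for $0\le i\le n-2$, $f:u\to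 u'$ in $S^\ast$ and $e:v\to v'$, $e':w\to w'$ in $E^\top$. Then the square extension $E\rtimes\Gamma\,\cup\,\mathrm{Peiffer}(E^\top,S^\ast)\,\cup\,\mathrm{conf}(E)$ of the pair $(E^\top,S^\top)$ is acyclic: every square on $(E^\top,S^\top)$ is the boundary of a square $(n+1)$-cell of the free $(n-1)$-category enriched in double groupoids that it generates. Moreover, Squier's coherence theorem holds (the case where $E$ is empty): if $P$ is a terminating and confluent $n$-polygraph, $n\geq 1$, and $\Gamma$ is a cellular extension of the free $(n,n-1)$-category $P^\top$ consisting of exactly one $(n+1)$-cell $f\star_{n-1}f'\to g\star_{n-1}g'$ for each critical branching $(f,g)$ of $P$, where $(f',g')$ is an arbitrarily chosen confluence, then $\Gamma$ is acyclic: any two parallel $n$-cells of $P^\top$ are the source and the target of an $(n+1)$-cell of the free $(n+1,n-1)$-category $P^\top(\Gamma)$. -/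

import Mathlib

universe u

namespace PolyMod

/-! ### Strict globular `n`-categories -/

/-- A (small, strict, globular) `n`-category, in the single-set presentation: `Cell` is the set of
`n`-cells, a `k`-cell (`k < n`) is identified with its identity `n`-cell, `s i` and `t i` are the
`i`-source and the `i`-target, and `comp i a b` is the composite `a ⋆ᵢ b`, defined when the
`i`-target of `a` is the `i`-source of `b`. For `i ≥ n` the maps `s i` and `t i` are the identity.
The `k`-cells are the elements `a` with `s k a = a`. -/
structure NCat (n : ℕ) where
  Cell : Type u
  s : ℕ → Cell → Cell
  t : ℕ → Cell → Cell
  comp : ∀ (i : ℕ) (a b : Cell), t i a = s i b → Cell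
  s_self : ∀ i a, n ≤ i → s i a = a
  t_self : ∀ i a, n ≤ i → t i a = a
  s_s_le : ∀ i j a, i ≤ j → s j (s i a) = s i a
  t_s_le : ∀ i j a, i ≤ j → t j (s i a) = s i a
  s_t_le : ∀ i j a, i ≤ j → s j (t i a) = t i a
  t_t_le : ∀ i j a, i ≤ j → t j (t i a) = t i a
  s_s_lt : ∀ i j a, i < j → s i (s j a) = s i a
  s_t_lt : ∀ i j a, i < j → s i (t j a) = s i a
  t_s_lt : ∀ i j a, i < j → t i (s j a) = t i a
  t_t_lt : ∀ i j a, i < j → t i (t j a) = t i a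
  s_comp : ∀ i a b h, s i (comp i a b h) = s i a
  t_comp : ∀ i a b h, t i (comp i a b h) = t i b
  s_comp_lt : ∀ i j a b h h', i < j → s j (comp i a b h) = comp i (s j a) (s j b) h'
  t_comp_lt : ∀ i j a b h h', i < j → t j (comp i a b h) = comp i (t j a) (t j b) h'
  id_comp : ∀ i a h, comp i (s i a) a h = a
  comp_id : ∀ i a h, comp i a (t i a) h = a
  assoc : ∀ i a b c h₁ h₂ h₃ h₄, comp i (comp i a b h₁) c h₂ = comp i a (comp i b c h₃) h₄
  exchange : ∀ i j a b c d h₁ h₂ h₃ h₄ h₅ h₆, i < j →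
    comp i (comp j a b h₁) (comp j c d h₂) h₃ = comp j (comp i a c h₄) (comp i b d h₅) h₆

/-- The `0`-category on a set. -/
def NCat.ofSet (X : Type u) : NCat.{u} 0 where
  Cell := X
  s _ a := a
  t _ a := a
  comp _ a _ _ := a
  s_self _ _ _ := rfl
  t_self _ _ _ := rfl
  s_s_le _ _ _ _ := rfl
  t_s_le _ _ _ _ := rfl
  s_t_le _ _ _ _ := rfl
  t_t_le _ _ _ _ := rfl
  s_s_lt _ _ _ _ := rfl
  s_t_lt _ _ _ _ := rfl
  t_s_lt _ _ _ _ := rfl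
  t_t_lt _ _ _ _ := rfl
  s_comp _ _ _ _ := rfl
  t_comp _ _ _ h := h
  s_comp_lt _ _ _ _ _ _ _ := rfl
  t_comp_lt _ _ _ _ _ _ _ := rfl
  id_comp _ _ _ := rfl
  comp_id _ _ _ := rfl
  assoc _ _ _ _ _ _ _ _ := rfl
  exchange _ _ _ _ _ _ _ _ _ _ _ _ _ := rfl

theorem NCat.comp_congr {n : ℕ} (C : NCat.{u} n) (i : ℕ) {a a' b b' : C.Cell} (ha : a = a')
    (hb : b = b') (h : C.t i a = C.s i b) (h' : C.t i a' = C.s i b') :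
    C.comp i a b h = C.comp i a' b' h' := by
  subst ha hb; rfl

/-- An `(n+1)`-category with underlying `n`-category `C`: `incl` sends an `n`-cell to its identity,
`src` and `tgt` are the `n`-source and the `n`-target. -/
structure ExtCat {n : ℕ} (C : NCat.{u} n) extends NCat.{u} (n + 1) where
  incl : C.Cell → Cell
  src : Cell → C.Cell
  tgt : Cell → C.Cell
  incl_src : ∀ a, incl (src a) = s n a
  incl_tgt : ∀ a, incl (tgt a) = t n a
  src_incl : ∀ x, src (incl x) = x
  tgt_incl : ∀ x, tgt (incl x) = x
  s_incl : ∀ i x, s i (incl x) = incl (C.s i x)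
  t_incl : ∀ i x, t i (incl x) = incl (C.t i x)
  comp_incl : ∀ i x y h h', comp i (incl x) (incl y) h = incl (C.comp i x y h')

section Ext

variable {n : ℕ} {C : NCat.{u} n}

namespace ExtCat

variable (D : ExtCat C)

theorem incl_inj {x y : C.Cell} (h : D.incl x = D.incl y) : x = y := by
  rw [← D.src_incl x, h, D.src_incl]

theorem s_eq (i : ℕ) (hi : i ≤ n) (a : D.Cell) : D.s i a = D.incl (C.s i (D.src a)) := by
  rw [← D.s_incl, D.incl_src]
  rcases hi.lt_or_eq with h | h
  · exact (D.s_s_lt _ _ _ h).symm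
  · subst h; exact (D.s_s_le _ _ _ le_rfl).symm

theorem t_eq (i : ℕ) (hi : i ≤ n) (a : D.Cell) : D.t i a = D.incl (C.t i (D.tgt a)) := by
  rw [← D.t_incl, D.incl_tgt]
  rcases hi.lt_or_eq with h | h
  · exact (D.t_t_lt _ _ _ h).symm
  · subst h; exact (D.t_t_le _ _ _ le_rfl).symm

theorem s_src_tgt (i : ℕ) (hi : i < n) (a : D.Cell) : C.s i (D.src a) = C.s i (D.tgt a) := by
  apply D.incl_inj
  rw [← D.s_incl, ← D.s_incl, D.incl_src, D.incl_tgt, D.s_s_lt _ _ _ hi, D.s_t_lt _ _ _ hi]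

theorem t_src_tgt (i : ℕ) (hi : i < n) (a : D.Cell) : C.t i (D.src a) = C.t i (D.tgt a) := by
  apply D.incl_inj
  rw [← D.t_incl, ← D.t_incl, D.incl_src, D.incl_tgt, D.t_s_lt _ _ _ hi, D.t_t_lt _ _ _ hi]

theorem seq_cond {a b : D.Cell} (h : D.tgt a = D.src b) : D.t n a = D.s n b := by
  rw [← D.incl_src, ← D.incl_tgt, h]

/-- The composite `a ⋆ₙ b` of two `(n+1)`-cells along an `n`-cell. -/
def seq (a b : D.Cell) (h : D.tgt a = D.src b) : D.Cell := D.comp n a b (D.seq_cond h)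

theorem low_cond {i : ℕ} (hi : i < n) {a b : D.Cell} (h : C.t i (D.src a) = C.s i (D.src b)) :
    D.t i a = D.s i b := by
  rw [D.t_eq i hi.le, D.s_eq i hi.le, ← D.t_src_tgt i hi, h]

/-- The composite `a ⋆ᵢ b` of two `(n+1)`-cells, for `i < n`. -/
def low (i : ℕ) (hi : i < n) (a b : D.Cell) (h : C.t i (D.src a) = C.s i (D.src b)) : D.Cell :=
  D.comp i a b (D.low_cond hi h)

/-- `x ⋆ᵢ a` for an `n`-cell `x` and an `(n+1)`-cell `a`. -/
def whiskL (i : ℕ) (hi : i < n) (x : C.Cell) (a : D.Cell) (h : C.t i x = C.s i (D.src a)) :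
    D.Cell := D.low i hi (D.incl x) a (by rw [D.src_incl, h])

/-- `a ⋆ᵢ x` for an `(n+1)`-cell `a` and an `n`-cell `x`. -/
def whiskR (i : ℕ) (hi : i < n) (a : D.Cell) (x : C.Cell) (h : C.t i (D.src a) = C.s i x) :
    D.Cell := D.low i hi a (D.incl x) (by rw [D.src_incl, h])

theorem src_seq (a b : D.Cell) (h) : D.src (D.seq a b h) = D.src a := by
  apply D.incl_inj; rw [D.incl_src, D.incl_src]; exact D.s_comp _ _ _ _

theorem tgt_seq (a b : D.Cell) (h) : D.tgt (D.seq a b h) = D.tgt b := by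
  apply D.incl_inj; rw [D.incl_tgt, D.incl_tgt]; exact D.t_comp _ _ _ _

theorem src_low (i : ℕ) (hi : i < n) (a b : D.Cell) (h) :
    D.src (D.low i hi a b h) = C.comp i (D.src a) (D.src b) h := by
  apply D.incl_inj
  have h' : D.t i (D.incl (D.src a)) = D.s i (D.incl (D.src b)) := by
    rw [D.t_incl, D.s_incl, h]
  rw [D.incl_src, ← D.comp_incl i _ _ h']
  have h'' : D.t i (D.s n a) = D.s i (D.s n b) := by rw [← D.incl_src, ← D.incl_src, h']
  exact (D.s_comp_lt i n a b _ h'' hi).trans (D.comp_congr i (D.incl_src a).symm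
    (D.incl_src b).symm _ _)

theorem tgt_low (i : ℕ) (hi : i < n) (a b : D.Cell) (h) :
    D.tgt (D.low i hi a b h) = C.comp i (D.tgt a) (D.tgt b)
      (by rw [← D.t_src_tgt i hi, ← D.s_src_tgt i hi, h]) := by
  apply D.incl_inj
  have h₀ : C.t i (D.tgt a) = C.s i (D.tgt b) := by
    rw [← D.t_src_tgt i hi, ← D.s_src_tgt i hi, h]
  have h' : D.t i (D.incl (D.tgt a)) = D.s i (D.incl (D.tgt b)) := by
    rw [D.t_incl, D.s_incl, h₀]
  rw [D.incl_tgt, ← D.comp_incl i _ _ h']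
  have h'' : D.t i (D.t n a) = D.s i (D.t n b) := by rw [← D.incl_tgt, ← D.incl_tgt, h']
  exact (D.t_comp_lt i n a b _ h'' hi).trans (D.comp_congr i (D.incl_tgt a).symm
    (D.incl_tgt b).symm _ _)

/-- `b` is the inverse of the `(n+1)`-cell `a` for the composition `⋆ₙ`. -/
def IsInverse (a b : D.Cell) : Prop :=
  ∃ (h : D.tgt a = D.src b) (h' : D.tgt b = D.src a),
    D.seq a b h = D.incl (D.src a) ∧ D.seq b a h' = D.incl (D.tgt a)

end ExtCat

/-! ### Cellular extensions and the categories they generate -/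

/-- A cellular extension of an `n`-category: a set of generators with a map to `n`-spheres. -/
structure CellExt {n : ℕ} (C : NCat.{u} n) where
  Gen : Type u
  src : Gen → C.Cell
  tgt : Gen → C.Cell
  s_eq : ∀ γ, ∀ i < n, C.s i (src γ) = C.s i (tgt γ)
  t_eq : ∀ γ, ∀ i < n, C.t i (src γ) = C.t i (tgt γ)

/-- The formal composites of generators of `Γ` and identities, with their boundary. -/
inductive Term (Γ : CellExt C) : C.Cell → C.Cell → Type u
  | idn (x : C.Cell) : Term Γ x x
  | gen (γ : Γ.Gen) : Term Γ (Γ.src γ) (Γ.tgt γ)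
  | top {x y z : C.Cell} (a : Term Γ x y) (b : Term Γ y z) : Term Γ x z
  | low (i : ℕ) (hi : i < n) {x y x' y' : C.Cell} (a : Term Γ x y) (b : Term Γ x' y')
      (h : C.t i x = C.s i x') (h' : C.t i y = C.s i y') :
      Term Γ (C.comp i x x' h) (C.comp i y y' h')

/-- The congruence on formal composites generated by the axioms of `(n+1)`-categories and by
the relations `K`. -/
inductive Rel (Γ : CellExt C) (K : ∀ x y, Term Γ x y → Term Γ x y → Prop) :
    ∀ {x y x' y' : C.Cell}, Term Γ x y → Term Γ x' y' → Prop
  | refl {x y} (a : Term Γ x y) : Rel Γ K a a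
  | symm {x y x' y'} {a : Term Γ x y} {b : Term Γ x' y'} : Rel Γ K a b → Rel Γ K b a
  | trans {x y x' y' x'' y''} {a : Term Γ x y} {b : Term Γ x' y'} {c : Term Γ x'' y''} :
      Rel Γ K a b → Rel Γ K b c → Rel Γ K a c
  | rel {x y} {a b : Term Γ x y} : K x y a b → Rel Γ K a b
  | top_congr {x y z x' y' z'} {a : Term Γ x y} {b : Term Γ y z} {a' : Term Γ x' y'}
      {b' : Term Γ y' z'} : Rel Γ K a a' → Rel Γ K b b' → Rel Γ K (a.top b) (a'.top b')
  | low_congr (i hi) {x y z w x' y' z' w'} {a : Term Γ x y} {b : Term Γ z w}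
      {a' : Term Γ x' y'} {b' : Term Γ z' w'} (h₁ h₂ h₃ h₄) :
      Rel Γ K a a' → Rel Γ K b b' →
        Rel Γ K (Term.low i hi a b h₁ h₂) (Term.low i hi a' b' h₃ h₄)
  | idn_top {x y} (a : Term Γ x y) : Rel Γ K ((Term.idn x).top a) a
  | top_idn {x y} (a : Term Γ x y) : Rel Γ K (a.top (Term.idn y)) a
  | top_assoc {x y z w} (a : Term Γ x y) (b : Term Γ y z) (c : Term Γ z w) :
      Rel Γ K ((a.top b).top c) (a.top (b.top c))
  | idn_low (i hi) {x y} (a : Term Γ x y) (h h') :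
      Rel Γ K (Term.low i hi (Term.idn (C.s i x)) a h h') a
  | low_idn (i hi) {x y} (a : Term Γ x y) (h h') :
      Rel Γ K (Term.low i hi a (Term.idn (C.t i x)) h h') a
  | low_assoc (i hi) {x y x' y' x'' y''} (a : Term Γ x y) (b : Term Γ x' y')
      (c : Term Γ x'' y'') (h₁ h₂ h₃ h₄ h₅ h₆ h₇ h₈) :
      Rel Γ K (Term.low i hi (Term.low i hi a b h₁ h₂) c h₃ h₄)
        (Term.low i hi a (Term.low i hi b c h₅ h₆) h₇ h₈)
  | idn_idn (i hi) (x y : C.Cell) (h h') :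
      Rel Γ K (Term.low i hi (Term.idn x) (Term.idn y) h h') (Term.idn (C.comp i x y h))
  | low_top (i hi) {x y z x' y' z'} (a : Term Γ x y) (b : Term Γ y z) (c : Term Γ x' y')
      (d : Term Γ y' z') (h₁ h₂ h₃) :
      Rel Γ K (Term.low i hi (a.top b) (c.top d) h₁ h₂)
        ((Term.low i hi a c h₁ h₃).top (Term.low i hi b d h₃ h₂))
  | low_low (i j hi hj) (hij : i < j) {x₁ y₁ x₂ y₂ x₃ y₃ x₄ y₄} (a : Term Γ x₁ y₁)
      (b : Term Γ x₂ y₂) (c : Term Γ x₃ y₃) (d : Term Γ x₄ y₄)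
      (h₁ h₂ h₃ h₄ h₅ h₆ h₇ h₈ h₉ h₁₀ h₁₁ h₁₂) :
      Rel Γ K (Term.low i hi (Term.low j hj a b h₁ h₂) (Term.low j hj c d h₃ h₄) h₅ h₆)
        (Term.low j hj (Term.low i hi a c h₇ h₈) (Term.low i hi b d h₉ h₁₀) h₁₁ h₁₂)

theorem Term.par {Γ : CellExt C} {x y : C.Cell} (a : Term Γ x y) :
    ∀ i < n, C.s i x = C.s i y ∧ C.t i x = C.t i y := by
  induction a with
  | idn x => exact fun _ _ => ⟨rfl, rfl⟩
  | gen γ => exact fun i hi => ⟨Γ.s_eq γ i hi, Γ.t_eq γ i hi⟩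
  | top a b iha ihb =>
    exact fun i hi => ⟨(iha i hi).1.trans (ihb i hi).1, (iha i hi).2.trans (ihb i hi).2⟩
  | low j hj a b h h' iha ihb =>
    intro i hi
    rcases lt_trichotomy i j with hij | hij | hij
    · constructor
      · rw [← C.s_s_lt i j _ hij, C.s_comp, ← C.s_s_lt i j (C.comp _ _ _ h') hij, C.s_comp,
          C.s_s_lt _ _ _ hij, C.s_s_lt _ _ _ hij, (iha i hi).1]
      · rw [← C.t_t_lt i j _ hij, C.t_comp, ← C.t_t_lt i j (C.comp _ _ _ h') hij, C.t_comp,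
          C.t_t_lt _ _ _ hij, C.t_t_lt _ _ _ hij, (ihb i hi).2]
    · subst hij
      rw [C.s_comp, C.s_comp, C.t_comp, C.t_comp]
      exact ⟨(iha i hi).1, (ihb i hi).2⟩
    · have key : ∀ x y : C.Cell, C.t j x = C.s j y →
          C.t j (C.s i x) = C.s j (C.s i y) ∧ C.t j (C.t i x) = C.s j (C.t i y) := by
        intro x y h
        rw [C.t_s_lt _ _ _ hij, C.s_s_lt _ _ _ hij, C.t_t_lt _ _ _ hij, C.s_t_lt _ _ _ hij]
        exact ⟨h, h⟩
      rw [C.s_comp_lt j i _ _ _ (key _ _ h).1 hij, C.s_comp_lt j i _ _ _ (key _ _ h').1 hij,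
        C.t_comp_lt j i _ _ _ (key _ _ h).2 hij, C.t_comp_lt j i _ _ _ (key _ _ h').2 hij]
      exact ⟨C.comp_congr _ (iha i hi).1 (ihb i hi).1 _ _,
        C.comp_congr _ (iha i hi).2 (ihb i hi).2 _ _⟩

theorem Rel.bd {Γ : CellExt C} {K} {x y x' y' : C.Cell} {a : Term Γ x y} {b : Term Γ x' y'}
    (r : Rel Γ K a b) : x = x' ∧ y = y' := by
  induction r with
  | refl => exact ⟨rfl, rfl⟩
  | symm _ ih => exact ⟨ih.1.symm, ih.2.symm⟩
  | trans _ _ ih₁ ih₂ => exact ⟨ih₁.1.trans ih₂.1, ih₁.2.trans ih₂.2⟩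
  | rel => exact ⟨rfl, rfl⟩
  | top_congr _ _ ih₁ ih₂ => exact ⟨ih₁.1, ih₂.2⟩
  | low_congr i hi _ _ _ _ _ _ ih₁ ih₂ =>
    exact ⟨C.comp_congr _ ih₁.1 ih₂.1 _ _, C.comp_congr _ ih₁.2 ih₂.2 _ _⟩
  | idn_top => exact ⟨rfl, rfl⟩
  | top_idn => exact ⟨rfl, rfl⟩
  | top_assoc => exact ⟨rfl, rfl⟩
  | idn_low i hi a h h' =>
    refine ⟨C.id_comp _ _ _, ?_⟩
    exact (C.comp_congr i (a.par i hi).1 rfl h' (by rw [C.t_s_le _ _ _ le_rfl])).trans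
      (C.id_comp _ _ _)
  | low_idn i hi a h h' =>
    refine ⟨C.comp_id _ _ _, ?_⟩
    exact (C.comp_congr i rfl (a.par i hi).2 h' (by rw [C.s_t_le _ _ _ le_rfl])).trans
      (C.comp_id _ _ _)
  | low_assoc => exact ⟨C.assoc _ _ _ _ _ _ _ _, C.assoc _ _ _ _ _ _ _ _⟩
  | idn_idn => exact ⟨rfl, rfl⟩
  | low_top => exact ⟨rfl, rfl⟩
  | low_low i j hi hj hij =>
    exact ⟨C.exchange _ _ _ _ _ _ _ _ _ _ _ _ hij, C.exchange _ _ _ _ _ _ _ _ _ _ _ _ hij⟩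

/-- A formal composite together with its boundary. -/
structure PTerm (Γ : CellExt C) where
  x : C.Cell
  y : C.Cell
  tm : Term Γ x y

/-- Formal composites up to the congruence `Rel Γ K`. -/
def relSetoid (Γ : CellExt C) (K : ∀ x y, Term Γ x y → Term Γ x y → Prop) :
    Setoid (PTerm Γ) where
  r a b := Rel Γ K a.tm b.tm
  iseqv := ⟨fun _ => .refl _, fun h => .symm h, fun h₁ h₂ => .trans h₁ h₂⟩

open Classical in
/-- Composition of formal composites (with a dummy value when they are not composable). -/
noncomputable def PTerm.comp {Γ : CellExt C} (i : ℕ) (a b : PTerm Γ) : PTerm Γ :=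
  if hi : i < n then
    if h : C.t i a.x = C.s i b.x ∧ C.t i a.y = C.s i b.y then
      ⟨_, _, Term.low i hi a.tm b.tm h.1 h.2⟩ else a
  else if i = n then
    if h : a.y = b.x then ⟨a.x, b.y, a.tm.top (h ▸ b.tm)⟩ else a
  else a


section Present

variable (Γ : CellExt C) (K : ∀ x y, Term Γ x y → Term Γ x y → Prop)

/-- The `(n+1)`-cells generated by `Γ` modulo the relations `K`. -/
def PCell : Type u := Quotient (relSetoid Γ K)

/-- The class of a formal composite. -/
def PCell.mk {x y : C.Cell} (a : Term Γ x y) : PCell Γ K := Quotient.mk (relSetoid Γ K) ⟨x, y, a⟩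

variable {Γ K}

theorem PCell.ind {p : PCell Γ K → Prop} (h : ∀ {x y} (a : Term Γ x y), p (PCell.mk Γ K a))
    (A : PCell Γ K) : p A := Quotient.inductionOn A fun a => h a.tm

theorem PCell.sound {x y x' y' : C.Cell} {a : Term Γ x y} {b : Term Γ x' y'} (h : Rel Γ K a b) :
    PCell.mk Γ K a = PCell.mk Γ K b := Quotient.sound (s := relSetoid Γ K) h

/-- The `n`-source. -/
def PCell.src (A : PCell Γ K) : C.Cell := Quotient.lift PTerm.x (fun _ _ h => (Rel.bd h).1) A

/-- The `n`-target. -/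
def PCell.tgt (A : PCell Γ K) : C.Cell := Quotient.lift PTerm.y (fun _ _ h => (Rel.bd h).2) A

theorem PTerm.comp_congr (i : ℕ) (a b a' b' : PTerm Γ) (ha : Rel Γ K a.tm a'.tm)
    (hb : Rel Γ K b.tm b'.tm) : Rel Γ K (a.comp i b).tm (a'.comp i b').tm := by
  obtain ⟨x, y, a⟩ := a
  obtain ⟨z, w, b⟩ := b
  obtain ⟨x', y', a'⟩ := a'
  obtain ⟨z', w', b'⟩ := b'
  obtain ⟨rfl, rfl⟩ := ha.bd
  obtain ⟨rfl, rfl⟩ := hb.bd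
  change Rel Γ K a a' at ha
  change Rel Γ K b b' at hb
  unfold PTerm.comp
  by_cases h₁ : i < n
  · rw [dif_pos h₁, dif_pos h₁]
    by_cases h₂ : C.t i x = C.s i z ∧ C.t i y = C.s i w
    · rw [dif_pos h₂, dif_pos h₂]; exact Rel.low_congr _ _ _ _ _ _ ha hb
    · rw [dif_neg h₂, dif_neg h₂]; exact ha
  · rw [dif_neg h₁, dif_neg h₁]
    by_cases h₃ : i = n
    · rw [if_pos h₃, if_pos h₃]
      by_cases h₄ : y = z
      · subst h₄; rw [dif_pos rfl, dif_pos rfl]; exact Rel.top_congr ha hb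
      · rw [dif_neg h₄, dif_neg h₄]; exact ha
    · rw [if_neg h₃, if_neg h₃]; exact ha

/-- Composition of generated cells (with a dummy value when they are not composable). -/
noncomputable def PCell.comp (i : ℕ) (A B : PCell Γ K) : PCell Γ K :=
  Quotient.map₂ (sa := relSetoid Γ K) (sb := relSetoid Γ K) (sc := relSetoid Γ K) (PTerm.comp i)
    (fun _ _ ha _ _ hb => PTerm.comp_congr i _ _ _ _ ha hb) A B

theorem PCell.comp_low (i : ℕ) (hi : i < n) {x y x' y' : C.Cell} (a : Term Γ x y)
    (b : Term Γ x' y') (h : C.t i x = C.s i x') (h' : C.t i y = C.s i y') :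
    PCell.comp i (PCell.mk Γ K a) (PCell.mk Γ K b) = PCell.mk Γ K (Term.low i hi a b h h') := by
  change Quotient.mk (relSetoid Γ K) (PTerm.comp i ⟨x, y, a⟩ ⟨x', y', b⟩) = _
  rw [PTerm.comp, dif_pos hi, dif_pos ⟨h, h'⟩]; rfl

theorem PCell.comp_top {x y z : C.Cell} (a : Term Γ x y) (b : Term Γ y z) :
    PCell.comp n (PCell.mk Γ K a) (PCell.mk Γ K b) = PCell.mk Γ K (a.top b) := by
  change Quotient.mk (relSetoid Γ K) (PTerm.comp n ⟨x, y, a⟩ ⟨y, z, b⟩) = _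
  rw [PTerm.comp, dif_neg (lt_irrefl n), if_pos rfl, dif_pos rfl]; rfl

theorem PCell.comp_high (i : ℕ) (hi : n < i) (A B : PCell Γ K) : PCell.comp i A B = A := by
  induction A using PCell.ind with | @h x₁ y₁ a
  induction B using PCell.ind with | @h x₂ y₂ b
  change Quotient.mk (relSetoid Γ K) (PTerm.comp i ⟨_, _, a⟩ ⟨_, _, b⟩) = _
  rw [PTerm.comp, dif_neg hi.le.not_gt, if_neg hi.ne']; rfl

open Classical in
/-- The `i`-source. -/
noncomputable def PCell.s (i : ℕ) (A : PCell Γ K) : PCell Γ K :=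
  if i ≤ n then PCell.mk Γ K (Term.idn (C.s i A.src)) else A

open Classical in
/-- The `i`-target. -/
noncomputable def PCell.t (i : ℕ) (A : PCell Γ K) : PCell Γ K :=
  if i ≤ n then PCell.mk Γ K (Term.idn (C.t i A.tgt)) else A

theorem PCell.s_le {i : ℕ} (hi : i ≤ n) (A : PCell Γ K) :
    A.s i = PCell.mk Γ K (Term.idn (C.s i A.src)) := if_pos hi

theorem PCell.t_le {i : ℕ} (hi : i ≤ n) (A : PCell Γ K) :
    A.t i = PCell.mk Γ K (Term.idn (C.t i A.tgt)) := if_pos hi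

theorem PCell.s_gt {i : ℕ} (hi : n < i) (A : PCell Γ K) : A.s i = A := if_neg hi.not_ge

theorem PCell.t_gt {i : ℕ} (hi : n < i) (A : PCell Γ K) : A.t i = A := if_neg hi.not_ge

theorem PCell.idn_inj {x y : C.Cell} :
    PCell.mk Γ K (Term.idn x) = PCell.mk Γ K (Term.idn y) ↔ x = y :=
  ⟨fun h => congrArg PCell.src h, fun h => h ▸ rfl⟩

theorem PCell.s_src_tgt (A : PCell Γ K) {i : ℕ} (hi : i < n) : C.s i A.src = C.s i A.tgt := by
  induction A using PCell.ind with | @h x₁ y₁ a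
  exact (a.par i hi).1

theorem PCell.t_src_tgt (A : PCell Γ K) {i : ℕ} (hi : i < n) : C.t i A.src = C.t i A.tgt := by
  induction A using PCell.ind with | @h x₁ y₁ a
  exact (a.par i hi).2

theorem PCell.cond_low {A B : PCell Γ K} {i : ℕ} (hi : i < n) (h : A.t i = B.s i) :
    C.t i A.src = C.s i B.src ∧ C.t i A.tgt = C.s i B.tgt := by
  rw [PCell.t_le hi.le, PCell.s_le hi.le, PCell.idn_inj] at h
  rw [A.t_src_tgt hi, ← B.s_src_tgt hi]
  exact ⟨h, h⟩

theorem PCell.cond_top {A B : PCell Γ K} (h : A.t n = B.s n) : A.tgt = B.src := by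
  rwa [PCell.t_le le_rfl, PCell.s_le le_rfl, PCell.idn_inj, C.t_self _ _ le_rfl,
    C.s_self _ _ le_rfl] at h

theorem PCell.cond_high {A B : PCell Γ K} {i : ℕ} (hi : n < i) (h : A.t i = B.s i) : A = B := by
  rwa [PCell.t_gt hi, PCell.s_gt hi] at h

theorem PCell.src_comp_low {A B : PCell Γ K} {i : ℕ} (hi : i < n) (h : A.t i = B.s i) :
    (A.comp i B).src = C.comp i A.src B.src (PCell.cond_low hi h).1 := by
  have h' := PCell.cond_low hi h
  induction A using PCell.ind with | @h x₁ y₁ a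
  induction B using PCell.ind with | @h x₂ y₂ b
  exact congrArg PCell.src (PCell.comp_low i hi a b h'.1 h'.2)

theorem PCell.tgt_comp_low {A B : PCell Γ K} {i : ℕ} (hi : i < n) (h : A.t i = B.s i) :
    (A.comp i B).tgt = C.comp i A.tgt B.tgt (PCell.cond_low hi h).2 := by
  have h' := PCell.cond_low hi h
  induction A using PCell.ind with | @h x₁ y₁ a
  induction B using PCell.ind with | @h x₂ y₂ b
  exact congrArg PCell.tgt (PCell.comp_low i hi a b h'.1 h'.2)

theorem PCell.src_comp_top {A B : PCell Γ K} (h : A.t n = B.s n) :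
    (A.comp n B).src = A.src := by
  have h' := PCell.cond_top h
  induction A using PCell.ind with | @h x₁ y₁ a
  induction B using PCell.ind with | @h x₂ y₂ b
  obtain rfl : y₁ = x₂ := h'
  exact (congrArg PCell.src (PCell.comp_top (K := K) a b)).trans rfl

theorem PCell.tgt_comp_top {A B : PCell Γ K} (h : A.t n = B.s n) :
    (A.comp n B).tgt = B.tgt := by
  have h' := PCell.cond_top h
  induction A using PCell.ind with | @h x₁ y₁ a
  induction B using PCell.ind with | @h x₂ y₂ b
  obtain rfl : y₁ = x₂ := h'
  exact (congrArg PCell.tgt (PCell.comp_top (K := K) a b)).trans rfl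

theorem PCell.cond_mk {i : ℕ} (hi : i < n) {x y x' y' : C.Cell} {a : Term Γ x y}
    {b : Term Γ x' y'} (h : (PCell.mk Γ K a).t i = (PCell.mk Γ K b).s i) :
    C.t i x = C.s i x' ∧ C.t i y = C.s i y' := PCell.cond_low hi h

theorem PCell.comp_lowE (i : ℕ) (hi : i < n) {x y x' y' : C.Cell} (a : Term Γ x y)
    (b : Term Γ x' y') (h : (PCell.mk Γ K a).t i = (PCell.mk Γ K b).s i) :
    PCell.comp i (PCell.mk Γ K a) (PCell.mk Γ K b) =
      PCell.mk Γ K (Term.low i hi a b (PCell.cond_mk hi h).1 (PCell.cond_mk hi h).2) :=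
  PCell.comp_low i hi a b _ _

variable (Γ K)

/-- The `(n+1)`-category generated by `Γ` over the `n`-category `C`, modulo the relations `K`. -/
noncomputable def present : ExtCat C where
  Cell := PCell Γ K
  s := PCell.s
  t := PCell.t
  comp i A B _ := A.comp i B
  s_self i A hi := PCell.s_gt hi A
  t_self i A hi := PCell.t_gt hi A
  s_s_le i j A hij := by
    rcases le_or_gt j n with h | h
    · rw [PCell.s_le h, PCell.s_le (hij.trans h)]; exact PCell.idn_inj.2 (C.s_s_le _ _ _ hij)
    · exact PCell.s_gt h _
  t_s_le i j A hij := by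
    rcases le_or_gt j n with h | h
    · rw [PCell.t_le h, PCell.s_le (hij.trans h)]; exact PCell.idn_inj.2 (C.t_s_le _ _ _ hij)
    · exact PCell.t_gt h _
  s_t_le i j A hij := by
    rcases le_or_gt j n with h | h
    · rw [PCell.s_le h, PCell.t_le (hij.trans h)]; exact PCell.idn_inj.2 (C.s_t_le _ _ _ hij)
    · exact PCell.s_gt h _
  t_t_le i j A hij := by
    rcases le_or_gt j n with h | h
    · rw [PCell.t_le h, PCell.t_le (hij.trans h)]; exact PCell.idn_inj.2 (C.t_t_le _ _ _ hij)
    · exact PCell.t_gt h _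
  s_s_lt i j A hij := by
    rcases le_or_gt j n with h | h
    · rw [PCell.s_le (hij.le.trans h), PCell.s_le h, PCell.s_le (hij.le.trans h)]
      exact PCell.idn_inj.2 (C.s_s_lt _ _ _ hij)
    · rw [PCell.s_gt h]
  s_t_lt i j A hij := by
    rcases le_or_gt j n with h | h
    · rw [PCell.s_le (hij.le.trans h), PCell.t_le h, PCell.s_le (hij.le.trans h)]
      exact PCell.idn_inj.2 ((C.s_t_lt _ _ _ hij).trans (A.s_src_tgt (hij.trans_le h)).symm)
    · rw [PCell.t_gt h]
  t_s_lt i j A hij := by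
    rcases le_or_gt j n with h | h
    · rw [PCell.t_le (hij.le.trans h), PCell.s_le h, PCell.t_le (hij.le.trans h)]
      exact PCell.idn_inj.2 ((C.t_s_lt _ _ _ hij).trans (A.t_src_tgt (hij.trans_le h)))
    · rw [PCell.s_gt h]
  t_t_lt i j A hij := by
    rcases le_or_gt j n with h | h
    · rw [PCell.t_le (hij.le.trans h), PCell.t_le h, PCell.t_le (hij.le.trans h)]
      exact PCell.idn_inj.2 (C.t_t_lt _ _ _ hij)
    · rw [PCell.t_gt h]
  s_comp i A B h := by
    rcases lt_trichotomy i n with hi | hi | hi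
    · rw [PCell.s_le hi.le, PCell.s_le hi.le, PCell.src_comp_low hi h, C.s_comp]
    · subst hi; rw [PCell.s_le le_rfl, PCell.s_le le_rfl, PCell.src_comp_top h]
    · rw [PCell.comp_high i hi]
  t_comp i A B h := by
    rcases lt_trichotomy i n with hi | hi | hi
    · rw [PCell.t_le hi.le, PCell.t_le hi.le, PCell.tgt_comp_low hi h, C.t_comp]
    · subst hi; rw [PCell.t_le le_rfl, PCell.t_le le_rfl, PCell.tgt_comp_top h]
    · rw [PCell.comp_high i hi, PCell.cond_high hi h]
  s_comp_lt i j A B h h' hij := by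
    rcases le_or_gt j n with hj | hj
    · have hi := hij.trans_le hj
      rw [PCell.s_le hj, PCell.s_le hj] at h'
      rw [PCell.s_le hj, PCell.s_le hj, PCell.s_le hj, PCell.src_comp_low hi h]
      rw [PCell.comp_lowE i hi _ _ h', PCell.sound (Rel.idn_idn i hi _ _ _ _), PCell.idn_inj]
      exact C.s_comp_lt _ _ _ _ _ _ hij
    · rw [PCell.s_gt hj, PCell.s_gt hj, PCell.s_gt hj]
  t_comp_lt i j A B h h' hij := by
    rcases le_or_gt j n with hj | hj
    · have hi := hij.trans_le hj
      rw [PCell.t_le hj, PCell.t_le hj] at h'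
      rw [PCell.t_le hj, PCell.t_le hj, PCell.t_le hj, PCell.tgt_comp_low hi h]
      rw [PCell.comp_lowE i hi _ _ h', PCell.sound (Rel.idn_idn i hi _ _ _ _), PCell.idn_inj]
      exact C.t_comp_lt _ _ _ _ _ _ hij
    · rw [PCell.t_gt hj, PCell.t_gt hj, PCell.t_gt hj]
  id_comp i A h := by
    rcases lt_trichotomy i n with hi | hi | hi
    · induction A using PCell.ind with | @h x₁ y₁ a
      have e : (PCell.mk Γ K a).s i = PCell.mk Γ K (Term.idn (C.s i x₁)) := PCell.s_le hi.le _
      rw [e]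
      rw [PCell.comp_lowE i hi (Term.idn (C.s i x₁)) a (by rw [← e]; exact h)]
      exact PCell.sound (Rel.idn_low i hi a _ _)
    · subst hi
      rw [PCell.s_le le_rfl, C.s_self _ _ le_rfl]
      induction A using PCell.ind with | @h x₁ y₁ a
      exact (PCell.comp_top _ _).trans (PCell.sound (Rel.idn_top a))
    · rw [PCell.comp_high i hi, PCell.s_gt hi]
  comp_id i A h := by
    rcases lt_trichotomy i n with hi | hi | hi
    · induction A using PCell.ind with | @h x₁ y₁ a
      have e : (PCell.mk Γ K a).t i = PCell.mk Γ K (Term.idn (C.t i x₁)) := by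
        rw [PCell.t_le hi.le, ← PCell.t_src_tgt _ hi]; rfl
      rw [e]
      rw [PCell.comp_lowE i hi a (Term.idn (C.t i x₁)) (by rw [← e]; exact h)]
      exact PCell.sound (Rel.low_idn i hi a _ _)
    · subst hi
      rw [PCell.t_le le_rfl, C.t_self _ _ le_rfl]
      induction A using PCell.ind with | @h x₁ y₁ a
      exact (PCell.comp_top _ _).trans (PCell.sound (Rel.top_idn a))
    · rw [PCell.comp_high i hi]
  assoc i A B D h₁ h₂ h₃ h₄ := by
    rcases lt_trichotomy i n with hi | hi | hi
    · induction A using PCell.ind with | @h x₁ y₁ a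
      induction B using PCell.ind with | @h x₂ y₂ b
      induction D using PCell.ind with | @h x₃ y₃ d
      rw [PCell.comp_lowE i hi _ _ h₁] at h₂ ⊢
      rw [PCell.comp_lowE i hi _ _ h₃] at h₄ ⊢
      rw [PCell.comp_lowE i hi _ _ h₂, PCell.comp_lowE i hi _ _ h₄]
      exact PCell.sound (Rel.low_assoc i hi a b d _ _ _ _ _ _ _ _)
    · subst hi
      have e₁ := PCell.cond_top h₁
      have e₃ := PCell.cond_top h₃
      induction A using PCell.ind with | @h x₁ y₁ a
      induction B using PCell.ind with | @h x₂ y₂ b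
      induction D using PCell.ind with | @h x₃ y₃ d
      obtain rfl : y₁ = x₂ := e₁
      obtain rfl : y₂ = x₃ := e₃
      rw [PCell.comp_top, PCell.comp_top, PCell.comp_top, PCell.comp_top]
      exact PCell.sound (Rel.top_assoc a b d)
    · rw [PCell.comp_high i hi, PCell.comp_high i hi, PCell.comp_high i hi]
  exchange i j A B D E h₁ h₂ h₃ h₄ h₅ h₆ hij := by
    rcases lt_trichotomy j n with hj | hj | hj
    · have hi := hij.trans hj
      induction A using PCell.ind with | @h x₁ y₁ a
      induction B using PCell.ind with | @h x₂ y₂ b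
      induction D using PCell.ind with | @h x₃ y₃ d
      induction E using PCell.ind with | @h x₄ y₄ e
      rw [PCell.comp_lowE j hj _ _ h₁, PCell.comp_lowE j hj _ _ h₂] at h₃ ⊢
      rw [PCell.comp_lowE i hi _ _ h₄, PCell.comp_lowE i hi _ _ h₅] at h₆ ⊢
      rw [PCell.comp_lowE i hi _ _ h₃, PCell.comp_lowE j hj _ _ h₆]
      exact PCell.sound (Rel.low_low i j hi hj hij a b d e _ _ _ _ _ _ _ _ _ _ _ _)
    · subst hj
      have e₁ := PCell.cond_top h₁
      have e₂ := PCell.cond_top h₂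
      induction A using PCell.ind with | @h x₁ y₁ a
      induction B using PCell.ind with | @h x₂ y₂ b
      induction D using PCell.ind with | @h x₃ y₃ d
      induction E using PCell.ind with | @h x₄ y₄ e
      obtain rfl : y₁ = x₂ := e₁
      obtain rfl : y₃ = x₄ := e₂
      rw [PCell.comp_top, PCell.comp_top, PCell.comp_lowE i hij _ _ h₄,
        PCell.comp_lowE i hij _ _ h₅, PCell.comp_low i hij (a.top b) (d.top e)
        (PCell.cond_mk hij h₄).1 (PCell.cond_mk hij h₅).2, PCell.comp_top]
      exact PCell.sound (Rel.low_top i hij a b d e _ _ _)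
    · rw [PCell.comp_high j hj, PCell.comp_high j hj, PCell.comp_high j hj]
  incl x := PCell.mk Γ K (Term.idn x)
  src := PCell.src
  tgt := PCell.tgt
  incl_src A := by rw [PCell.s_le le_rfl, C.s_self _ _ le_rfl]
  incl_tgt A := by rw [PCell.t_le le_rfl, C.t_self _ _ le_rfl]
  src_incl _ := rfl
  tgt_incl _ := rfl
  s_incl i x := by
    rcases le_or_gt i n with h | h
    · exact PCell.s_le h _
    · rw [PCell.s_gt h, C.s_self _ _ h.le]
  t_incl i x := by
    rcases le_or_gt i n with h | h
    · exact PCell.t_le h _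
    · rw [PCell.t_gt h, C.t_self _ _ h.le]
  comp_incl i x y h h' := by
    rcases lt_trichotomy i n with hi | hi | hi
    · rw [PCell.comp_lowE i hi _ _ h]
      exact PCell.sound (Rel.idn_idn i hi x y _ _)
    · have e : x = y := by rwa [C.t_self _ _ hi.ge, C.s_self _ _ hi.ge] at h'
      subst e hi
      rw [PCell.comp_top, PCell.sound (Rel.idn_top _), PCell.idn_inj]
      exact ((C.comp_congr i (C.s_self _ _ le_rfl).symm rfl _
        (by rw [C.t_s_le _ _ _ le_rfl])).trans (C.id_comp i x _)).symm
    · have e : x = y := by rwa [C.t_self _ _ hi.le, C.s_self _ _ hi.le] at h'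
      subst e
      rw [PCell.comp_high i hi, PCell.idn_inj]
      exact ((C.comp_congr i (C.s_self _ _ hi.le).symm rfl _
        (by rw [C.t_s_le _ _ _ le_rfl])).trans (C.id_comp i x _)).symm

/-- A generator, as a cell of the category it generates. -/
def genCell (γ : Γ.Gen) : (present Γ K).Cell := PCell.mk Γ K (Term.gen γ)

end Present


/-! ### Universal property -/

section Lift

variable {Γ : CellExt C} (D : ExtCat C) (φ : Γ.Gen → D.Cell)
  (hs : ∀ γ, D.src (φ γ) = Γ.src γ) (ht : ∀ γ, D.tgt (φ γ) = Γ.tgt γ)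

/-- Evaluation of formal composites in an `(n+1)`-category `D` over `C`. -/
def Term.eval : ∀ {x y : C.Cell}, Term Γ x y → {d : D.Cell // D.src d = x ∧ D.tgt d = y}
  | _, _, .idn x => ⟨D.incl x, D.src_incl x, D.tgt_incl x⟩
  | _, _, .gen γ => ⟨φ γ, hs γ, ht γ⟩
  | _, _, .top a b =>
    ⟨D.seq a.eval.1 b.eval.1 (a.eval.2.2.trans b.eval.2.1.symm),
      (D.src_seq _ _ _).trans a.eval.2.1, (D.tgt_seq _ _ _).trans b.eval.2.2⟩
  | _, _, .low i hi a b h h' =>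
    ⟨D.low i hi a.eval.1 b.eval.1 (by rw [a.eval.2.1, b.eval.2.1, h]),
      (D.src_low i hi _ _ _).trans (C.comp_congr i a.eval.2.1 b.eval.2.1 _ _),
      (D.tgt_low i hi _ _ _).trans (C.comp_congr i a.eval.2.2 b.eval.2.2 _ _)⟩

theorem ExtCat.seq_congr {a a' b b' : D.Cell} (ha : a = a') (hb : b = b')
    (h : D.tgt a = D.src b) (h' : D.tgt a' = D.src b') : D.seq a b h = D.seq a' b' h' := by
  subst ha hb; rfl

theorem ExtCat.low_congr (i : ℕ) (hi : i < n) {a a' b b' : D.Cell} (ha : a = a') (hb : b = b')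
    (h : C.t i (D.src a) = C.s i (D.src b)) (h' : C.t i (D.src a') = C.s i (D.src b')) :
    D.low i hi a b h = D.low i hi a' b' h' := by
  subst ha hb; rfl

theorem ExtCat.idn_seq (x : C.Cell) (a : D.Cell) (h) : D.seq (D.incl x) a h = a := by
  have e : x = D.src a := by rw [← h, D.tgt_incl]
  subst e
  have h₀ : D.t n (D.s n a) = D.s n a := D.t_s_le _ _ _ le_rfl
  exact (D.comp_congr n (D.incl_src a) rfl _ h₀).trans (D.id_comp n a h₀)

theorem ExtCat.seq_idn (a : D.Cell) (x : C.Cell) (h) : D.seq a (D.incl x) h = a := by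
  have e : x = D.tgt a := by rw [h, D.src_incl]
  subst e
  have h₀ : D.t n a = D.s n (D.t n a) := (D.s_t_le _ _ _ le_rfl).symm
  exact (D.comp_congr n rfl (D.incl_tgt a) _ h₀).trans (D.comp_id n a h₀)

theorem ExtCat.seq_assoc (a b c : D.Cell) (h₁ h₂ h₃ h₄) :
    D.seq (D.seq a b h₁) c h₂ = D.seq a (D.seq b c h₃) h₄ := D.assoc _ _ _ _ _ _ _ _

theorem ExtCat.low_assoc (i : ℕ) (hi : i < n) (a b c : D.Cell) (h₁ h₂ h₃ h₄) :
    D.low i hi (D.low i hi a b h₁) c h₂ = D.low i hi a (D.low i hi b c h₃) h₄ :=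
  D.assoc _ _ _ _ _ _ _ _

theorem ExtCat.idn_low (i : ℕ) (hi : i < n) (x : C.Cell) (a : D.Cell)
    (hx : x = C.s i (D.src a)) (h) : D.low i hi (D.incl x) a h = a := by
  subst hx
  have e : D.s i a = D.incl (C.s i (D.src a)) := D.s_eq i hi.le a
  have h₀ : D.t i (D.s i a) = D.s i a := D.t_s_le _ _ _ le_rfl
  exact (D.comp_congr i e.symm rfl _ h₀).trans (D.id_comp i a h₀)

theorem ExtCat.low_idn (i : ℕ) (hi : i < n) (a : D.Cell) (x : C.Cell)
    (hx : x = C.t i (D.src a)) (h) : D.low i hi a (D.incl x) h = a := by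
  subst hx
  have e : D.t i a = D.incl (C.t i (D.src a)) := by rw [D.t_eq i hi.le, D.t_src_tgt i hi]
  have h₀ : D.t i a = D.s i (D.t i a) := (D.s_t_le _ _ _ le_rfl).symm
  exact (D.comp_congr i rfl e.symm _ h₀).trans (D.comp_id i a h₀)

theorem ExtCat.low_seq (i : ℕ) (hi : i < n) (a b c d : D.Cell) (h₁ h₂ h₃ h₄ h₅ h₆) :
    D.low i hi (D.seq a b h₁) (D.seq c d h₂) h₃ =
      D.seq (D.low i hi a c h₄) (D.low i hi b d h₅) h₆ :=
  D.exchange i n _ _ _ _ _ _ _ _ _ _ hi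

theorem ExtCat.low_low (i j : ℕ) (hi : i < n) (hj : j < n) (hij : i < j) (a b c d : D.Cell)
    (h₁ h₂ h₃ h₄ h₅ h₆) :
    D.low i hi (D.low j hj a b h₁) (D.low j hj c d h₂) h₃ =
      D.low j hj (D.low i hi a c h₄) (D.low i hi b d h₅) h₆ :=
  D.exchange i j _ _ _ _ _ _ _ _ _ _ hij

theorem Term.eval_rel {K : ∀ x y, Term Γ x y → Term Γ x y → Prop}
    (hK : ∀ x y a b, K x y a b → (a.eval D φ hs ht).1 = (b.eval D φ hs ht).1)
    {x y x' y' : C.Cell} {a : Term Γ x y} {b : Term Γ x' y'} (r : Rel Γ K a b) :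
    (a.eval D φ hs ht).1 = (b.eval D φ hs ht).1 := by
  induction r with
  | refl => rfl
  | symm _ ih => exact ih.symm
  | trans _ _ ih₁ ih₂ => exact ih₁.trans ih₂
  | rel h => exact hK _ _ _ _ h
  | top_congr _ _ ih₁ ih₂ =>
    simp only [Term.eval]; exact D.seq_congr ih₁ ih₂ _ _
  | low_congr i hi _ _ _ _ _ _ ih₁ ih₂ =>
    simp only [Term.eval]; exact D.low_congr i hi ih₁ ih₂ _ _
  | idn_top a =>
    simp only [Term.eval]; exact D.idn_seq _ _ _
  | top_idn a =>
    simp only [Term.eval]; exact D.seq_idn _ _ _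
  | top_assoc a b c =>
    simp only [Term.eval]; exact D.seq_assoc _ _ _ _ _ _ _
  | idn_low i hi a h h' =>
    simp only [Term.eval]; exact D.idn_low i hi _ _ (by rw [(a.eval D φ hs ht).2.1]) _
  | low_idn i hi a h h' =>
    simp only [Term.eval]; exact D.low_idn i hi _ _ (by rw [(a.eval D φ hs ht).2.1]) _
  | low_assoc i hi a b c =>
    simp only [Term.eval]; exact D.low_assoc i hi _ _ _ _ _ _ _
  | idn_idn i hi x y h h' =>
    simp only [Term.eval]; exact D.comp_incl i x y _ h
  | low_top i hi a b c d =>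
    simp only [Term.eval]; exact D.low_seq i hi _ _ _ _ _ _ _ _ _ _
  | low_low i j hi hj hij a b c d =>
    simp only [Term.eval]; exact D.low_low i j hi hj hij _ _ _ _ _ _ _ _ _ _

/-- The functor, identical on `C`, induced by a map on generators that is compatible with the
boundaries and respects the relations. -/
def liftCell (K : ∀ x y, Term Γ x y → Term Γ x y → Prop)
    (hK : ∀ x y a b, K x y a b → (a.eval D φ hs ht).1 = (b.eval D φ hs ht).1) :
    (present Γ K).Cell → D.Cell :=
  fun A => Quotient.lift (s := relSetoid Γ K) (fun a => (a.tm.eval D φ hs ht).1)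
    (fun _ _ h => Term.eval_rel D φ hs ht hK h) A

theorem src_liftCell {K : ∀ x y, Term Γ x y → Term Γ x y → Prop} (hK) (A : (present Γ K).Cell) :
    D.src (liftCell D φ hs ht K hK A) = (present Γ K).src A := by
  induction A using PCell.ind with | @h x y a
  exact (a.eval D φ hs ht).2.1

theorem tgt_liftCell {K : ∀ x y, Term Γ x y → Term Γ x y → Prop} (hK) (A : (present Γ K).Cell) :
    D.tgt (liftCell D φ hs ht K hK A) = (present Γ K).tgt A := by
  induction A using PCell.ind with | @h x y a
  exact (a.eval D φ hs ht).2.2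

end Lift

/-! ### Free `(n+1)`-categories and free `(n+1,n)`-categories -/

/-- Disjoint union of cellular extensions. -/
def CellExt.sum (Γ Δ : CellExt C) : CellExt C where
  Gen := Γ.Gen ⊕ Δ.Gen
  src := Sum.elim Γ.src Δ.src
  tgt := Sum.elim Γ.tgt Δ.tgt
  s_eq := by rintro (γ | γ) <;> [exact Γ.s_eq γ; exact Δ.s_eq γ]
  t_eq := by rintro (γ | γ) <;> [exact Γ.t_eq γ; exact Δ.t_eq γ]

/-- The extension `Γ⁻`, with sources and targets reversed. -/
def CellExt.op (Γ : CellExt C) : CellExt C where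
  Gen := Γ.Gen
  src := Γ.tgt
  tgt := Γ.src
  s_eq γ i hi := (Γ.s_eq γ i hi).symm
  t_eq γ i hi := (Γ.t_eq γ i hi).symm

/-- The relations making `Γ⁻` inverse to `Γ`, in the extension `Θ ⊔ (Γ ⊔ Γ⁻)`. -/
inductive InvRel (Θ Γ : CellExt C) : ∀ x y, Term (Θ.sum (Γ.sum Γ.op)) x y →
    Term (Θ.sum (Γ.sum Γ.op)) x y → Prop
  | left (γ : Γ.Gen) : InvRel Θ Γ (Γ.src γ) (Γ.src γ)
      (Term.top (y := Γ.tgt γ) (Term.gen (Γ := Θ.sum (Γ.sum Γ.op)) (.inr (.inl γ)))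
        (Term.gen (Γ := Θ.sum (Γ.sum Γ.op)) (.inr (.inr γ)))) (Term.idn (Γ.src γ))
  | right (γ : Γ.Gen) : InvRel Θ Γ (Γ.tgt γ) (Γ.tgt γ)
      (Term.top (y := Γ.src γ) (Term.gen (Γ := Θ.sum (Γ.sum Γ.op)) (.inr (.inr γ)))
        (Term.gen (Γ := Θ.sum (Γ.sum Γ.op)) (.inr (.inl γ)))) (Term.idn (Γ.tgt γ))

/-- The empty cellular extension. -/
def CellExt.empty (C : NCat.{u} n) : CellExt C where
  Gen := PEmpty
  src := PEmpty.elim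
  tgt := PEmpty.elim
  s_eq γ := γ.elim
  t_eq γ := γ.elim

/-- The free `(n+1)`-category `C[Γ]`. -/
noncomputable def free (Γ : CellExt C) : ExtCat C := present Γ fun _ _ _ _ => False

/-- `C[Θ, Γ, Γ⁻]/Inv(Γ)`, in which the generators of `Γ` are invertible and those of `Θ` are
not required to be. -/
noncomputable def freeMixed (Θ Γ : CellExt C) : ExtCat C :=
  present (Θ.sum (Γ.sum Γ.op)) (InvRel Θ Γ)

/-- The free `(n+1,n)`-category `C(Γ) = C[Γ, Γ⁻]/Inv(Γ)`. -/
noncomputable def freeInv (Γ : CellExt C) : ExtCat C := freeMixed (CellExt.empty C) Γ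

/-- A generator, as a cell of the free `(n+1)`-category. -/
noncomputable def freeGen (Γ : CellExt C) (γ : Γ.Gen) : (free Γ).Cell :=
  genCell Γ (fun _ _ _ _ => False) γ

/-- A non-invertible generator of the mixed category. -/
noncomputable def mixGen (Θ Γ : CellExt C) (γ : Θ.Gen) : (freeMixed Θ Γ).Cell :=
  genCell (Θ.sum (Γ.sum Γ.op)) (InvRel Θ Γ) (.inl γ)

/-- An invertible generator of the mixed category. -/
noncomputable def posGen (Θ Γ : CellExt C) (γ : Γ.Gen) : (freeMixed Θ Γ).Cell :=
  genCell (Θ.sum (Γ.sum Γ.op)) (InvRel Θ Γ) (.inr (.inl γ))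

/-- The inverse of an invertible generator of the mixed category. -/
noncomputable def negGen (Θ Γ : CellExt C) (γ : Γ.Gen) : (freeMixed Θ Γ).Cell :=
  genCell (Θ.sum (Γ.sum Γ.op)) (InvRel Θ Γ) (.inr (.inr γ))

/-- The functor from the free `(n+1)`-category on `Γ` to `D`, identical on `C`, that extends a map
on generators. -/
noncomputable def freeLift {Γ : CellExt C} (D : ExtCat C) (φ : Γ.Gen → D.Cell)
    (hs : ∀ γ, D.src (φ γ) = Γ.src γ) (ht : ∀ γ, D.tgt (φ γ) = Γ.tgt γ) (f : (free Γ).Cell) :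
    D.Cell :=
  liftCell D φ hs ht (fun _ _ _ _ => False) (fun _ _ _ _ h => h.elim) f

theorem src_freeLift {Γ : CellExt C} (D : ExtCat C) (φ : Γ.Gen → D.Cell) (hs) (ht)
    (f : (free Γ).Cell) : D.src (freeLift D φ hs ht f) = (free Γ).src f :=
  src_liftCell D φ hs ht _ f

theorem tgt_freeLift {Γ : CellExt C} (D : ExtCat C) (φ : Γ.Gen → D.Cell) (hs) (ht)
    (f : (free Γ).Cell) : D.tgt (freeLift D φ hs ht f) = (free Γ).tgt f :=
  tgt_liftCell D φ hs ht _ f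

/-- The canonical functor from `C[Γ]` to `C(Γ)`. -/
noncomputable def toInv (Γ : CellExt C) : (free Γ).Cell → (freeInv Γ).Cell :=
  freeLift (freeInv Γ) (posGen (CellExt.empty C) Γ) (fun _ => rfl) (fun _ => rfl)

/-- The canonical functor from `C[Θ]` to the mixed category. -/
noncomputable def toMixed (Θ Γ : CellExt C) : (free Θ).Cell → (freeMixed Θ Γ).Cell :=
  freeLift (freeMixed Θ Γ) (mixGen Θ Γ) (fun _ => rfl) (fun _ => rfl)

/-- The generators of `C[Θ, Γ, Γ⁻]/Inv(Γ)` coming from `Γ` and `Γ⁻`. -/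
noncomputable def invGens (Θ Γ : CellExt C) :
    ((CellExt.empty C).sum (Γ.sum Γ.op)).Gen → (freeMixed Θ Γ).Cell
  | .inl γ => γ.elim
  | .inr (.inl γ) => posGen Θ Γ γ
  | .inr (.inr γ) => negGen Θ Γ γ

/-- The canonical functor from `C(Γ)` to the mixed category. -/
noncomputable def invToMixed (Θ Γ : CellExt C) : (freeInv Γ).Cell → (freeMixed Θ Γ).Cell :=
  liftCell (freeMixed Θ Γ) (invGens Θ Γ)
    (by rintro (γ | γ | γ); exacts [γ.elim, rfl, rfl])
    (by rintro (γ | γ | γ); exacts [γ.elim, rfl, rfl])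
    (InvRel (CellExt.empty C) Γ)
    (by
      intro x y a b h
      cases h with
      | left γ =>
        exact (PCell.comp_top _ _).trans (PCell.sound (Rel.rel (InvRel.left γ)))
      | right γ =>
        exact (PCell.comp_top _ _).trans (PCell.sound (Rel.rel (InvRel.right γ))))

theorem src_toInv (Γ : CellExt C) (f : (free Γ).Cell) :
    (freeInv Γ).src (toInv Γ f) = (free Γ).src f := src_freeLift _ _ _ _ _

theorem tgt_toInv (Γ : CellExt C) (f : (free Γ).Cell) :
    (freeInv Γ).tgt (toInv Γ f) = (free Γ).tgt f := tgt_freeLift _ _ _ _ _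

theorem src_toMixed (Θ Γ : CellExt C) (f : (free Θ).Cell) :
    (freeMixed Θ Γ).src (toMixed Θ Γ f) = (free Θ).src f := src_freeLift _ _ _ _ _

theorem tgt_toMixed (Θ Γ : CellExt C) (f : (free Θ).Cell) :
    (freeMixed Θ Γ).tgt (toMixed Θ Γ f) = (free Θ).tgt f := tgt_freeLift _ _ _ _ _

theorem src_invToMixed (Θ Γ : CellExt C) (e : (freeInv Γ).Cell) :
    (freeMixed Θ Γ).src (invToMixed Θ Γ e) = (freeInv Γ).src e := src_liftCell _ _ _ _ _ e

theorem tgt_invToMixed (Θ Γ : CellExt C) (e : (freeInv Γ).Cell) :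
    (freeMixed Θ Γ).tgt (invToMixed Θ Γ e) = (freeInv Γ).tgt e := tgt_liftCell _ _ _ _ _ e

/-! ### Whiskers and rewriting steps -/

/-- A whisker `x_n ⋆_{n-1} ( ⋯ (x_1 ⋆_0 - ⋆_0 y_1) ⋯ ) ⋆_{n-1} y_n` of the `n`-category `C`;
`left k` and `right k` are the `(k+1)`-cells `x_{k+1}` and `y_{k+1}`. -/
structure Whisker {n : ℕ} (C : NCat.{u} n) where
  left : ℕ → C.Cell
  right : ℕ → C.Cell
  left_mem : ∀ k < n, C.s (k + 1) (left k) = left k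
  right_mem : ∀ k < n, C.s (k + 1) (right k) = right k

/-- The first `k` layers of the whisker `W`, applied to `f`, yield `f'`. -/
def Whisker.SendsTo (W : Whisker C) (D : ExtCat C) : ℕ → D.Cell → D.Cell → Prop
  | 0, f, f' => f' = f
  | k + 1, f, f' => ∃ g, W.SendsTo D k f g ∧ ∃ (hk : k < n) (h : _) (h' : _),
      f' = D.whiskR k hk (D.whiskL k hk (W.left k) g h) (W.right k) h'

/-- `W` can be applied to `f`, with `W[f] = f'`. -/
def Whisker.Sends (W : Whisker C) (D : ExtCat C) (f f' : D.Cell) : Prop := W.SendsTo D n f f'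

/-- The cells of size one: those of the form `W[γ]`, with `W` a whisker and `γ` a generator. -/
def IsStep (Γ : CellExt C) (f : (free Γ).Cell) : Prop :=
  ∃ (W : Whisker C) (γ : Γ.Gen), W.Sends (free Γ) (freeGen Γ γ) f

/-- The cells of size one of `C(Γ)`: those of the form `W[γ]` or `W[γ⁻]`. -/
def IsInvStep (Γ : CellExt C) (e : (freeInv Γ).Cell) : Prop :=
  ∃ (W : Whisker C) (γ : Γ.Gen),
    W.Sends (freeInv Γ) (posGen (CellExt.empty C) Γ γ) e ∨
      W.Sends (freeInv Γ) (negGen (CellExt.empty C) Γ γ) e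

theorem isStep_freeGen (Γ : CellExt C) (γ : Γ.Gen) : IsStep Γ (freeGen Γ γ) := by
  let W : Whisker C :=
    { left := fun k => C.s k (Γ.src γ)
      right := fun k => C.t k (Γ.src γ)
      left_mem := fun k _ => C.s_s_le _ _ _ k.le_succ
      right_mem := fun k _ => C.s_t_le _ _ _ k.le_succ }
  refine ⟨W, γ, ?_⟩
  have key : ∀ k ≤ n, W.SendsTo (free Γ) k (freeGen Γ γ) (freeGen Γ γ) := by
    intro k
    induction k with
    | zero => exact fun _ => rfl
    | succ k ih =>
      intro hk
      have h : C.t k (C.s k (Γ.src γ)) = C.s k ((free Γ).src (freeGen Γ γ)) :=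
        C.t_s_le _ _ _ le_rfl
      have e : (free Γ).whiskL k hk (C.s k (Γ.src γ)) (freeGen Γ γ) h = freeGen Γ γ :=
        ExtCat.idn_low (free Γ) k hk (C.s k (Γ.src γ)) (freeGen Γ γ) rfl _
      have h' : C.t k ((free Γ).src ((free Γ).whiskL k hk (C.s k (Γ.src γ)) (freeGen Γ γ) h)) =
          C.s k (C.t k (Γ.src γ)) := by
        rw [e]; exact (C.s_t_le _ _ _ le_rfl).symm
      refine ⟨freeGen Γ γ, ih (Nat.le_of_succ_le hk), hk, h, h', ?_⟩
      refine Eq.symm (Eq.trans ?_ e)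
      exact ExtCat.low_idn (free Γ) k hk _ _ (by rw [e]; rfl) _
  exact key n le_rfl

/-! ### Rewriting -/

/-- `u` reduces to `v`: there is a non-identity cell from `u` to `v`. -/
def Reduces (Γ : CellExt C) (u v : C.Cell) : Prop :=
  ∃ f : (free Γ).Cell, (free Γ).src f = u ∧ (free Γ).tgt f = v ∧ f ≠ (free Γ).incl u

/-- There is no infinite reduction sequence. -/
def Terminating (Γ : CellExt C) : Prop :=
  ¬ ∃ u : ℕ → C.Cell, ∀ k, Reduces Γ (u k) (u (k + 1))

/-- Every branching is confluent. -/
def Confluent (Γ : CellExt C) : Prop :=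
  ∀ f g : (free Γ).Cell, (free Γ).src f = (free Γ).src g →
    ∃ f' g' : (free Γ).Cell, (free Γ).src f' = (free Γ).tgt f ∧
      (free Γ).src g' = (free Γ).tgt g ∧ (free Γ).tgt f' = (free Γ).tgt g'

/-- Terminating and confluent. -/
def Convergent (Γ : CellExt C) : Prop := Terminating Γ ∧ Confluent Γ

/-- Every branching `(f, e, g)` of `S` modulo `E` is confluent modulo `E`. -/
def ConfluentModulo (S E : CellExt C) : Prop :=
  ∀ (f : (free S).Cell) (e : (freeInv E).Cell) (g : (free S).Cell),
    (freeInv E).src e = (free S).src f → (freeInv E).tgt e = (free S).src g →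
    f ≠ (free S).incl ((free S).src f) →
    ∃ (f' : (free S).Cell) (e' : (freeInv E).Cell) (g' : (free S).Cell),
      (free S).src f' = (free S).tgt f ∧ (free S).src g' = (free S).tgt g ∧
      (freeInv E).src e' = (free S).tgt f' ∧ (freeInv E).tgt e' = (free S).tgt g'

/-- The irreducible cells. -/
def Irr (Γ : CellExt C) : Set C.Cell := {u | ∀ v, ¬ Reduces Γ u v}

/-- The normal forms of `u`: the irreducible cells `v` such that there is a cell (possibly an
identity) from `u` to `v`. -/
def NF (Γ : CellExt C) (u : C.Cell) : Set C.Cell :=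
  {v | v ∈ Irr Γ ∧ ∃ f : (free Γ).Cell, (free Γ).src f = u ∧ (free Γ).tgt f = v}

/-- Each element of `X` has a normal form with respect to `S` that is irreducible for `E`. -/
def IsNormalizing (S E : CellExt C) (X : Set C.Cell) : Prop :=
  ∀ u ∈ X, (NF S u ∩ Irr E).Nonempty

/-! ### Critical branchings -/

/-- `f = f₀ ⋆ᵢ v` and `g = u ⋆ᵢ g₀` for steps `f₀ : u ⟶ u'` and `g₀ : v ⟶ v'`. -/
def IsPeiffer (Γ : CellExt C) (f g : (free Γ).Cell) : Prop :=
  ∃ (i : ℕ) (hi : i < n) (f₀ g₀ : (free Γ).Cell)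
    (h : C.t i ((free Γ).src f₀) = C.s i ((free Γ).src g₀)),
    IsStep Γ f₀ ∧ IsStep Γ g₀ ∧ f = (free Γ).whiskR i hi f₀ ((free Γ).src g₀) h ∧
      g = (free Γ).whiskL i hi ((free Γ).src f₀) g₀ h

/-- `(f, g)` is a critical branching: a local branching, neither aspherical nor Peiffer, that is
minimal for the relation generated by the application of whiskers. -/
def IsCritical (Γ : CellExt C) (f g : (free Γ).Cell) : Prop :=
  IsStep Γ f ∧ IsStep Γ g ∧ (free Γ).src f = (free Γ).src g ∧
  f ≠ g ∧ ¬ IsPeiffer Γ f g ∧ ¬ IsPeiffer Γ g f ∧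
  ∀ (W : Whisker C) (f' g' : (free Γ).Cell), (free Γ).src f' = (free Γ).src g' →
    W.Sends (free Γ) f' f → W.Sends (free Γ) g' g → f' = f ∧ g' = g

/-- `f = f₀ ⋆ᵢ v` and `e = u ⋆ᵢ e₀` (first form), or `f = w ⋆ᵢ f₀` and `e = e₀ ⋆ᵢ u` (second
form), for steps `f₀` of source `u` and `e₀` of source `v`, resp. `w`. -/
def IsPeifferModulo (S E : CellExt C) (f : (free S).Cell) (e : (freeInv E).Cell) : Prop :=
  ∃ (i : ℕ) (hi : i < n) (f₀ : (free S).Cell) (e₀ : (freeInv E).Cell),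
    IsStep S f₀ ∧ IsInvStep E e₀ ∧
    ((∃ h : C.t i ((free S).src f₀) = C.s i ((freeInv E).src e₀),
        f = (free S).whiskR i hi f₀ ((freeInv E).src e₀) h ∧
        e = (freeInv E).whiskL i hi ((free S).src f₀) e₀ h) ∨
      ∃ h : C.t i ((freeInv E).src e₀) = C.s i ((free S).src f₀),
        f = (free S).whiskL i hi ((freeInv E).src e₀) f₀ h ∧
        e = (freeInv E).whiskR i hi e₀ ((free S).src f₀) h)

/-- `(f, e)` is a critical branching of `S` modulo `E`: a local branching modulo, not Peiffer, that
is minimal for the relation generated by the application of whiskers. -/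
def IsCriticalModulo (S E : CellExt C) (f : (free S).Cell) (e : (freeInv E).Cell) : Prop :=
  IsStep S f ∧ IsInvStep E e ∧ (free S).src f = (freeInv E).src e ∧ ¬ IsPeifferModulo S E f e ∧
  ∀ (W : Whisker C) (f' : (free S).Cell) (e' : (freeInv E).Cell),
    (free S).src f' = (freeInv E).src e' →
    W.Sends (free S) f' f → W.Sends (freeInv E) e' e → f' = f ∧ e' = e

/-! ### Squares and square extensions -/

/-- A square on a pair of `(n+1)`-categories with the same underlying `n`-category. -/
@[ext]
structure Square (V H : ExtCat C) where
  top : H.Cell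
  bot : H.Cell
  left : V.Cell
  right : V.Cell
  tl : V.src left = H.src top
  tr : V.src right = H.tgt top
  bl : V.tgt left = H.src bot
  br : V.tgt right = H.tgt bot

/-- A square extension: a set with a map to squares. -/
structure SqExt (V H : ExtCat C) where
  Gen : Type u
  bd : Gen → Square V H

/-- Union of square extensions. -/
def SqExt.union {V H : ExtCat C} (X Y : SqExt V H) : SqExt V H where
  Gen := X.Gen ⊕ Y.Gen
  bd := Sum.elim X.bd Y.bd

namespace Square

variable {V H : ExtCat C}

/-- The boundary of the identity of a horizontal cell. -/
def idH (f : H.Cell) : Square V H where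
  top := f
  bot := f
  left := V.incl (H.src f)
  right := V.incl (H.tgt f)
  tl := V.src_incl _
  tr := V.src_incl _
  bl := V.tgt_incl _
  br := V.tgt_incl _

/-- The boundary of the identity of a vertical cell. -/
def idV (e : V.Cell) : Square V H where
  top := H.incl (V.src e)
  bot := H.incl (V.tgt e)
  left := e
  right := e
  tl := (H.src_incl _).symm
  tr := (H.tgt_incl _).symm
  bl := (H.src_incl _).symm
  br := (H.tgt_incl _).symm

theorem tgt_top {p q : Square V H} (h : p.right = q.left) : H.tgt p.top = H.src q.top := by
  rw [← p.tr, h, q.tl]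

theorem tgt_bot {p q : Square V H} (h : p.right = q.left) : H.tgt p.bot = H.src q.bot := by
  rw [← p.br, h, q.bl]

theorem tgt_left {p q : Square V H} (h : p.bot = q.top) : V.tgt p.left = V.src q.left := by
  rw [p.bl, h, q.tl]

theorem tgt_right {p q : Square V H} (h : p.bot = q.top) : V.tgt p.right = V.src q.right := by
  rw [p.br, h, q.tr]

/-- The boundary of the composite of two squares along a common vertical cell. -/
def juxt (p q : Square V H) (h : p.right = q.left) : Square V H where
  top := H.seq p.top q.top (tgt_top h)
  bot := H.seq p.bot q.bot (tgt_bot h)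
  left := p.left
  right := q.right
  tl := by rw [H.src_seq, p.tl]
  tr := by rw [H.tgt_seq, q.tr]
  bl := by rw [H.src_seq, p.bl]
  br := by rw [H.tgt_seq, q.br]

/-- The boundary of the composite of two squares along a common horizontal cell. -/
def stack (p q : Square V H) (h : p.bot = q.top) : Square V H where
  top := p.top
  bot := q.bot
  left := V.seq p.left q.left (tgt_left h)
  right := V.seq p.right q.right (tgt_right h)
  tl := by rw [V.src_seq, p.tl]
  tr := by rw [V.src_seq, p.tr]
  bl := by rw [V.tgt_seq, q.bl]
  br := by rw [V.tgt_seq, q.br]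

theorem s_bot (i : ℕ) (hi : i < n) (p : Square V H) :
    C.s i (H.src p.bot) = C.s i (H.src p.top) := by
  rw [← p.bl, ← V.s_src_tgt i hi, p.tl]

theorem t_bot (i : ℕ) (hi : i < n) (p : Square V H) :
    C.t i (H.src p.bot) = C.t i (H.src p.top) := by
  rw [← p.bl, ← V.t_src_tgt i hi, p.tl]

theorem s_right (i : ℕ) (hi : i < n) (p : Square V H) :
    C.s i (V.src p.right) = C.s i (H.src p.top) := by
  rw [p.tr, H.s_src_tgt i hi]

theorem t_right (i : ℕ) (hi : i < n) (p : Square V H) :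
    C.t i (V.src p.right) = C.t i (H.src p.top) := by
  rw [p.tr, H.t_src_tgt i hi]

/-- The boundary of the composite of two squares along an `i`-cell, `i < n`. -/
def low (i : ℕ) (hi : i < n) (p q : Square V H)
    (h : C.t i (H.src p.top) = C.s i (H.src q.top)) : Square V H where
  top := H.low i hi p.top q.top h
  bot := H.low i hi p.bot q.bot (by rw [t_bot i hi, s_bot i hi, h])
  left := V.low i hi p.left q.left (by rw [p.tl, q.tl, h])
  right := V.low i hi p.right q.right (by rw [t_right i hi, s_right i hi, h])
  tl := by rw [V.src_low, H.src_low]; exact C.comp_congr _ p.tl q.tl _ _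
  tr := by rw [V.src_low, H.tgt_low]; exact C.comp_congr _ p.tr q.tr _ _
  bl := by rw [V.tgt_low, H.src_low]; exact C.comp_congr _ p.bl q.bl _ _
  br := by rw [V.tgt_low, H.tgt_low]; exact C.comp_congr _ p.br q.br _ _

/-- The boundary of the inverse of a square for the composition along vertical cells; `f` and `g`
are the inverses of the horizontal faces. -/
def flipH (p : Square V H) (f g : H.Cell) (hf : H.IsInverse p.top f) (hg : H.IsInverse p.bot g) :
    Square V H where
  top := f
  bot := g
  left := p.right
  right := p.left
  tl := p.tr.trans hf.choose
  tr := p.tl.trans hf.choose_spec.choose.symm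
  bl := p.br.trans hg.choose
  br := p.bl.trans hg.choose_spec.choose.symm

/-- The boundary of the inverse of a square for the composition along horizontal cells; `d` and `e`
are the inverses of the vertical faces. -/
def flipV (p : Square V H) (d e : V.Cell) (hd : V.IsInverse p.left d)
    (he : V.IsInverse p.right e) : Square V H where
  top := p.bot
  bot := p.top
  left := d
  right := e
  tl := hd.choose.symm.trans p.bl
  tr := he.choose.symm.trans p.br
  bl := hd.choose_spec.choose.trans p.tl
  br := he.choose_spec.choose.trans p.tr

/-- The image of a square under a pair of maps that are compatible with sources and targets. -/
def map {V' H' : ExtCat C} (F : V.Cell → V'.Cell) (G : H.Cell → H'.Cell)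
    (hF : ∀ e, V'.src (F e) = V.src e) (hF' : ∀ e, V'.tgt (F e) = V.tgt e)
    (hG : ∀ f, H'.src (G f) = H.src f) (hG' : ∀ f, H'.tgt (G f) = H.tgt f) (p : Square V H) :
    Square V' H' where
  top := G p.top
  bot := G p.bot
  left := F p.left
  right := F p.right
  tl := by rw [hF, hG, p.tl]
  tr := by rw [hF, hG', p.tr]
  bl := by rw [hF', hG, p.bl]
  br := by rw [hF', hG', p.br]

end Square

/-! ### The free `n`-category enriched in double groupoids -/

/-- Formal composites of the generating squares of `X`, with their boundary. The compositions are
along a vertical cell, along a horizontal cell, and along `i`-cells for `i < n`. -/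
inductive Pasting {V H : ExtCat C} (X : SqExt V H) : Square V H → Type u
  | gen (x : X.Gen) : Pasting X (X.bd x)
  | idH (f : H.Cell) : Pasting X (Square.idH f)
  | idV (e : V.Cell) : Pasting X (Square.idV e)
  | juxt {p q : Square V H} (a : Pasting X p) (b : Pasting X q) (h : p.right = q.left) :
      Pasting X (p.juxt q h)
  | stack {p q : Square V H} (a : Pasting X p) (b : Pasting X q) (h : p.bot = q.top) :
      Pasting X (p.stack q h)
  | low (i : ℕ) (hi : i < n) {p q : Square V H} (a : Pasting X p) (b : Pasting X q)
      (h : C.t i (H.src p.top) = C.s i (H.src q.top)) : Pasting X (p.low i hi q h)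
  | invH {p : Square V H} (a : Pasting X p) (f g : H.Cell) (hf : H.IsInverse p.top f)
      (hg : H.IsInverse p.bot g) : Pasting X (p.flipH f g hf hg)
  | invV {p : Square V H} (a : Pasting X p) (d e : V.Cell) (hd : V.IsInverse p.left d)
      (he : V.IsInverse p.right e) : Pasting X (p.flipV d e hd he)

/-- The congruence on formal composites generated by the axioms of `n`-categories enriched in
double groupoids. -/
inductive PRel {V H : ExtCat C} (X : SqExt V H) :
    ∀ {p q : Square V H}, Pasting X p → Pasting X q → Prop
  | refl {p} (a : Pasting X p) : PRel X a a
  | symm {p q} {a : Pasting X p} {b : Pasting X q} : PRel X a b → PRel X b a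
  | trans {p q r} {a : Pasting X p} {b : Pasting X q} {c : Pasting X r} :
      PRel X a b → PRel X b c → PRel X a c
  | juxt_congr {p q p' q'} {a : Pasting X p} {b : Pasting X q} {a' : Pasting X p'}
      {b' : Pasting X q'} (h h') : PRel X a a' → PRel X b b' →
      PRel X (a.juxt b h) (a'.juxt b' h')
  | stack_congr {p q p' q'} {a : Pasting X p} {b : Pasting X q} {a' : Pasting X p'}
      {b' : Pasting X q'} (h h') : PRel X a a' → PRel X b b' →
      PRel X (a.stack b h) (a'.stack b' h')
  | low_congr (i hi) {p q p' q'} {a : Pasting X p} {b : Pasting X q} {a' : Pasting X p'}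
      {b' : Pasting X q'} (h h') : PRel X a a' → PRel X b b' →
      PRel X (Pasting.low i hi a b h) (Pasting.low i hi a' b' h')
  | id_juxt {p} (a : Pasting X p) (h) : PRel X ((Pasting.idV p.left).juxt a h) a
  | juxt_id {p} (a : Pasting X p) (h) : PRel X (a.juxt (Pasting.idV p.right) h) a
  | juxt_assoc {p q r} (a : Pasting X p) (b : Pasting X q) (c : Pasting X r) (h₁ h₂ h₃ h₄) :
      PRel X ((a.juxt b h₁).juxt c h₂) (a.juxt (b.juxt c h₃) h₄)
  | id_stack {p} (a : Pasting X p) (h) : PRel X ((Pasting.idH p.top).stack a h) a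
  | stack_id {p} (a : Pasting X p) (h) : PRel X (a.stack (Pasting.idH p.bot) h) a
  | stack_assoc {p q r} (a : Pasting X p) (b : Pasting X q) (c : Pasting X r) (h₁ h₂ h₃ h₄) :
      PRel X ((a.stack b h₁).stack c h₂) (a.stack (b.stack c h₃) h₄)
  | interchange {p q r t} (a : Pasting X p) (b : Pasting X q) (c : Pasting X r)
      (d : Pasting X t) (h₁ h₂ h₃ h₄ h₅ h₆) :
      PRel X ((a.juxt b h₁).stack (c.juxt d h₂) h₃) ((a.stack c h₄).juxt (b.stack d h₅) h₆)
  | idH_idH (f g : H.Cell) (h h') :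
      PRel X ((Pasting.idH f).juxt (Pasting.idH g) h') (Pasting.idH (H.seq f g h))
  | idV_idV (d e : V.Cell) (h h') :
      PRel X ((Pasting.idV d).stack (Pasting.idV e) h') (Pasting.idV (V.seq d e h))
  | idH_incl (x : C.Cell) : PRel X (Pasting.idH (H.incl x)) (Pasting.idV (V.incl x))
  | juxt_invH {p} (a : Pasting X p) (f g hf hg h) :
      PRel X (a.juxt (a.invH f g hf hg) h) (Pasting.idV p.left)
  | invH_juxt {p} (a : Pasting X p) (f g hf hg h) :
      PRel X ((a.invH f g hf hg).juxt a h) (Pasting.idV p.right)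
  | stack_invV {p} (a : Pasting X p) (d e hd he h) :
      PRel X (a.stack (a.invV d e hd he) h) (Pasting.idH p.top)
  | invV_stack {p} (a : Pasting X p) (d e hd he h) :
      PRel X ((a.invV d e hd he).stack a h) (Pasting.idH p.bot)
  | id_low (i hi) {p} (a : Pasting X p) (h) :
      PRel X (Pasting.low i hi (Pasting.idH (H.incl (C.s i (H.src p.top)))) a h) a
  | low_id (i hi) {p} (a : Pasting X p) (h) :
      PRel X (Pasting.low i hi a (Pasting.idH (H.incl (C.t i (H.src p.top)))) h) a
  | low_assoc (i hi) {p q r} (a : Pasting X p) (b : Pasting X q) (c : Pasting X r)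
      (h₁ h₂ h₃ h₄) : PRel X (Pasting.low i hi (Pasting.low i hi a b h₁) c h₂)
        (Pasting.low i hi a (Pasting.low i hi b c h₃) h₄)
  | low_juxt (i hi) {p q r t} (a : Pasting X p) (b : Pasting X q) (c : Pasting X r)
      (d : Pasting X t) (h₁ h₂ h₃ h₄ h₅ h₆) :
      PRel X (Pasting.low i hi (a.juxt b h₁) (c.juxt d h₂) h₃)
        ((Pasting.low i hi a c h₄).juxt (Pasting.low i hi b d h₅) h₆)
  | low_stack (i hi) {p q r t} (a : Pasting X p) (b : Pasting X q) (c : Pasting X r)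
      (d : Pasting X t) (h₁ h₂ h₃ h₄ h₅ h₆) :
      PRel X (Pasting.low i hi (a.stack b h₁) (c.stack d h₂) h₃)
        ((Pasting.low i hi a c h₄).stack (Pasting.low i hi b d h₅) h₆)
  | low_low (i j hi hj) (hij : i < j) {p q r t} (a : Pasting X p) (b : Pasting X q)
      (c : Pasting X r) (d : Pasting X t) (h₁ h₂ h₃ h₄ h₅ h₆) :
      PRel X (Pasting.low i hi (Pasting.low j hj a b h₁) (Pasting.low j hj c d h₂) h₃)
        (Pasting.low j hj (Pasting.low i hi a c h₄) (Pasting.low i hi b d h₅) h₆)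
  | low_idH (i hi) (f g : H.Cell) (h h') :
      PRel X (Pasting.low i hi (Pasting.idH f) (Pasting.idH g) h') (Pasting.idH (H.low i hi f g h))
  | low_idV (i hi) (d e : V.Cell) (h h') :
      PRel X (Pasting.low i hi (Pasting.idV d) (Pasting.idV e) h') (Pasting.idV (V.low i hi d e h))

set_option linter.unusedSimpArgs false in
theorem PRel.bd {V H : ExtCat C} {X : SqExt V H} {p q : Square V H} {a : Pasting X p}
    {b : Pasting X q} (r : PRel X a b) : p = q := by
  induction r with
  | refl => rfl
  | symm _ ih => exact ih.symm
  | trans _ _ ih₁ ih₂ => exact ih₁.trans ih₂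
  | juxt_congr h h' _ _ ih₁ ih₂ => subst ih₁ ih₂; rfl
  | stack_congr h h' _ _ ih₁ ih₂ => subst ih₁ ih₂; rfl
  | low_congr i hi h h' _ _ ih₁ ih₂ => subst ih₁ ih₂; rfl
  | @id_juxt p a h =>
    ext <;> simp only [Square.juxt, Square.stack, Square.low, Square.idH, Square.idV,
      Square.flipH, Square.flipV]
    · exact H.idn_seq _ _ (H.tgt_incl _ |>.trans p.tl)
    · exact H.idn_seq _ _ (H.tgt_incl _ |>.trans p.bl)
  | @juxt_id p a h =>
    ext <;> simp only [Square.juxt, Square.stack, Square.low, Square.idH, Square.idV,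
      Square.flipH, Square.flipV]
    · exact H.seq_idn _ _ (p.tr.symm.trans (H.src_incl _).symm)
    · exact H.seq_idn _ _ (p.br.symm.trans (H.src_incl _).symm)
  | juxt_assoc a b c =>
    ext <;> simp only [Square.juxt, Square.stack, Square.low, Square.idH, Square.idV,
      Square.flipH, Square.flipV]
    · exact H.seq_assoc _ _ _ _ _ _ _
    · exact H.seq_assoc _ _ _ _ _ _ _
  | id_stack a h =>
    ext <;> simp only [Square.juxt, Square.stack, Square.low, Square.idH, Square.idV,
      Square.flipH, Square.flipV]
    · exact V.idn_seq _ _ _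
    · exact V.idn_seq _ _ _
  | stack_id a h =>
    ext <;> simp only [Square.juxt, Square.stack, Square.low, Square.idH, Square.idV,
      Square.flipH, Square.flipV]
    · exact V.seq_idn _ _ _
    · exact V.seq_idn _ _ _
  | stack_assoc a b c =>
    ext <;> simp only [Square.juxt, Square.stack, Square.low, Square.idH, Square.idV,
      Square.flipH, Square.flipV]
    · exact V.seq_assoc _ _ _ _ _ _ _
    · exact V.seq_assoc _ _ _ _ _ _ _
  | interchange => rfl
  | idH_idH f g h h' =>
    ext <;> simp only [Square.juxt, Square.stack, Square.low, Square.idH, Square.idV,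
      Square.flipH, Square.flipV]
    · exact congrArg V.incl (H.src_seq _ _ _).symm
    · exact congrArg V.incl (H.tgt_seq _ _ _).symm
  | idV_idV d e h h' =>
    ext <;> simp only [Square.juxt, Square.stack, Square.low, Square.idH, Square.idV,
      Square.flipH, Square.flipV]
    · exact congrArg H.incl (V.src_seq _ _ _).symm
    · exact congrArg H.incl (V.tgt_seq _ _ _).symm
  | idH_incl x =>
    ext <;> simp only [Square.juxt, Square.stack, Square.low, Square.idH, Square.idV,
      Square.flipH, Square.flipV]
    · exact congrArg H.incl (V.src_incl _).symm
    · exact congrArg H.incl (V.tgt_incl _).symm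
    · exact congrArg V.incl (H.src_incl _)
    · exact congrArg V.incl (H.tgt_incl _)
  | @juxt_invH p a f g hf hg h =>
    ext <;> simp only [Square.juxt, Square.stack, Square.low, Square.idH, Square.idV,
      Square.flipH, Square.flipV]
    · exact hf.choose_spec.choose_spec.1.trans (congrArg H.incl p.tl.symm)
    · exact hg.choose_spec.choose_spec.1.trans (congrArg H.incl p.bl.symm)
  | @invH_juxt p a f g hf hg h =>
    ext <;> simp only [Square.juxt, Square.stack, Square.low, Square.idH, Square.idV,
      Square.flipH, Square.flipV]
    · exact hf.choose_spec.choose_spec.2.trans (congrArg H.incl p.tr.symm)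
    · exact hg.choose_spec.choose_spec.2.trans (congrArg H.incl p.br.symm)
  | @stack_invV p a d e hd he h =>
    ext <;> simp only [Square.juxt, Square.stack, Square.low, Square.idH, Square.idV,
      Square.flipH, Square.flipV]
    · exact hd.choose_spec.choose_spec.1.trans (congrArg V.incl p.tl)
    · exact he.choose_spec.choose_spec.1.trans (congrArg V.incl p.tr)
  | @invV_stack p a d e hd he h =>
    ext <;> simp only [Square.juxt, Square.stack, Square.low, Square.idH, Square.idV,
      Square.flipH, Square.flipV]
    · exact hd.choose_spec.choose_spec.2.trans (congrArg V.incl p.bl)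
    · exact he.choose_spec.choose_spec.2.trans (congrArg V.incl p.br)
  | @id_low i hi p a h =>
    ext <;> simp only [Square.juxt, Square.stack, Square.low, Square.idH, Square.idV,
      Square.flipH, Square.flipV]
    · exact H.idn_low _ _ _ _ rfl _
    · exact H.idn_low _ _ _ _ (p.s_bot i hi).symm _
    · refine (V.low_congr i hi (congrArg V.incl (H.src_incl _)) rfl _ ?_).trans
        (V.idn_low _ _ _ _ (by rw [p.tl]) ?_)
      all_goals rw [V.src_incl, p.tl]; exact C.t_s_le _ _ _ le_rfl
    · refine (V.low_congr i hi (congrArg V.incl (H.tgt_incl _)) rfl _ ?_).trans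
        (V.idn_low _ _ _ _ (p.s_right i hi).symm ?_)
      all_goals rw [V.src_incl, p.s_right i hi]; exact C.t_s_le _ _ _ le_rfl
  | @low_id i hi p a h =>
    ext <;> simp only [Square.juxt, Square.stack, Square.low, Square.idH, Square.idV,
      Square.flipH, Square.flipV]
    · exact H.low_idn _ _ _ _ rfl _
    · exact H.low_idn _ _ _ _ (p.t_bot i hi).symm _
    · refine (V.low_congr i hi rfl (congrArg V.incl (H.src_incl _)) _ ?_).trans
        (V.low_idn _ _ _ _ (by rw [p.tl]) ?_)
      all_goals rw [V.src_incl, p.tl]; exact (C.s_t_le _ _ _ le_rfl).symm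
    · refine (V.low_congr i hi rfl (congrArg V.incl (H.tgt_incl _)) _ ?_).trans
        (V.low_idn _ _ _ _ (p.t_right i hi).symm ?_)
      all_goals rw [V.src_incl, p.t_right i hi]; exact (C.s_t_le _ _ _ le_rfl).symm
  | low_assoc i hi a b c =>
    ext <;> simp only [Square.juxt, Square.stack, Square.low, Square.idH, Square.idV,
      Square.flipH, Square.flipV]
    · exact H.low_assoc _ _ _ _ _ _ _ _ _
    · exact H.low_assoc _ _ _ _ _ _ _ _ _
    · exact V.low_assoc _ _ _ _ _ _ _ _ _
    · exact V.low_assoc _ _ _ _ _ _ _ _ _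
  | low_juxt i hi a b c d =>
    ext <;> simp only [Square.juxt, Square.stack, Square.low, Square.idH, Square.idV,
      Square.flipH, Square.flipV]
    · exact H.low_seq _ _ _ _ _ _ _ _ _ _ _ _
    · exact H.low_seq _ _ _ _ _ _ _ _ _ _ _ _
  | low_stack i hi a b c d =>
    ext <;> simp only [Square.juxt, Square.stack, Square.low, Square.idH, Square.idV,
      Square.flipH, Square.flipV]
    · exact V.low_seq _ _ _ _ _ _ _ _ _ _ _ _
    · exact V.low_seq _ _ _ _ _ _ _ _ _ _ _ _
  | low_low i j hi hj hij a b c d =>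
    ext <;> simp only [Square.juxt, Square.stack, Square.low, Square.idH, Square.idV,
      Square.flipH, Square.flipV]
    · exact H.low_low _ _ _ _ hij _ _ _ _ _ _ _ _ _ _
    · exact H.low_low _ _ _ _ hij _ _ _ _ _ _ _ _ _ _
    · exact V.low_low _ _ _ _ hij _ _ _ _ _ _ _ _ _ _
    · exact V.low_low _ _ _ _ hij _ _ _ _ _ _ _ _ _ _
  | low_idH i hi f g h h' =>
    ext <;> simp only [Square.juxt, Square.stack, Square.low, Square.idH, Square.idV,
      Square.flipH, Square.flipV]
    · exact (V.comp_incl i _ _ _ h).trans (congrArg V.incl (H.src_low i hi f g h).symm)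
    · exact (V.comp_incl i _ _ _ (by rw [← H.t_src_tgt i hi, ← H.s_src_tgt i hi, h])).trans
        (congrArg V.incl (H.tgt_low i hi f g h).symm)
  | low_idV i hi d e h h' =>
    ext <;> simp only [Square.juxt, Square.stack, Square.low, Square.idH, Square.idV,
      Square.flipH, Square.flipV]
    · exact (H.comp_incl i _ _ _ h).trans (congrArg H.incl (V.src_low i hi d e h).symm)
    · exact (H.comp_incl i _ _ _ (by rw [← V.t_src_tgt i hi, ← V.s_src_tgt i hi, h])).trans
        (congrArg H.incl (V.tgt_low i hi d e h).symm)

/-- The square cells of the free `n`-category enriched in double groupoids generated by `X`. -/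
def SquareCell {V H : ExtCat C} (X : SqExt V H) : Type u :=
  Quot fun a b : (Σ p : Square V H, Pasting X p) => PRel X a.2 b.2

/-- The boundary of a square cell. -/
def SquareCell.bd {V H : ExtCat C} {X : SqExt V H} (A : SquareCell X) : Square V H :=
  Quot.lift (fun a : (Σ p : Square V H, Pasting X p) => a.1) (fun _ _ h => PRel.bd h) A

/-- Every square is the boundary of a square cell. -/
def SqExt.Acyclic {V H : ExtCat C} (X : SqExt V H) : Prop :=
  ∀ p : Square V H, ∃ A : SquareCell X, A.bd = p

/-! ### The Peiffer square extension -/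

section Peiffer

variable {V H : ExtCat C}

/-- The square with horizontal faces `f ⋆ᵢ v`, `f ⋆ᵢ v'` and vertical faces `u ⋆ᵢ e`, `u' ⋆ᵢ e`, for
`f : u ⟶ u'` and `e : v ⟶ v'`. -/
def Square.peifferR (i : ℕ) (hi : i < n) (f : H.Cell) (e : V.Cell)
    (h : C.t i (H.src f) = C.s i (V.src e)) : Square V H where
  top := H.whiskR i hi f (V.src e) h
  bot := H.whiskR i hi f (V.tgt e) (by rw [← V.s_src_tgt i hi, h])
  left := V.whiskL i hi (H.src f) e h
  right := V.whiskL i hi (H.tgt f) e (by rw [← H.t_src_tgt i hi, h])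
  tl := ((V.src_low ..).trans (C.comp_congr _ (V.src_incl _) (H.src_incl _).symm _ _)).trans
    (H.src_low ..).symm
  tr := ((V.src_low ..).trans (C.comp_congr _ (V.src_incl _) (H.tgt_incl _).symm _ _)).trans
    (H.tgt_low ..).symm
  bl := ((V.tgt_low ..).trans (C.comp_congr _ (V.tgt_incl _) (H.src_incl _).symm _ _)).trans
    (H.src_low ..).symm
  br := ((V.tgt_low ..).trans (C.comp_congr _ (V.tgt_incl _) (H.tgt_incl _).symm _ _)).trans
    (H.tgt_low ..).symm

/-- The square with horizontal faces `w ⋆ᵢ f`, `w' ⋆ᵢ f` and vertical faces `e ⋆ᵢ u`, `e ⋆ᵢ u'`, for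
`f : u ⟶ u'` and `e : w ⟶ w'`. -/
def Square.peifferL (i : ℕ) (hi : i < n) (f : H.Cell) (e : V.Cell)
    (h : C.t i (V.src e) = C.s i (H.src f)) : Square V H where
  top := H.whiskL i hi (V.src e) f h
  bot := H.whiskL i hi (V.tgt e) f (by rw [← V.t_src_tgt i hi, h])
  left := V.whiskR i hi e (H.src f) h
  right := V.whiskR i hi e (H.tgt f) (by rw [← H.s_src_tgt i hi, h])
  tl := ((V.src_low ..).trans (C.comp_congr _ (H.src_incl _).symm (V.src_incl _) _ _)).trans
    (H.src_low ..).symm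
  tr := ((V.src_low ..).trans (C.comp_congr _ (H.tgt_incl _).symm (V.src_incl _) _ _)).trans
    (H.tgt_low ..).symm
  bl := ((V.tgt_low ..).trans (C.comp_congr _ (H.src_incl _).symm (V.tgt_incl _) _ _)).trans
    (H.src_low ..).symm
  br := ((V.tgt_low ..).trans (C.comp_congr _ (H.tgt_incl _).symm (V.tgt_incl _) _ _)).trans
    (H.tgt_low ..).symm

/-- The Peiffer square extension of the pair `(V, H)`. -/
def peiffer (V H : ExtCat C) : SqExt V H where
  Gen := {p : Square V H // ∃ (i : ℕ) (hi : i < n) (f : H.Cell) (e : V.Cell),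
    (∃ h, p = Square.peifferR i hi f e h) ∨ ∃ h, p = Square.peifferL i hi f e h}
  bd p := p.1

end Peiffer

/-- A square extension of `(V, C[Γ])`, seen as a square extension of `(V, C(Γ))`. -/
noncomputable def SqExt.toInv {V : ExtCat C} {Γ : CellExt C} (X : SqExt V (free Γ)) :
    SqExt V (freeInv Γ) where
  Gen := X.Gen
  bd x := (X.bd x).map id (PolyMod.toInv Γ) (fun _ => rfl) (fun _ => rfl) (src_toInv Γ) (tgt_toInv Γ)

/-! ### Extensions modulo -/

/-- The generators of the cellular extension `_E R_E`: composable triples `(e, r, e')` with `r` a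
rewriting step of `R` and `e`, `e'` cells of the free `(n+1,n)`-category on `E`. -/
@[ext]
structure ModRule (R E : CellExt C) where
  left : (freeInv E).Cell
  mid : (free R).Cell
  right : (freeInv E).Cell
  step : IsStep R mid
  tgt_left : (freeInv E).tgt left = (free R).src mid
  src_right : (freeInv E).src right = (free R).tgt mid

/-- A rule `γ` of `R`, as the triple `(1, γ, 1)`. -/
noncomputable def ModRule.ofRule (R E : CellExt C) (γ : R.Gen) : ModRule R E where
  left := (freeInv E).incl (R.src γ)
  mid := freeGen R γ
  right := (freeInv E).incl (R.tgt γ)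
  step := isStep_freeGen R γ
  tgt_left := rfl
  src_right := rfl

/-- The cellular extension `_E R_E`. -/
noncomputable def ere (R E : CellExt C) : CellExt C where
  Gen := ModRule R E
  src γ := (freeInv E).src γ.left
  tgt γ := (freeInv E).tgt γ.right
  s_eq γ i hi := by
    rw [(freeInv E).s_src_tgt i hi, γ.tgt_left, (free R).s_src_tgt i hi, ← γ.src_right,
      (freeInv E).s_src_tgt i hi]
  t_eq γ i hi := by
    rw [(freeInv E).t_src_tgt i hi, γ.tgt_left, (free R).t_src_tgt i hi, ← γ.src_right,
      (freeInv E).t_src_tgt i hi]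

/-- A subset of the generators of a cellular extension, as a cellular extension. -/
def CellExt.restrict (Γ : CellExt C) (S : Set Γ.Gen) : CellExt C where
  Gen := S
  src γ := Γ.src γ.1
  tgt γ := Γ.tgt γ.1
  s_eq γ := Γ.s_eq γ.1
  t_eq γ := Γ.t_eq γ.1

section Modulo

variable {R E : CellExt C} (S : Set (ere R E).Gen)

/-- The functor from the free `(n+1)`-category on `S ⊆ _E R_E` to `C[R, E, E⁻]/Inv(E)`, sending
`(e, r, e')` to the composite `e ⋆ r ⋆ e'`. -/
noncomputable def modEval : (free ((ere R E).restrict S)).Cell → (freeMixed R E).Cell :=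
  freeLift (freeMixed R E)
    (fun γ => (freeMixed R E).seq (invToMixed R E γ.1.left)
      ((freeMixed R E).seq (toMixed R E γ.1.mid) (invToMixed R E γ.1.right)
        (by rw [tgt_toMixed, src_invToMixed, γ.1.src_right]))
      (by rw [tgt_invToMixed, ExtCat.src_seq, src_toMixed, γ.1.tgt_left]))
    (fun γ => by rw [ExtCat.src_seq, src_invToMixed]; rfl)
    (fun γ => by rw [ExtCat.tgt_seq, ExtCat.tgt_seq, tgt_invToMixed]; rfl)

/-- `f'` is a cell `e f` of the free `(n+1)`-category on `S`, obtained by letting the cell `e` act on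
the left of `f`: either `e` is an identity and `f' = f`, or `f = f₁ ⋆ f₂` and `f' = f₁' ⋆ f₂` with
`f₁` and `f₁'` rewriting steps such that `f₁'` represents the composite `e ⋆ f₁`. -/
def IsLeftAct (e : (freeInv E).Cell) (f f' : (free ((ere R E).restrict S)).Cell) : Prop :=
  (e = (freeInv E).incl ((free ((ere R E).restrict S)).src f) ∧ f' = f) ∨
  ∃ (f₁ f₁' f₂ : (free ((ere R E).restrict S)).Cell) (h : _) (h' : _) (h'' : _),
    IsStep ((ere R E).restrict S) f₁ ∧ IsStep ((ere R E).restrict S) f₁' ∧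
    f = (free ((ere R E).restrict S)).seq f₁ f₂ h ∧
    f' = (free ((ere R E).restrict S)).seq f₁' f₂ h' ∧
    modEval S f₁' = (freeMixed R E).seq (invToMixed R E e) (modEval S f₁) h''

variable {S}

theorem IsLeftAct.src {e : (freeInv E).Cell} {f f' : (free ((ere R E).restrict S)).Cell}
    (h : IsLeftAct S e f f') :
    (free ((ere R E).restrict S)).src f' = (freeInv E).src e := by
  rcases h with ⟨rfl, rfl⟩ | ⟨f₁, f₁', f₂, h, h', h'', -, -, -, rfl, h₁⟩
  · exact ((freeInv E).src_incl _).symm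
  · rw [ExtCat.src_seq, ← src_freeLift (freeMixed R E) _ _ _ f₁']
    exact (congrArg (freeMixed R E).src h₁).trans
      ((ExtCat.src_seq _ _ _ _).trans (src_invToMixed R E e))

theorem IsLeftAct.tgt {e : (freeInv E).Cell} {f f' : (free ((ere R E).restrict S)).Cell}
    (h : IsLeftAct S e f f') :
    (free ((ere R E).restrict S)).tgt f' = (free ((ere R E).restrict S)).tgt f := by
  rcases h with ⟨rfl, rfl⟩ | ⟨f₁, f₁', f₂, h, h', h'', -, -, rfl, rfl, h₁⟩
  · rfl
  · rw [ExtCat.tgt_seq, ExtCat.tgt_seq]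

/-- A generating square `A` of `Γ`, together with cells `e₁`, `e₂` that act on `A`: `e₁` acts on the
top face and the inverse of `e₂` acts on the bottom face. -/
structure Action (Γ : SqExt (freeInv E) (free ((ere R E).restrict S))) where
  A : Γ.Gen
  e₁ : (freeInv E).Cell
  e₂ : (freeInv E).Cell
  e₂' : (freeInv E).Cell
  top : (free ((ere R E).restrict S)).Cell
  bot : (free ((ere R E).restrict S)).Cell
  tgt_e₁ : (freeInv E).tgt e₁ = (freeInv E).src (Γ.bd A).left
  src_e₂ : (freeInv E).tgt (Γ.bd A).left = (freeInv E).src e₂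
  inv : (freeInv E).IsInverse e₂ e₂'
  act_top : IsLeftAct S e₁ (Γ.bd A).top top
  act_bot : IsLeftAct S e₂' (Γ.bd A).bot bot

/-- The square extension `E ⋊ Γ`: the squares with horizontal faces `e₁ f` and `e₂⁻ g` and vertical
faces `e₁ ⋆ e ⋆ e₂` and `e'`, for all squares of `Γ` with horizontal faces `f`, `g` and vertical faces
`e`, `e'`. -/
noncomputable def semidirect (Γ : SqExt (freeInv E) (free ((ere R E).restrict S))) :
    SqExt (freeInv E) (free ((ere R E).restrict S)) where
  Gen := Action Γ
  bd x :=
    { top := x.top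
      bot := x.bot
      left := (freeInv E).seq x.e₁ ((freeInv E).seq (Γ.bd x.A).left x.e₂ x.src_e₂)
        (by rw [ExtCat.src_seq, x.tgt_e₁])
      right := (Γ.bd x.A).right
      tl := by rw [ExtCat.src_seq, x.act_top.src]
      tr := by rw [x.act_top.tgt, (Γ.bd x.A).tr]
      bl := by rw [ExtCat.tgt_seq, ExtCat.tgt_seq, x.act_bot.src, x.inv.choose]
      br := by rw [x.act_bot.tgt, (Γ.bd x.A).br] }

variable (S)

/-- `S` contains `R`. -/
def ContainsRules : Prop := ∀ γ : R.Gen, ModRule.ofRule R E γ ∈ S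

/-- The rewriting steps of `R`, as cells of the free `(n+1)`-category on `S`. -/
def IsPrimaryStep (hS : ContainsRules S) (g : (free ((ere R E).restrict S)).Cell) : Prop :=
  ∃ (W : Whisker C) (γ : R.Gen),
    W.Sends (free ((ere R E).restrict S))
      (freeGen ((ere R E).restrict S) ⟨ModRule.ofRule R E γ, hS γ⟩) g

/-- The (unordered) critical branchings `(f, g)` of `S` with `g` a rewriting step of `R`. -/
def PrimaryCritical (hS : ContainsRules S) : Type u :=
  {p : Sym2 (free ((ere R E).restrict S)).Cell //
    ∃ f g, p = s(f, g) ∧ IsCritical ((ere R E).restrict S) f g ∧ IsPrimaryStep S hS g}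

/-- The critical branchings `(f, e)` of `S` modulo `E`. -/
def CriticalModulo : Type u :=
  {p : (free ((ere R E).restrict S)).Cell × (freeInv E).Cell //
    IsCriticalModulo ((ere R E).restrict S) E p.1 p.2}

/-- `Γ` is a coherent completion of `S` modulo `E`: it consists of one square with faces
`(f ⋆ f', g ⋆ g', 1, e')` for each critical branching `(f, g)` with `g` a step of `R`, and one
square with faces `(f ⋆ f', g', e, e')` for each critical branching `(f, e)` of `S` modulo `E`. -/
def IsCompletionModulo (hS : ContainsRules S)
    (Γ : SqExt (freeInv E) (free ((ere R E).restrict S))) : Prop :=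
  ∃ φ : (PrimaryCritical S hS ⊕ CriticalModulo S) ≃ Γ.Gen,
    (∀ p : PrimaryCritical S hS, ∃ (f g f' g' : (free ((ere R E).restrict S)).Cell) (h : _) (h' : _),
      p.1 = s(f, g) ∧ IsPrimaryStep S hS g ∧
      (Γ.bd (φ (.inl p))).top = (free ((ere R E).restrict S)).seq f f' h ∧
      (Γ.bd (φ (.inl p))).bot = (free ((ere R E).restrict S)).seq g g' h' ∧
      (Γ.bd (φ (.inl p))).left =
        (freeInv E).incl ((free ((ere R E).restrict S)).src f)) ∧
    ∀ p : CriticalModulo S, ∃ (f' : (free ((ere R E).restrict S)).Cell) (h : _),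
      (Γ.bd (φ (.inr p))).top = (free ((ere R E).restrict S)).seq p.1.1 f' h ∧
      (Γ.bd (φ (.inr p))).left = p.1.2

end Modulo

/-- The (unordered) critical branchings of a cellular extension. -/
def CriticalBranching (E : CellExt C) : Type u :=
  {p : Sym2 (free E).Cell // ∃ e e', p = s(e, e') ∧ IsCritical E e e'}

/-- `X` is a coherent completion of `E`, seen as a square extension of `(C(E), H)` with trivial
horizontal faces: it consists of one square with vertical faces `e ⋆ e₁` and `e' ⋆ e₁'` for each
critical branching `(e, e')` of `E`. -/
def IsCompletion (E : CellExt C) {H : ExtCat C} (X : SqExt (freeInv E) H) : Prop :=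
  ∃ φ : CriticalBranching E ≃ X.Gen,
    ∀ p : CriticalBranching E, ∃ (e e' e₁ e₁' : (free E).Cell) (h : _) (h' : _),
      p.1 = s(e, e') ∧
      (X.bd (φ p)).left = toInv E ((free E).seq e e₁ h) ∧
      (X.bd (φ p)).right = toInv E ((free E).seq e' e₁' h') ∧
      (X.bd (φ p)).top = H.incl ((free E).src e) ∧
      (X.bd (φ p)).bot = H.incl ((free E).tgt e₁)

/-- `Γ` is a family of generating confluences of `E`: it consists of one generator
`e ⋆ e₁ ⟶ e' ⋆ e₁'` for each critical branching `(e, e')` of `E`. -/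
def IsGlobularCompletion (E : CellExt C) (Γ : CellExt (freeInv E).toNCat) : Prop :=
  ∃ φ : CriticalBranching E ≃ Γ.Gen,
    ∀ p : CriticalBranching E, ∃ (e e' e₁ e₁' : (free E).Cell) (h : _) (h' : _),
      p.1 = s(e, e') ∧
      Γ.src (φ p) = toInv E ((free E).seq e e₁ h) ∧
      Γ.tgt (φ p) = toInv E ((free E).seq e' e₁' h')

/-- The cellular extension `Γ` of the `(n+1,n)`-category `D` is acyclic: any two parallel cells are
the source and the target of a cell of the free `(n+2,n)`-category `D(Γ)`. -/
def CellExt.Acyclic {D : ExtCat C} (Γ : CellExt D.toNCat) : Prop :=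
  ∀ f g : D.Cell, D.src f = D.src g → D.tgt f = D.tgt g →
    ∃ A : (freeInv Γ).Cell, (freeInv Γ).src A = f ∧ (freeInv Γ).tgt A = g

end Ext

/-! ### Polygraphs and polygraphs modulo -/

/-- The type of `n`-polygraphs, together with the free `n`-category functor on objects: a
`0`-polygraph is a set, and an `(n+1)`-polygraph is an `n`-polygraph with a cellular extension of the
free `n`-category it generates. -/
noncomputable def PolygraphData : (n : ℕ) → Σ T : Type (u + 1), (T → NCat.{u} n)
  | 0 => ⟨Type u, NCat.ofSet⟩
  | n + 1 => ⟨Σ P : (PolygraphData n).1, CellExt ((PolygraphData n).2 P),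
      fun P => (free P.2).toNCat⟩

/-- An `n`-polygraph. -/
def Polygraph (n : ℕ) : Type (u + 1) := (PolygraphData.{u} n).1

/-- The free `n`-category on an `n`-polygraph. -/
noncomputable def Polygraph.cat {n : ℕ} (P : Polygraph.{u} n) : NCat.{u} n :=
  (PolygraphData.{u} n).2 P

/-- The underlying `n`-polygraph of an `(n+1)`-polygraph. -/
def Polygraph.base {n : ℕ} (P : Polygraph.{u} (n + 1)) : Polygraph.{u} n :=
  Sigma.fst (β := fun P : (PolygraphData.{u} n).1 => CellExt ((PolygraphData.{u} n).2 P)) P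

/-- The generating `(n+1)`-cells of an `(n+1)`-polygraph. -/
def Polygraph.rules {n : ℕ} (P : Polygraph.{u} (n + 1)) : CellExt P.base.cat :=
  Sigma.snd (β := fun P : (PolygraphData.{u} n).1 => CellExt ((PolygraphData.{u} n).2 P)) P

/-- An `(m+1)`-polygraph modulo: an `(m+1)`-polygraph `R`, a set `E` of modulo rules on the free
`m`-category generated by the underlying `m`-polygraph of `R`, and a cellular extension `S` with
`R ⊆ S ⊆ _E R_E`. -/
structure PolygraphModulo (m : ℕ) where
  R : Polygraph.{u} (m + 1)
  E : CellExt R.base.cat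
  S : Set (ere R.rules E).Gen
  rules_mem : ContainsRules S

namespace PolygraphModulo

variable {m : ℕ} (P : PolygraphModulo.{u} m)

/-- The cellular extension `S`. -/
noncomputable def ext : CellExt P.R.base.cat := (ere P.R.rules P.E).restrict P.S

/-- `E` is convergent, `_E R_E` is terminating, and `S` is confluent modulo `E`. -/
def Diconvergent : Prop :=
  Convergent P.E ∧ Terminating (ere P.R.rules P.E) ∧ ConfluentModulo P.ext P.E

/-- `Γ` is a coherent completion of `S` modulo `E`. -/
def IsCoherentCompletion (Γ : SqExt (freeInv P.E) (free P.ext)) : Prop :=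
  IsCompletionModulo P.S P.rules_mem Γ

/-- The square extension `(E ⋊ Γ) ∪ Peiffer(E^⊤, S^*) ∪ X` of the pair `(E^⊤, S^⊤)`. -/
noncomputable def extend (Γ : SqExt (freeInv P.E) (free P.ext))
    (X : SqExt (freeInv P.E) (freeInv P.ext)) : SqExt (freeInv P.E) (freeInv P.ext) :=
  ((semidirect Γ).toInv.union (peiffer (freeInv P.E) (free P.ext)).toInv).union X

end PolygraphModulo

end PolyMod

namespace PolyMod

/-! ### Total composition -/

section Total

variable {n : ℕ}

/-! Both statements are Newman's lemma with the diagrams kept. Every cell of a free category is a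
composite of steps (`isPath_free`, `isPath_freeInv`), so coherence is a matter of steps, of
branchings of steps, and of chosen reductions to normal form.

Local branchings reduce to critical ones because the base category is free on a polygraph. Its cells
have sizes, one for each dimension, and a non-trivial whisker strictly increases them for a
well-founded lexicographic order (`Polygraph.nonempty_weights`, `Whisker.Fits.trivial_or_lt`).
Stripping whiskers off a branching therefore stops, at an aspherical, Peiffer or critical one
(`local_branching_induction`).

Squier's theorem is proved for any congruence that closes the critical branchings. Newman's
induction relates two reductions from the same cell to irreducible cells (`Congruence.newman`). With
a normalising reduction `k u` chosen for each `u`, a zigzag `a` from `u` to `v` then satisfies `a ⋆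
k v ~ k u`. Cancelling `k v`, which is invertible, shows that the class of `a` depends only on its
boundary (`Congruence.total`). The congruence "source and target of a cell over `Γ`" gives the
coherence theorem (`squier`). The congruence "vertical faces of a filled square with trivial
horizontal faces" shows that conf(E) fills all vertical globes (`globe_of_completion`).

For the theorem modulo, the central property is `CoherentModulo.coherentAt`: two `S`-reductions to
irreducible cells, with sources joined by a given cell `e` of `E^⊤`, are the top and bottom of a
filled square with left face `e`. The induction is on `Precedes`, which combines rewriting by `R`
modulo `E` with removal of whiskers and passage to `E`-equivalent cells. As vertical globes are
filled, left faces can be ignored until the end. Two steps are thus called coherent when they extend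
to some filled square, and the induction hypothesis makes this relation transitive
(`CoherentModulo.trans`).

A step of `S` is moved along a step of `E` by a trichotomy: the pair is Peiffer, critical, or a
whiskering of a smaller pair (`CoherentModulo.cross`). Hence it is coherent with a step on the
`E`-normal form of its source, and from there with a step on any `E`-equivalent cell
(`CoherentModulo.exists_coherent_step`). The completion only treats branchings of `S` against `R`.
This is enough, because the source of a step of `S` is `E`-equivalent to the source of a step of
`R`, to which all steps on equivalent sources can be compared
(`CoherentModulo.coherent_of_equivalent`). Newman's pasting closes the induction, and an arbitrary
square is recovered from squares between normalising reductions, which are invertible in `S^⊤`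
(`CoherentModulo.acyclic`). -/

open Classical in
/-- The composite `a ⋆ᵢ b`, with a dummy value when it is not defined. -/
noncomputable def NCat.cmp (C : NCat.{u} n) (i : ℕ) (a b : C.Cell) : C.Cell :=
  if h : C.t i a = C.s i b then C.comp i a b h else a

namespace NCat

variable (C : NCat.{u} n)

theorem cmp_eq {i : ℕ} {a b : C.Cell} (h : C.t i a = C.s i b) : C.cmp i a b = C.comp i a b h :=
  dif_pos h

theorem comp_eq_cmp {i : ℕ} {a b : C.Cell} (h : C.t i a = C.s i b) :
    C.comp i a b h = C.cmp i a b := (C.cmp_eq h).symm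

theorem s_cmp {i : ℕ} {a b : C.Cell} (h : C.t i a = C.s i b) : C.s i (C.cmp i a b) = C.s i a := by
  rw [C.cmp_eq h, C.s_comp]

theorem t_cmp {i : ℕ} {a b : C.Cell} (h : C.t i a = C.s i b) : C.t i (C.cmp i a b) = C.t i b := by
  rw [C.cmp_eq h, C.t_comp]

theorem s_cmp_low {i j : ℕ} (hj : j < i) {a b : C.Cell} (h : C.t i a = C.s i b) :
    C.s j (C.cmp i a b) = C.s j a := by
  rw [← C.s_s_lt j i _ hj, C.s_cmp h, C.s_s_lt _ _ _ hj]

theorem t_cmp_low {i j : ℕ} (hj : j < i) {a b : C.Cell} (h : C.t i a = C.s i b) :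
    C.t j (C.cmp i a b) = C.t j b := by
  rw [← C.t_t_lt j i _ hj, C.t_cmp h, C.t_t_lt _ _ _ hj]

theorem s_eq_of_comp {i j : ℕ} (hj : j < i) {a b : C.Cell} (h : C.t i a = C.s i b) :
    C.s j a = C.s j b := by
  rw [← C.s_t_lt j i _ hj, h, C.s_s_lt _ _ _ hj]

theorem t_eq_of_comp {i j : ℕ} (hj : j < i) {a b : C.Cell} (h : C.t i a = C.s i b) :
    C.t j a = C.t j b := by
  rw [← C.t_t_lt j i _ hj, h, C.t_s_lt _ _ _ hj]

theorem cond_s {i j : ℕ} (hj : i < j) {a b : C.Cell} (h : C.t i a = C.s i b) :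
    C.t i (C.s j a) = C.s i (C.s j b) := by
  rw [C.t_s_lt _ _ _ hj, C.s_s_lt _ _ _ hj, h]

theorem cond_t {i j : ℕ} (hj : i < j) {a b : C.Cell} (h : C.t i a = C.s i b) :
    C.t i (C.t j a) = C.s i (C.t j b) := by
  rw [C.t_t_lt _ _ _ hj, C.s_t_lt _ _ _ hj, h]

theorem s_cmp_high {i j : ℕ} (hj : i < j) {a b : C.Cell} (h : C.t i a = C.s i b) :
    C.s j (C.cmp i a b) = C.cmp i (C.s j a) (C.s j b) := by
  rw [C.cmp_eq h, C.cmp_eq (C.cond_s hj h), C.s_comp_lt _ _ _ _ _ _ hj]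

theorem t_cmp_high {i j : ℕ} (hj : i < j) {a b : C.Cell} (h : C.t i a = C.s i b) :
    C.t j (C.cmp i a b) = C.cmp i (C.t j a) (C.t j b) := by
  rw [C.cmp_eq h, C.cmp_eq (C.cond_t hj h), C.t_comp_lt _ _ _ _ _ _ hj]

theorem id_cmp {i : ℕ} {x a : C.Cell} (hx : x = C.s i a) : C.cmp i x a = a := by
  subst hx
  rw [C.cmp_eq (C.t_s_le _ _ _ le_rfl), C.id_comp]

theorem cmp_id {i : ℕ} {a x : C.Cell} (hx : x = C.t i a) : C.cmp i a x = a := by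
  subst hx
  rw [C.cmp_eq (C.s_t_le _ _ _ le_rfl).symm, C.comp_id]

theorem cmp_assoc {i : ℕ} {a b c : C.Cell} (h : C.t i a = C.s i b) (h' : C.t i b = C.s i c) :
    C.cmp i (C.cmp i a b) c = C.cmp i a (C.cmp i b c) := by
  have h₁ : C.t i (C.comp i a b h) = C.s i c := by rw [C.t_comp, h']
  have h₂ : C.t i a = C.s i (C.comp i b c h') := by rw [C.s_comp, h]
  rw [C.cmp_eq h, C.cmp_eq h', C.cmp_eq h₁, C.cmp_eq h₂, C.assoc]

theorem cmp_exchange {i j : ℕ} (hij : i < j) {a b c d : C.Cell} (hab : C.t j a = C.s j b)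
    (hcd : C.t j c = C.s j d) (hac : C.t i a = C.s i c) :
    C.cmp i (C.cmp j a b) (C.cmp j c d) = C.cmp j (C.cmp i a c) (C.cmp i b d) := by
  have hbd : C.t i b = C.s i d := by
    rw [← C.t_eq_of_comp hij hab, ← C.s_eq_of_comp hij hcd, hac]
  have h₁ : C.t i (C.cmp j a b) = C.s i (C.cmp j c d) := by
    rw [C.t_cmp_low hij hab, C.s_cmp_low hij hcd, hbd, C.s_eq_of_comp hij hcd]
  have h₂ : C.t j (C.cmp i a c) = C.s j (C.cmp i b d) := by
    rw [C.t_cmp_high hij hac, C.s_cmp_high hij hbd, hab, hcd]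
  rw [C.cmp_eq h₁, C.cmp_eq h₂]
  simp only [C.cmp_eq hab, C.cmp_eq hcd, C.cmp_eq hac, C.cmp_eq hbd]
  rw [C.exchange _ _ _ _ _ _ _ _ _ _ _ _ hij]

/-- Two cells are parallel if they have the same `i`-sources and `i`-targets for `i < n`. -/
def Par (a b : C.Cell) : Prop := ∀ i < n, C.s i a = C.s i b ∧ C.t i a = C.t i b

variable {C}

theorem Par.refl (a : C.Cell) : C.Par a a := fun _ _ => ⟨rfl, rfl⟩

theorem Par.trans {a b c : C.Cell} (h : C.Par a b) (h' : C.Par b c) : C.Par a c :=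
  fun i hi => ⟨(h i hi).1.trans (h' i hi).1, (h i hi).2.trans (h' i hi).2⟩

theorem Par.cmp {a b a' b' : C.Cell} (ha : C.Par a a') (hb : C.Par b b') {j : ℕ} (hj : j < n)
    (h : C.t j a = C.s j b) : C.Par (C.cmp j a b) (C.cmp j a' b') := by
  have h' : C.t j a' = C.s j b' := by rw [← (ha j hj).2, ← (hb j hj).1, h]
  intro i hi
  rcases lt_trichotomy i j with hij | rfl | hij
  · rw [C.s_cmp_low hij h, C.s_cmp_low hij h', C.t_cmp_low hij h, C.t_cmp_low hij h']
    exact ⟨(ha i hi).1, (hb i hi).2⟩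
  · rw [C.s_cmp h, C.s_cmp h', C.t_cmp h, C.t_cmp h']
    exact ⟨(ha i hi).1, (hb i hi).2⟩
  · rw [C.s_cmp_high hij h, C.s_cmp_high hij h', C.t_cmp_high hij h, C.t_cmp_high hij h',
      (ha i hi).1, (hb i hi).1, (ha i hi).2, (hb i hi).2]
    exact ⟨rfl, rfl⟩

end NCat

variable {C : NCat.{u} n}

namespace ExtCat

variable (D : ExtCat C)

/-- The composite `a ⋆ₙ b` of two `(n+1)`-cells, with a dummy value when it is not defined. -/
noncomputable def sq (a b : D.Cell) : D.Cell := D.cmp n a b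

/-- `x ⋆ᵢ a`, with a dummy value when it is not defined. -/
noncomputable def wl (i : ℕ) (x : C.Cell) (a : D.Cell) : D.Cell := D.cmp i (D.incl x) a

/-- `a ⋆ᵢ x`, with a dummy value when it is not defined. -/
noncomputable def wr (i : ℕ) (a : D.Cell) (x : C.Cell) : D.Cell := D.cmp i a (D.incl x)

variable {D}

theorem par (a : D.Cell) : C.Par (D.src a) (D.tgt a) :=
  fun i hi => ⟨D.s_src_tgt i hi a, D.t_src_tgt i hi a⟩

theorem seq_eq_sq {a b : D.Cell} (h : D.tgt a = D.src b) : D.seq a b h = D.sq a b :=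
  D.comp_eq_cmp _

theorem low_eq_cmp {i : ℕ} (hi : i < n) {a b : D.Cell} (h : C.t i (D.src a) = C.s i (D.src b)) :
    D.low i hi a b h = D.cmp i a b := D.comp_eq_cmp _

theorem whiskL_eq_wl {i : ℕ} (hi : i < n) {x : C.Cell} {a : D.Cell}
    (h : C.t i x = C.s i (D.src a)) : D.whiskL i hi x a h = D.wl i x a := D.comp_eq_cmp _

theorem whiskR_eq_wr {i : ℕ} (hi : i < n) {x : C.Cell} {a : D.Cell}
    (h : C.t i (D.src a) = C.s i x) : D.whiskR i hi a x h = D.wr i a x := D.comp_eq_cmp _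

theorem src_sq {a b : D.Cell} (h : D.tgt a = D.src b) : D.src (D.sq a b) = D.src a := by
  rw [← seq_eq_sq h, D.src_seq]

theorem tgt_sq {a b : D.Cell} (h : D.tgt a = D.src b) : D.tgt (D.sq a b) = D.tgt b := by
  rw [← seq_eq_sq h, D.tgt_seq]

theorem idn_sq {x : C.Cell} {a : D.Cell} (h : x = D.src a) : D.sq (D.incl x) a = a := by
  rw [← seq_eq_sq ((D.tgt_incl x).trans h), D.idn_seq]

theorem sq_idn {x : C.Cell} {a : D.Cell} (h : D.tgt a = x) : D.sq a (D.incl x) = a := by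
  rw [← seq_eq_sq (h.trans (D.src_incl x).symm), D.seq_idn]

theorem sq_assoc {a b c : D.Cell} (h : D.tgt a = D.src b) (h' : D.tgt b = D.src c) :
    D.sq (D.sq a b) c = D.sq a (D.sq b c) := D.cmp_assoc (D.seq_cond h) (D.seq_cond h')

theorem src_cmp {i : ℕ} (hi : i < n) {a b : D.Cell} (h : C.t i (D.src a) = C.s i (D.src b)) :
    D.src (D.cmp i a b) = C.cmp i (D.src a) (D.src b) := by
  rw [← low_eq_cmp hi h, D.src_low, C.cmp_eq h]

theorem tgt_cmp {i : ℕ} (hi : i < n) {a b : D.Cell} (h : C.t i (D.src a) = C.s i (D.src b)) :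
    D.tgt (D.cmp i a b) = C.cmp i (D.tgt a) (D.tgt b) := by
  rw [← low_eq_cmp hi h, D.tgt_low, C.cmp_eq]

theorem src_wl {i : ℕ} (hi : i < n) {x : C.Cell} {a : D.Cell} (h : C.t i x = C.s i (D.src a)) :
    D.src (D.wl i x a) = C.cmp i x (D.src a) := by
  rw [wl, src_cmp hi (by rw [D.src_incl, h]), D.src_incl]

theorem tgt_wl {i : ℕ} (hi : i < n) {x : C.Cell} {a : D.Cell} (h : C.t i x = C.s i (D.src a)) :
    D.tgt (D.wl i x a) = C.cmp i x (D.tgt a) := by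
  rw [wl, tgt_cmp hi (by rw [D.src_incl, h]), D.tgt_incl]

theorem src_wr {i : ℕ} (hi : i < n) {x : C.Cell} {a : D.Cell} (h : C.t i (D.src a) = C.s i x) :
    D.src (D.wr i a x) = C.cmp i (D.src a) x := by
  rw [wr, src_cmp hi (by rw [D.src_incl, h]), D.src_incl]

theorem tgt_wr {i : ℕ} (hi : i < n) {x : C.Cell} {a : D.Cell} (h : C.t i (D.src a) = C.s i x) :
    D.tgt (D.wr i a x) = C.cmp i (D.tgt a) x := by
  rw [wr, tgt_cmp hi (by rw [D.src_incl, h]), D.tgt_incl]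

theorem cmp_incl {i : ℕ} {x y : C.Cell} (h : C.t i x = C.s i y) :
    D.cmp i (D.incl x) (D.incl y) = D.incl (C.cmp i x y) := by
  have h' : D.t i (D.incl x) = D.s i (D.incl y) := by rw [D.t_incl, D.s_incl, h]
  rw [D.cmp_eq h', D.comp_incl i x y h' h, C.cmp_eq h]

theorem cmp_sq {i : ℕ} (hi : i < n) {a b c d : D.Cell} (hab : D.tgt a = D.src b)
    (hcd : D.tgt c = D.src d) (hac : C.t i (D.src a) = C.s i (D.src c)) :
    D.cmp i (D.sq a b) (D.sq c d) = D.sq (D.cmp i a c) (D.cmp i b d) :=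
  D.cmp_exchange hi (D.seq_cond hab) (D.seq_cond hcd) (D.low_cond hi hac)

theorem wl_sq {i : ℕ} (hi : i < n) {x : C.Cell} {a b : D.Cell} (h : C.t i x = C.s i (D.src a))
    (hab : D.tgt a = D.src b) : D.wl i x (D.sq a b) = D.sq (D.wl i x a) (D.wl i x b) := by
  have := D.cmp_sq hi (a := D.incl x) (b := D.incl x) (by rw [D.tgt_incl, D.src_incl]) hab
    (by rw [D.src_incl, h])
  rwa [idn_sq (D.src_incl x).symm] at this

theorem wr_sq {i : ℕ} (hi : i < n) {x : C.Cell} {a b : D.Cell} (h : C.t i (D.src a) = C.s i x)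
    (hab : D.tgt a = D.src b) : D.wr i (D.sq a b) x = D.sq (D.wr i a x) (D.wr i b x) := by
  have := D.cmp_sq hi (c := D.incl x) (d := D.incl x) hab (by rw [D.tgt_incl, D.src_incl])
    (by rw [D.src_incl, h])
  rwa [idn_sq (D.src_incl x).symm] at this

/-- By exchange with identities, two cells side by side can be performed one after the other. This
reduces all low-dimensional compositions to whiskerings and `⋆ₙ`; the other order, in
`cmp_eq_wl_wr`, gives the confluence of Peiffer branchings. -/
theorem cmp_eq_wr_wl {i : ℕ} (hi : i < n) {a b : D.Cell} (h : C.t i (D.src a) = C.s i (D.src b)) :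
    D.cmp i a b = D.sq (D.wr i a (D.src b)) (D.wl i (D.tgt a) b) := by
  rw [wr, wl, ← cmp_sq hi (D.src_incl _).symm (D.tgt_incl _) (by rw [D.src_incl, h]), sq_idn rfl,
    idn_sq rfl]

theorem cmp_eq_wl_wr {i : ℕ} (hi : i < n) {a b : D.Cell} (h : C.t i (D.src a) = C.s i (D.src b)) :
    D.cmp i a b = D.sq (D.wl i (D.src a) b) (D.wr i a (D.tgt b)) := by
  rw [wr, wl, ← cmp_sq hi (D.tgt_incl _) (D.src_incl _).symm (by rw [D.src_incl, h]), sq_idn rfl,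
    idn_sq rfl]

theorem IsInverse.symm {a b : D.Cell} (h : D.IsInverse a b) : D.IsInverse b a := by
  obtain ⟨h₁, h₂, h₃, h₄⟩ := h
  exact ⟨h₂, h₁, by rw [h₄, h₁], by rw [h₃, h₂]⟩

theorem isInverse_iff {a b : D.Cell} : D.IsInverse a b ↔ D.tgt a = D.src b ∧ D.tgt b = D.src a ∧
    D.sq a b = D.incl (D.src a) ∧ D.sq b a = D.incl (D.tgt a) := by
  constructor
  · rintro ⟨h, h', h₁, h₂⟩
    rw [seq_eq_sq] at h₁ h₂
    exact ⟨h, h', h₁, h₂⟩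
  · rintro ⟨h, h', h₁, h₂⟩
    exact ⟨h, h', (seq_eq_sq h).trans h₁, (seq_eq_sq h').trans h₂⟩

theorem isInverse_incl (x : C.Cell) : D.IsInverse (D.incl x) (D.incl x) := by
  rw [isInverse_iff, D.src_incl, D.tgt_incl, idn_sq (D.src_incl x).symm]
  exact ⟨rfl, rfl, rfl, rfl⟩

theorem IsInverse.sq {a b a' b' : D.Cell} (ha : D.IsInverse a a') (hb : D.IsInverse b b')
    (h : D.tgt a = D.src b) : D.IsInverse (D.sq a b) (D.sq b' a') := by
  rw [isInverse_iff] at ha hb ⊢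
  obtain ⟨a₁, a₂, a₃, a₄⟩ := ha
  obtain ⟨b₁, b₂, b₃, b₄⟩ := hb
  have h' : D.tgt b' = D.src a' := by rw [b₂, ← h, a₁]
  refine ⟨by rw [tgt_sq h, src_sq h', b₁], by rw [tgt_sq h', src_sq h, a₂], ?_, ?_⟩
  · rw [sq_assoc h (by rw [src_sq h', b₁]), ← sq_assoc b₁ h', b₃, idn_sq (by rw [← h, a₁]), a₃,
      src_sq h]
  · rw [sq_assoc h' (by rw [src_sq h, a₂]), ← sq_assoc a₂ h, a₄, idn_sq h, b₄, tgt_sq h]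

theorem IsInverse.wl {a a' : D.Cell} (ha : D.IsInverse a a') {i : ℕ} (hi : i < n) {x : C.Cell}
    (h : C.t i x = C.s i (D.src a)) : D.IsInverse (D.wl i x a) (D.wl i x a') := by
  rw [isInverse_iff] at ha ⊢
  obtain ⟨a₁, a₂, a₃, a₄⟩ := ha
  have h' : C.t i x = C.s i (D.src a') := by rw [← a₁, ← D.s_src_tgt i hi, h]
  refine ⟨by rw [tgt_wl hi h, src_wl hi h', a₁], by rw [tgt_wl hi h', src_wl hi h, a₂], ?_, ?_⟩
  · rw [← wl_sq hi h a₁, a₃, src_wl hi h, ExtCat.wl, cmp_incl h]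
  · rw [← wl_sq hi h' a₂, a₄, tgt_wl hi h, ExtCat.wl, cmp_incl (by rw [a₁, h'])]

theorem IsInverse.wr {a a' : D.Cell} (ha : D.IsInverse a a') {i : ℕ} (hi : i < n) {x : C.Cell}
    (h : C.t i (D.src a) = C.s i x) : D.IsInverse (D.wr i a x) (D.wr i a' x) := by
  rw [isInverse_iff] at ha ⊢
  obtain ⟨a₁, a₂, a₃, a₄⟩ := ha
  have h' : C.t i (D.src a') = C.s i x := by rw [← a₁, ← D.t_src_tgt i hi, h]
  refine ⟨by rw [tgt_wr hi h, src_wr hi h', a₁], by rw [tgt_wr hi h', src_wr hi h, a₂], ?_, ?_⟩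
  · rw [← wr_sq hi h a₁, a₃, src_wr hi h, ExtCat.wr, cmp_incl h]
  · rw [← wr_sq hi h' a₂, a₄, tgt_wr hi h, ExtCat.wr, cmp_incl (by rw [a₁, h'])]

end ExtCat

/-! ### Application of whiskers -/

namespace Whisker

variable (W : Whisker C) (D : ExtCat C)

/-- The first `k` layers of `W`, applied to a cell of `C`. -/
noncomputable def onBase : ℕ → C.Cell → C.Cell
  | 0, u => u
  | k + 1, u => C.cmp k (C.cmp k (W.left k) (onBase k u)) (W.right k)

/-- The first `k` layers of `W`, applied to a cell of an extension of `C`. -/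
noncomputable def app : ℕ → D.Cell → D.Cell
  | 0, a => a
  | k + 1, a => D.wr k (D.wl k (W.left k) (app k a)) (W.right k)

/-- The first `k` layers of `W` can be applied to `u`. -/
def Fits : ℕ → C.Cell → Prop
  | 0, _ => True
  | k + 1, u => Fits k u ∧ k < n ∧ C.t k (W.left k) = C.s k (W.onBase k u) ∧
      C.t k (W.onBase k u) = C.s k (W.right k)

variable {W D}

/-- Applicability of a layer only involves sources and targets of dimension below `n`, which
parallel cells share. So a whisker that fits the source of an `(n+1)`-cell fits its target, and a
whisker that fits a cell fits its whole `E`-class. -/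
theorem Fits.par : ∀ {k : ℕ} {u v : C.Cell}, W.Fits k u → C.Par u v →
    W.Fits k v ∧ C.Par (W.onBase k u) (W.onBase k v)
  | 0, _, _, _, h => ⟨trivial, h⟩
  | k + 1, u, v, ⟨h, hk, h₁, h₂⟩, p => by
    obtain ⟨hv, q⟩ := Fits.par h p
    refine ⟨⟨hv, hk, by rw [h₁, (q k hk).1], by rw [← h₂, (q k hk).2]⟩, ?_⟩
    exact ((NCat.Par.refl _).cmp q hk h₁).cmp (NCat.Par.refl _) hk (by rw [C.t_cmp h₁, h₂])

theorem Fits.src_tgt {k : ℕ} {a : D.Cell} (h : W.Fits k (D.src a)) : W.Fits k (D.tgt a) :=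
  (h.par (D.par a)).1

theorem Fits.src_app : ∀ {k : ℕ} {a : D.Cell}, W.Fits k (D.src a) →
    D.src (W.app D k a) = W.onBase k (D.src a)
  | 0, _, _ => rfl
  | k + 1, a, ⟨h, hk, h₁, h₂⟩ => by
    rw [← h.src_app] at h₁ h₂
    rw [app, ExtCat.src_wr hk (by rw [ExtCat.src_wl hk h₁, C.t_cmp h₁, h₂]), ExtCat.src_wl hk h₁,
      h.src_app]
    rfl

theorem Fits.tgt_app : ∀ {k : ℕ} {a : D.Cell}, W.Fits k (D.src a) →
    D.tgt (W.app D k a) = W.onBase k (D.tgt a)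
  | 0, _, _ => rfl
  | k + 1, a, ⟨h, hk, h₁, h₂⟩ => by
    rw [← h.src_app] at h₁ h₂
    rw [app, ExtCat.tgt_wr hk (by rw [ExtCat.src_wl hk h₁, C.t_cmp h₁, h₂]), ExtCat.tgt_wl hk h₁,
      h.tgt_app]
    rfl

/-- The relation, which carries proofs of composability at each layer, becomes the graph of the
total function `app` restricted to the domain `Fits`. Later arguments use only this form. -/
theorem sendsTo_iff : ∀ {k : ℕ} {a b : D.Cell},
    W.SendsTo D k a b ↔ W.Fits k (D.src a) ∧ b = W.app D k a
  | 0, a, b => by simp [SendsTo, Fits, app]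
  | k + 1, a, b => by
    constructor
    · rintro ⟨g, hg, hk, h, h', rfl⟩
      obtain ⟨hf, rfl⟩ := sendsTo_iff.1 hg
      have h₂ := h'
      rw [ExtCat.whiskL_eq_wl hk h, ExtCat.src_wl hk h, C.t_cmp h] at h₂
      refine ⟨⟨hf, hk, by rw [h, hf.src_app], by rw [← hf.src_app, h₂]⟩, ?_⟩
      rw [ExtCat.whiskR_eq_wr, ExtCat.whiskL_eq_wl]
      rfl
    · rintro ⟨⟨h, hk, h₁, h₂⟩, rfl⟩
      rw [← h.src_app] at h₁ h₂
      refine ⟨_, sendsTo_iff.2 ⟨h, rfl⟩, hk, h₁, ?_, ?_⟩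
      · rw [ExtCat.whiskL_eq_wl hk h₁, ExtCat.src_wl hk h₁, C.t_cmp h₁, h₂]
      · rw [ExtCat.whiskR_eq_wr, ExtCat.whiskL_eq_wl]
        rfl

theorem sends_iff {a b : D.Cell} : W.Sends D a b ↔ W.Fits n (D.src a) ∧ b = W.app D n a :=
  sendsTo_iff

/-- A relation between cells that is stable under single whiskerings is stable under whiskers. -/
theorem Fits.app_rel {D' : ExtCat C} {p : D.Cell → D'.Cell → Prop}
    (hsrc : ∀ a b, p a b → C.Par (D.src a) (D'.src b))
    (hl : ∀ i < n, ∀ x a b, p a b → C.t i x = C.s i (D.src a) → p (D.wl i x a) (D'.wl i x b))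
    (hr : ∀ i < n, ∀ x a b, p a b → C.t i (D.src a) = C.s i x → p (D.wr i a x) (D'.wr i b x)) :
    ∀ {k : ℕ} {a : D.Cell} {b : D'.Cell}, W.Fits k (D.src a) → p a b →
      p (W.app D k a) (W.app D' k b)
  | 0, _, _, _, h => h
  | k + 1, a, b, ⟨h, hk, h₁, h₂⟩, hp => by
    rw [← h.src_app] at h₁ h₂
    exact hr k hk _ _ _ (hl k hk _ _ _ (h.app_rel hsrc hl hr hp) h₁)
      (by rw [ExtCat.src_wl hk h₁, C.t_cmp h₁, h₂])

/-- Whiskers are functorial for `⋆ₙ`, since each layer distributes over it by exchange. -/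
theorem Fits.app_sq : ∀ {k : ℕ} {a b : D.Cell}, W.Fits k (D.src a) → D.tgt a = D.src b →
    W.app D k (D.sq a b) = D.sq (W.app D k a) (W.app D k b)
  | 0, _, _, _, _ => rfl
  | k + 1, a, b, ⟨h, hk, h₁, h₂⟩, hab => by
    have hb : W.Fits k (D.src b) := hab ▸ h.src_tgt
    have h₃ : D.tgt (W.app D k a) = D.src (W.app D k b) := by rw [h.tgt_app, hb.src_app, hab]
    rw [← h.src_app] at h₁ h₂
    have h₁' : C.t k (W.left k) = C.s k (D.src (W.app D k b)) := by
      rw [h₁, D.s_src_tgt k hk, h₃]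
    rw [app, h.app_sq hab, ExtCat.wl_sq hk h₁ h₃, ExtCat.wr_sq hk]
    · rfl
    · rw [ExtCat.src_wl hk h₁, C.t_cmp h₁, h₂]
    · rw [ExtCat.tgt_wl hk h₁, ExtCat.src_wl hk h₁', h₃]

theorem Fits.isInverse {k : ℕ} {a a' : D.Cell} (h : W.Fits k (D.src a)) (ha : D.IsInverse a a') :
    D.IsInverse (W.app D k a) (W.app D k a') :=
  h.app_rel (p := D.IsInverse)
    (fun a b hab => (D.par a).trans (by rw [(ExtCat.isInverse_iff.1 hab).1]; exact .refl _))
    (fun _ hi _ _ _ hab h => hab.wl hi h) (fun _ hi _ _ _ hab h => hab.wr hi h) ha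

end Whisker

end Total

/-! ### Cells generated by whiskered generators. -/

section Generated

variable {n : ℕ} {C : NCat.{u} n}

/-- A `k`-cell `x` equals `x ⋆ₖ x`, so the exchange law distributes it over `a ⋆ₖ b`. -/
theorem NCat.cmp_cmp_of_left {i k : ℕ} (hik : i < k) {x a b : C.Cell} (hx : C.s k x = x)
    (hab : C.t k a = C.s k b) (h : C.t i x = C.s i a) :
    C.cmp i x (C.cmp k a b) = C.cmp k (C.cmp i x a) (C.cmp i x b) := by
  have hx' : C.t k x = x := by rw [← hx, C.t_s_le _ _ _ le_rfl]
  rw [← C.cmp_exchange hik (hx'.trans hx.symm) hab h, C.cmp_id hx'.symm]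

theorem NCat.cmp_cmp_of_right {i k : ℕ} (hik : i < k) {x a b : C.Cell} (hx : C.s k x = x)
    (hab : C.t k a = C.s k b) (h : C.t i a = C.s i x) :
    C.cmp i (C.cmp k a b) x = C.cmp k (C.cmp i a x) (C.cmp i b x) := by
  have hx' : C.t k x = x := by rw [← hx, C.t_s_le _ _ _ le_rfl]
  rw [← C.cmp_exchange hik hab (hx'.trans hx.symm) h, C.cmp_id hx'.symm]

/-! ### Stability of steps under whiskering -/

section Layers

variable (D : ExtCat C) (g : D.Cell)

/-- The cells obtained from `g` by application of `k` layers of a whisker. -/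
def Layered : ℕ → D.Cell → Prop
  | 0, a => a = g
  | k + 1, a => ∃ b l r, Layered k b ∧ C.s (k + 1) l = l ∧ C.s (k + 1) r = r ∧ k < n ∧
      C.t k l = C.s k (D.src b) ∧ C.t k (D.src b) = C.s k r ∧ a = D.wr k (D.wl k l b) r

variable {D g}

theorem Whisker.SendsTo.layered {W : Whisker C} : ∀ {k : ℕ} {a : D.Cell},
    W.SendsTo D k g a → Layered D g k a
  | 0, _, h => h
  | k + 1, _, ⟨b, hb, hk, h, h', e⟩ => by
    refine ⟨b, _, _, SendsTo.layered hb, W.left_mem k hk, W.right_mem k hk, hk, h, ?_, ?_⟩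
    · rwa [ExtCat.whiskL_eq_wl hk h, ExtCat.src_wl hk h, C.t_cmp h] at h'
    · rw [e, ExtCat.whiskR_eq_wr, ExtCat.whiskL_eq_wl]

theorem Whisker.SendsTo.congr {W W' : Whisker C} : ∀ {k : ℕ} {a : D.Cell},
    (∀ j < k, W.left j = W'.left j ∧ W.right j = W'.right j) → W.SendsTo D k g a →
      W'.SendsTo D k g a
  | 0, _, _, h => h
  | k + 1, a, e, ⟨b, hb, hk, h, h', e'⟩ => by
    have hb' := SendsTo.congr (fun j hj => e j (hj.trans k.lt_succ_self)) hb
    obtain ⟨e₁, e₂⟩ := e k k.lt_succ_self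
    refine ⟨b, hb', hk, by rw [← e₁, h], ?_, ?_⟩
    · simp only [← e₁, ← e₂]; exact h'
    · simp only [← e₁, ← e₂]; exact e'

theorem Layered.exists_whisker : ∀ {k : ℕ} {a : D.Cell}, Layered D g k a →
    ∃ W : Whisker C, W.SendsTo D k g a
  | 0, a, h =>
    -- No layer is used yet, so any whisker will do.
    ⟨⟨fun k => C.s k (D.src a), fun k => C.s k (D.src a), fun k _ => C.s_s_le _ _ _ k.le_succ,
      fun k _ => C.s_s_le _ _ _ k.le_succ⟩, h⟩
  | k + 1, a, ⟨b, l, r, hb, hl, hr, hk, h, h', e⟩ => by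
    obtain ⟨W, hW⟩ := hb.exists_whisker
    let W' : Whisker C :=
      { left := Function.update W.left k l
        right := Function.update W.right k r
        left_mem := fun j hj => by
          rcases eq_or_ne j k with rfl | hjk
          · rw [Function.update_self, hl]
          · rw [Function.update_of_ne hjk, W.left_mem j hj]
        right_mem := fun j hj => by
          rcases eq_or_ne j k with rfl | hjk
          · rw [Function.update_self, hr]
          · rw [Function.update_of_ne hjk, W.right_mem j hj] }
    have e₁ : W'.left k = l := Function.update_self ..
    have e₂ : W'.right k = r := Function.update_self ..
    refine ⟨W', b, hW.congr fun j hj => ?_, hk, by rw [e₁, h], ?_, ?_⟩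
    · exact ⟨(Function.update_of_ne hj.ne _ _).symm, (Function.update_of_ne hj.ne _ _).symm⟩
    · simp only [e₁, e₂]
      rw [ExtCat.whiskL_eq_wl hk h, ExtCat.src_wl hk h, C.t_cmp h, h']
    · simp only [e₁, e₂]
      rw [ExtCat.whiskR_eq_wr, ExtCat.whiskL_eq_wl, e]

theorem NCat.s_eq_of_le {i j : ℕ} (hij : i ≤ j) {x : C.Cell} (hx : C.s i x = x) :
    C.s j x = x := by rw [← hx, C.s_s_le _ _ _ hij]

theorem NCat.t_eq_of_s {i : ℕ} {x : C.Cell} (hx : C.s i x = x) : C.t i x = x := by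
  rw [← hx, C.t_s_le _ _ _ le_rfl]

/-- A whisker absorbs an `(i+1)`-cell composed along dimension `i`. Under a layer `k > i`, the cell
is distributed by exchange over both sides of the layer and over the inner cell, where induction
applies. At the layer `k = i`, associativity merges it into the left factor. -/
theorem Layered.wl_aux {i : ℕ} {x : C.Cell} (hx : C.s (i + 1) x = x) :
    ∀ {k : ℕ} {a : D.Cell}, i < k → Layered D g k a → C.t i x = C.s i (D.src a) →
      Layered D g k (D.wl i x a)
  | k + 1, a, hi, ⟨b, l, r, hb, hl, hr, hk, h, h', e⟩, hxa => by
    have h₁ : D.t k (D.incl l) = D.s k b := D.low_cond hk (by rw [D.src_incl, h])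
    have h₁' : C.t k (D.src (D.wl k l b)) = C.s k r := by
      rw [ExtCat.src_wl hk h, C.t_cmp h, h']
    have h₂ : D.t k (D.wl k l b) = D.s k (D.incl r) := D.low_cond hk (by rw [D.src_incl, h₁'])
    have h₃ : D.src a = C.cmp k (C.cmp k l (D.src b)) r := by
      rw [e, ExtCat.src_wr hk h₁', ExtCat.src_wl hk h]
    have h₄ : C.t k (C.cmp k l (D.src b)) = C.s k r := by rw [C.t_cmp h, h']
    rcases (Nat.lt_succ_iff.1 hi).lt_or_eq with hik | rfl
    · have hxk : C.s k x = x := C.s_eq_of_le hik hx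
      have hxl : C.t i x = C.s i l := by
        rw [hxa, h₃, C.s_cmp_low hik h₄, C.s_cmp_low hik h]
      have hxb : C.t i x = C.s i (D.src b) := by rw [hxl, C.s_eq_of_comp hik h]
      have hxr : C.t i x = C.s i r := by rw [hxb, C.s_eq_of_comp hik h']
      have hD : D.s k (D.incl x) = D.incl x := by rw [D.s_incl, hxk]
      have ex : C.t k x = C.s k x := by rw [C.t_eq_of_s hxk, hxk]
      refine ⟨D.wl i x b, C.cmp i x l, C.cmp i x r, hb.wl_aux hx hik hxb, ?_, ?_, hk, ?_, ?_, ?_⟩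
      · rw [C.s_cmp_high (hik.trans k.lt_succ_self) hxl, hl, C.s_eq_of_le (Nat.succ_le_succ hik.le) hx]
      · rw [C.s_cmp_high (hik.trans k.lt_succ_self) hxr, hr, C.s_eq_of_le (Nat.succ_le_succ hik.le) hx]
      · rw [ExtCat.src_wl (hik.trans hk) hxb, C.t_cmp_high hik hxl, C.s_cmp_high hik hxb, ex, h]
      · rw [ExtCat.src_wl (hik.trans hk) hxb, C.t_cmp_high hik hxb, C.s_cmp_high hik hxr, ex, h']
      · have t₁ : D.t i (D.incl x) = D.s i (D.wl k l b) := by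
          refine D.low_cond (hik.trans hk) ?_
          rw [D.src_incl, ExtCat.src_wl hk h, C.s_cmp_low hik h, hxl]
        have t₂ : D.t i (D.incl x) = D.s i (D.incl l) := by rw [D.t_incl, D.s_incl, hxl]
        rw [e, ExtCat.wl, ExtCat.wr, NCat.cmp_cmp_of_left hik hD h₂ t₁, ExtCat.cmp_incl hxr]
        conv_lhs => rw [ExtCat.wl, NCat.cmp_cmp_of_left hik hD h₁ t₂, ExtCat.cmp_incl hxl]
        rfl
    · have hxl : C.t i x = C.s i l := by rw [hxa, h₃, C.s_cmp h₄, C.s_cmp h]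
      refine ⟨b, C.cmp i x l, r, hb, ?_, hr, hk, ?_, h', ?_⟩
      · rw [C.s_cmp_high i.lt_succ_self hxl, hx, hl]
      · rw [C.t_cmp hxl, h]
      · have t₂ : D.t i (D.incl x) = D.s i (D.incl l) := by rw [D.t_incl, D.s_incl, hxl]
        have t₁ : D.t i (D.incl x) = D.s i (D.wl i l b) := by
          rw [ExtCat.wl, D.s_cmp h₁, t₂]
        rw [e, ExtCat.wl, ExtCat.wr, ← D.cmp_assoc t₁ h₂, ExtCat.wl, ← D.cmp_assoc t₂ h₁,
          ExtCat.cmp_incl hxl]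
        rfl

theorem Layered.wr_aux {i : ℕ} {x : C.Cell} (hx : C.s (i + 1) x = x) :
    ∀ {k : ℕ} {a : D.Cell}, i < k → Layered D g k a → C.t i (D.src a) = C.s i x →
      Layered D g k (D.wr i a x)
  | k + 1, a, hi, ⟨b, l, r, hb, hl, hr, hk, h, h', e⟩, hxa => by
    have h₁ : D.t k (D.incl l) = D.s k b := D.low_cond hk (by rw [D.src_incl, h])
    have h₁' : C.t k (D.src (D.wl k l b)) = C.s k r := by
      rw [ExtCat.src_wl hk h, C.t_cmp h, h']
    have h₂ : D.t k (D.wl k l b) = D.s k (D.incl r) := D.low_cond hk (by rw [D.src_incl, h₁'])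
    have h₃ : D.src a = C.cmp k (C.cmp k l (D.src b)) r := by
      rw [e, ExtCat.src_wr hk h₁', ExtCat.src_wl hk h]
    have h₄ : C.t k (C.cmp k l (D.src b)) = C.s k r := by rw [C.t_cmp h, h']
    rcases (Nat.lt_succ_iff.1 hi).lt_or_eq with hik | rfl
    · have hxk : C.s k x = x := C.s_eq_of_le hik hx
      have hxr : C.t i r = C.s i x := by
        rw [← hxa, h₃, C.t_cmp_low hik h₄]
      have hxb : C.t i (D.src b) = C.s i x := by rw [← hxr, C.t_eq_of_comp hik h']
      have hxl : C.t i l = C.s i x := by rw [← hxb, C.t_eq_of_comp hik h]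
      have hD : D.s k (D.incl x) = D.incl x := by rw [D.s_incl, hxk]
      have ex : C.t k x = C.s k x := by rw [C.t_eq_of_s hxk, hxk]
      refine ⟨D.wr i b x, C.cmp i l x, C.cmp i r x, hb.wr_aux hx hik hxb, ?_, ?_, hk, ?_, ?_, ?_⟩
      · rw [C.s_cmp_high (hik.trans k.lt_succ_self) hxl, hl, C.s_eq_of_le (Nat.succ_le_succ hik.le) hx]
      · rw [C.s_cmp_high (hik.trans k.lt_succ_self) hxr, hr, C.s_eq_of_le (Nat.succ_le_succ hik.le) hx]
      · rw [ExtCat.src_wr (hik.trans hk) hxb, C.t_cmp_high hik hxl, C.s_cmp_high hik hxb, ex, h]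
      · rw [ExtCat.src_wr (hik.trans hk) hxb, C.t_cmp_high hik hxb, C.s_cmp_high hik hxr, ex, h']
      · have t₁ : D.t i (D.wl k l b) = D.s i (D.incl x) := by
          refine D.low_cond (hik.trans hk) ?_
          rw [D.src_incl, ExtCat.src_wl hk h, C.t_cmp_low hik h, hxb]
        have t₂ : D.t i (D.incl l) = D.s i (D.incl x) := by rw [D.t_incl, D.s_incl, hxl]
        rw [e]
        conv_lhs => rw [ExtCat.wr, ExtCat.wr, NCat.cmp_cmp_of_right hik hD h₂ t₁,
          ExtCat.cmp_incl hxr, ExtCat.wl, NCat.cmp_cmp_of_right hik hD h₁ t₂, ExtCat.cmp_incl hxl]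
        rfl
    · have hxr : C.t i r = C.s i x := by rw [← hxa, h₃, C.t_cmp h₄]
      refine ⟨b, l, C.cmp i r x, hb, hl, ?_, hk, h, ?_, ?_⟩
      · rw [C.s_cmp_high i.lt_succ_self hxr, hx, hr]
      · rw [C.s_cmp hxr, h']
      · have t₂ : D.t i (D.incl r) = D.s i (D.incl x) := by rw [D.t_incl, D.s_incl, hxr]
        rw [e]
        conv_lhs => rw [ExtCat.wr, ExtCat.wr, D.cmp_assoc h₂ t₂, ExtCat.cmp_incl hxr]
        rfl

/-- Layer `i` of a whisker only holds `(i+1)`-cells, so a cell `x` of dimension `j+1 > i+1` must be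
spread over several layers. By exchange, `x ⋆ᵢ a` is `(x ⋆ᵢ s_j a) ⋆ⱼ (t_j x ⋆ᵢ a)`. The first
factor fits in layer `j`, and `t_j x` has lower dimension. -/
theorem Layered.wl {i : ℕ} : ∀ {j : ℕ} {x : C.Cell} {a : D.Cell}, i < j → j ≤ n →
    C.s j x = x → Layered D g n a → C.t i x = C.s i (D.src a) → Layered D g n (D.wl i x a)
  | j + 1, x, a, hi, hj, hx, ha, h => by
    rcases (Nat.lt_succ_iff.1 hi).lt_or_eq with hij | rfl
    · have hc : C.t i x = C.s i (C.s j (D.src a)) := by rw [h, C.s_s_lt _ _ _ hij]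
      have hc' : C.t i (C.t j x) = C.s i (D.src a) := by rw [C.t_t_lt _ _ _ hij, h]
      have ih := Layered.wl hij (Nat.le_of_succ_le hj) (C.s_t_le _ _ _ le_rfl) ha hc'
      have e : D.wl i x a = D.wl j (C.cmp i x (C.s j (D.src a))) (D.wl i (C.t j x) a) := by
        have k₁ : D.t j (D.incl x) = D.s j (D.incl (C.t j x)) := by
          rw [D.t_incl, D.s_incl, C.s_t_le _ _ _ le_rfl]
        have k₂ : D.t j (D.incl (C.s j (D.src a))) = D.s j a := by
          rw [D.t_incl, C.t_s_le _ _ _ le_rfl, D.s_eq j (Nat.le_of_succ_le hj)]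
        have := D.cmp_exchange hij k₁ k₂ (by rw [D.t_incl, D.s_incl, hc])
        rw [D.cmp_id (a := D.incl x) (by rw [D.t_incl]),
          D.id_cmp (a := a) (by rw [D.s_eq j (Nat.le_of_succ_le hj)]),
          ExtCat.cmp_incl hc] at this
        exact this
      rw [e]
      have hin := (hij.trans hj)
      refine ih.wl_aux ?_ hj ?_
      · rw [C.s_cmp_high hi hc, hx, C.s_s_le _ _ _ j.le_succ]
      · rw [ExtCat.src_wl hin hc', C.t_cmp_high hij hc, C.s_cmp_high hij hc',
          C.t_s_le _ _ _ le_rfl, C.s_t_le _ _ _ le_rfl]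
    · exact ha.wl_aux hx hj h

theorem Layered.wr {i : ℕ} : ∀ {j : ℕ} {x : C.Cell} {a : D.Cell}, i < j → j ≤ n →
    C.s j x = x → Layered D g n a → C.t i (D.src a) = C.s i x → Layered D g n (D.wr i a x)
  | j + 1, x, a, hi, hj, hx, ha, h => by
    rcases (Nat.lt_succ_iff.1 hi).lt_or_eq with hij | rfl
    · have hc : C.t i (C.s j (D.src a)) = C.s i x := by rw [← h, C.t_s_lt _ _ _ hij]
      have hc' : C.t i (D.src a) = C.s i (C.t j x) := by rw [C.s_t_lt _ _ _ hij, h]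
      have ih := Layered.wr hij (Nat.le_of_succ_le hj) (C.s_t_le _ _ _ le_rfl) ha hc'
      -- The `(j+1)`-dimensional part is placed on the left along `⋆ⱼ` here as well, so `wl_aux`
      -- serves again.
      have e : D.wr i a x = D.wl j (C.cmp i (C.s j (D.src a)) x) (D.wr i a (C.t j x)) := by
        have k₁ : D.t j (D.incl x) = D.s j (D.incl (C.t j x)) := by
          rw [D.t_incl, D.s_incl, C.s_t_le _ _ _ le_rfl]
        have k₂ : D.t j (D.incl (C.s j (D.src a))) = D.s j a := by
          rw [D.t_incl, C.t_s_le _ _ _ le_rfl, D.s_eq j (Nat.le_of_succ_le hj)]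
        have := D.cmp_exchange hij k₂ k₁ (by rw [D.t_incl, D.s_incl, hc])
        rw [D.cmp_id (a := D.incl x) (by rw [D.t_incl]),
          D.id_cmp (a := a) (by rw [D.s_eq j (Nat.le_of_succ_le hj)]), ExtCat.cmp_incl hc] at this
        exact this
      rw [e]
      have hin := (hij.trans hj)
      refine ih.wl_aux ?_ hj ?_
      · rw [C.s_cmp_high hi hc, hx, C.s_s_le _ _ _ j.le_succ]
      · rw [ExtCat.src_wr hin hc', C.t_cmp_high hij hc, C.s_cmp_high hij hc',
          C.t_s_le _ _ _ le_rfl, C.s_t_le _ _ _ le_rfl]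
    · exact ha.wr_aux hx hj h

end Layers

/-- The cells `W[g]`, for `W` a whisker. -/
def Orbit (D : ExtCat C) (g a : D.Cell) : Prop := ∃ W : Whisker C, W.Sends D g a

/-! ### Orbits of a cell under whiskers. -/

section Orbit

variable {D : ExtCat C} {g a : D.Cell}

theorem orbit_iff : Orbit D g a ↔ Layered D g n a :=
  ⟨fun ⟨_, h⟩ => h.layered, fun h => h.exists_whisker⟩

theorem Orbit.wl (h : Orbit D g a) {i : ℕ} (hi : i < n) {x : C.Cell}
    (hx : C.t i x = C.s i (D.src a)) : Orbit D g (D.wl i x a) :=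
  orbit_iff.2 ((orbit_iff.1 h).wl hi le_rfl (C.s_self _ _ le_rfl) hx)

theorem Orbit.wr (h : Orbit D g a) {i : ℕ} (hi : i < n) {x : C.Cell}
    (hx : C.t i (D.src a) = C.s i x) : Orbit D g (D.wr i a x) :=
  orbit_iff.2 ((orbit_iff.1 h).wr hi le_rfl (C.s_self _ _ le_rfl) hx)

theorem Orbit.self (D : ExtCat C) (g : D.Cell) : Orbit D g g := by
  have key : ∀ k ≤ n, Layered D g k g := by
    intro k
    induction k with
    | zero => exact fun _ => rfl
    | succ k ih =>
      intro hk
      refine ⟨g, C.s k (D.src g), C.t k (D.src g), ih (Nat.le_of_succ_le hk),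
        C.s_s_le _ _ _ k.le_succ, C.s_t_le _ _ _ k.le_succ, hk, C.t_s_le _ _ _ le_rfl,
        (C.s_t_le _ _ _ le_rfl).symm, ?_⟩
      have e : D.wl k (C.s k (D.src g)) g = g := D.id_cmp (D.s_eq k (Nat.le_of_succ_le hk) g).symm
      rw [e]
      exact (D.cmp_id (by rw [D.t_eq k (Nat.le_of_succ_le hk), D.t_src_tgt k hk])).symm
  exact orbit_iff.2 (key n le_rfl)

end Orbit

/-! ### Composites of steps -/

/-- The identities and the composites `a₁ ⋆ (a₂ ⋆ ( ⋯ ))` of cells of `T`. -/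
inductive IsPath (D : ExtCat C) (T : D.Cell → Prop) : D.Cell → Prop
  | incl (x : C.Cell) : IsPath D T (D.incl x)
  | cons {a b : D.Cell} (h : D.tgt a = D.src b) (ha : T a) (hb : IsPath D T b) :
      IsPath D T (D.sq a b)

namespace IsPath

variable {D : ExtCat C} {T : D.Cell → Prop}

theorem single {a : D.Cell} (h : T a) : IsPath D T a := by
  rw [← ExtCat.sq_idn (a := a) rfl]
  exact .cons (D.src_incl _).symm h (.incl _)

theorem sq {a b : D.Cell} (ha : IsPath D T a) (hb : IsPath D T b) (h : D.tgt a = D.src b) :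
    IsPath D T (D.sq a b) := by
  induction ha with
  | incl x => rw [ExtCat.idn_sq (by rw [← h, D.tgt_incl])]; exact hb
  | @cons a c h' ha hc ih =>
    rw [ExtCat.tgt_sq h'] at h
    rw [ExtCat.sq_assoc h' h]
    exact .cons (by rw [ExtCat.src_sq h, h']) ha (ih h)

theorem wl (hT : ∀ i < n, ∀ x a, T a → C.t i x = C.s i (D.src a) → T (D.wl i x a)) {a : D.Cell}
    (ha : IsPath D T a) {i : ℕ} (hi : i < n) {x : C.Cell} (h : C.t i x = C.s i (D.src a)) :
    IsPath D T (D.wl i x a) := by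
  induction ha with
  | incl y => rw [ExtCat.wl, ExtCat.cmp_incl (by rw [h, D.src_incl])]; exact .incl _
  | @cons a c h' ha hc ih =>
    rw [ExtCat.src_sq h'] at h
    have h₂ : C.t i x = C.s i (D.src c) := by rw [h, D.s_src_tgt i hi, h']
    rw [ExtCat.wl_sq hi h h']
    exact .cons (by rw [ExtCat.tgt_wl hi h, ExtCat.src_wl hi h₂, h']) (hT i hi x a ha h) (ih h₂)

theorem wr (hT : ∀ i < n, ∀ x a, T a → C.t i (D.src a) = C.s i x → T (D.wr i a x)) {a : D.Cell}
    (ha : IsPath D T a) {i : ℕ} (hi : i < n) {x : C.Cell} (h : C.t i (D.src a) = C.s i x) :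
    IsPath D T (D.wr i a x) := by
  induction ha with
  | incl y => rw [ExtCat.wr, ExtCat.cmp_incl (by rw [← h, D.src_incl])]; exact .incl _
  | @cons a c h' ha hc ih =>
    rw [ExtCat.src_sq h'] at h
    have h₂ : C.t i (D.src c) = C.s i x := by rw [← h', ← D.t_src_tgt i hi, h]
    rw [ExtCat.wr_sq hi h h']
    exact .cons (by rw [ExtCat.tgt_wr hi h, ExtCat.src_wr hi h₂, h']) (hT i hi x a ha h) (ih h₂)

/-- Sequentialising the composite with `cmp_eq_wr_wl` leaves two whiskered paths, one after the
other. -/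
theorem cmp (hl : ∀ i < n, ∀ x a, T a → C.t i x = C.s i (D.src a) → T (D.wl i x a))
    (hr : ∀ i < n, ∀ x a, T a → C.t i (D.src a) = C.s i x → T (D.wr i a x)) {a b : D.Cell}
    (ha : IsPath D T a) (hb : IsPath D T b) {i : ℕ} (hi : i < n)
    (h : C.t i (D.src a) = C.s i (D.src b)) : IsPath D T (D.cmp i a b) := by
  have h' : C.t i (D.tgt a) = C.s i (D.src b) := by rw [← D.t_src_tgt i hi, h]
  rw [ExtCat.cmp_eq_wr_wl hi h]
  exact (ha.wr hr hi h).sq (hb.wl hl hi h') (by rw [ExtCat.tgt_wr hi h, ExtCat.src_wl hi h'])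

end IsPath

/-! ### Presented categories: induction on cells, decomposition into paths, functoriality of the
lift. -/

section Present

variable {Γ : CellExt C} {K : ∀ x y, Term Γ x y → Term Γ x y → Prop}

theorem sq_mk {x y z : C.Cell} (a : Term Γ x y) (b : Term Γ y z) :
    (present Γ K).sq (PCell.mk Γ K a) (PCell.mk Γ K b) = PCell.mk Γ K (a.top b) := by
  have h : (present Γ K).tgt (PCell.mk Γ K a) = (present Γ K).src (PCell.mk Γ K b) := rfl
  rw [← ExtCat.seq_eq_sq h]
  exact PCell.comp_top a b

theorem cmp_mk {i : ℕ} (hi : i < n) {x y x' y' : C.Cell} (a : Term Γ x y) (b : Term Γ x' y')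
    (h : C.t i x = C.s i x') (h' : C.t i y = C.s i y') :
    (present Γ K).cmp i (PCell.mk Γ K a) (PCell.mk Γ K b) =
      PCell.mk Γ K (Term.low i hi a b h h') := by
  have h : C.t i ((present Γ K).src (PCell.mk Γ K a)) =
    C.s i ((present Γ K).src (PCell.mk Γ K b)) := h
  rw [← ExtCat.low_eq_cmp hi h]
  exact PCell.comp_low i hi a b _ _

theorem present_induction {p : (present Γ K).Cell → Prop}
    (incl : ∀ x, p ((present Γ K).incl x)) (gen : ∀ γ, p (genCell Γ K γ))
    (sq : ∀ a b, (present Γ K).tgt a = (present Γ K).src b → p a → p b → p ((present Γ K).sq a b))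
    (cmp : ∀ i < n, ∀ a b, C.t i ((present Γ K).src a) = C.s i ((present Γ K).src b) → p a → p b →
      p ((present Γ K).cmp i a b)) (A : (present Γ K).Cell) : p A := by
  induction A using PCell.ind with | @h x y a
  induction a with
  | idn x => exact incl x
  | gen γ => exact gen γ
  | top a b iha ihb => rw [← sq_mk]; exact sq _ _ rfl iha ihb
  | low i hi a b h h' iha ihb => rw [← cmp_mk]; exact cmp i hi _ _ h iha ihb

theorem isPath_present {T : (present Γ K).Cell → Prop}
    (hl : ∀ i < n, ∀ x a, T a → C.t i x = C.s i ((present Γ K).src a) → T ((present Γ K).wl i x a))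
    (hr : ∀ i < n, ∀ x a, T a → C.t i ((present Γ K).src a) = C.s i x → T ((present Γ K).wr i a x))
    (gen : ∀ γ, T (genCell Γ K γ)) (A : (present Γ K).Cell) : IsPath (present Γ K) T A :=
  present_induction .incl (fun γ => .single (gen γ)) (fun _ _ h ha hb => ha.sq hb h)
    (fun _ hi _ _ h ha hb => ha.cmp hl hr hb hi h) A

variable (D : ExtCat C) (φ : Γ.Gen → D.Cell) (hs : ∀ γ, D.src (φ γ) = Γ.src γ)
  (ht : ∀ γ, D.tgt (φ γ) = Γ.tgt γ) (hK)

theorem liftCell_sq {a b : (present Γ K).Cell} (h : (present Γ K).tgt a = (present Γ K).src b) :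
    liftCell D φ hs ht K hK ((present Γ K).sq a b) =
      D.sq (liftCell D φ hs ht K hK a) (liftCell D φ hs ht K hK b) := by
  have h' : D.tgt (liftCell D φ hs ht K hK a) = D.src (liftCell D φ hs ht K hK b) := by
    rw [tgt_liftCell, src_liftCell, h]
  induction a using PCell.ind with | @h x y a
  induction b using PCell.ind with | @h y' z b
  obtain rfl : y = y' := h
  rw [sq_mk, ← ExtCat.seq_eq_sq h']
  rfl

theorem liftCell_cmp {i : ℕ} (hi : i < n) {a b : (present Γ K).Cell}
    (h : C.t i ((present Γ K).src a) = C.s i ((present Γ K).src b)) :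
    liftCell D φ hs ht K hK ((present Γ K).cmp i a b) =
      D.cmp i (liftCell D φ hs ht K hK a) (liftCell D φ hs ht K hK b) := by
  have h₁ := h
  have h' : C.t i (D.src (liftCell D φ hs ht K hK a)) =
      C.s i (D.src (liftCell D φ hs ht K hK b)) := by
    rw [src_liftCell, src_liftCell, h]
  have h₂ : C.t i ((present Γ K).tgt a) = C.s i ((present Γ K).tgt b) := by
    rw [← (present Γ K).t_src_tgt i hi, ← (present Γ K).s_src_tgt i hi, h]
  induction a using PCell.ind with | @h x y a
  induction b using PCell.ind with | @h y' z b
  rw [cmp_mk hi a b h₁ h₂, ← ExtCat.low_eq_cmp hi h']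
  rfl

end Present

/-! ### Functoriality of the map from `C[Γ]` to `C(Γ)`. -/

section ToInv

variable (Γ : CellExt C)

theorem toInv_incl (x : C.Cell) : toInv Γ ((free Γ).incl x) = (freeInv Γ).incl x := rfl

variable {Γ}

theorem toInv_sq {a b : (free Γ).Cell} (h : (free Γ).tgt a = (free Γ).src b) :
    toInv Γ ((free Γ).sq a b) = (freeInv Γ).sq (toInv Γ a) (toInv Γ b) :=
  liftCell_sq _ _ _ _ (fun _ _ _ _ h => h.elim) h

theorem toInv_cmp {i : ℕ} (hi : i < n) {a b : (free Γ).Cell}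
    (h : C.t i ((free Γ).src a) = C.s i ((free Γ).src b)) :
    toInv Γ ((free Γ).cmp i a b) = (freeInv Γ).cmp i (toInv Γ a) (toInv Γ b) :=
  liftCell_cmp _ _ _ _ (fun _ _ _ _ h => h.elim) hi h

theorem toInv_wl {i : ℕ} (hi : i < n) {x : C.Cell} {a : (free Γ).Cell}
    (h : C.t i x = C.s i ((free Γ).src a)) :
    toInv Γ ((free Γ).wl i x a) = (freeInv Γ).wl i x (toInv Γ a) :=
  toInv_cmp hi (by rwa [ExtCat.src_incl])

theorem toInv_wr {i : ℕ} (hi : i < n) {x : C.Cell} {a : (free Γ).Cell}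
    (h : C.t i ((free Γ).src a) = C.s i x) :
    toInv Γ ((free Γ).wr i a x) = (freeInv Γ).wr i (toInv Γ a) x :=
  toInv_cmp hi (by rwa [ExtCat.src_incl])

theorem Whisker.Fits.toInv_app {W : Whisker C} {k : ℕ} {a : (free Γ).Cell}
    (h : W.Fits k ((free Γ).src a)) :
    toInv Γ (W.app (free Γ) k a) = W.app (freeInv Γ) k (toInv Γ a) :=
  (h.app_rel (p := fun a b => toInv Γ a = b)
    (by rintro a _ rfl; rw [src_toInv]; exact .refl _)
    (by rintro i hi x a _ rfl h; exact toInv_wl hi h)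
    (by rintro i hi x a _ rfl h; exact toInv_wr hi h) rfl)

end ToInv

end Generated

section Counting

variable {n : ℕ} {C : NCat.{u} n}

/-! ### Number of generators -/

/-- The number of generators of a formal composite, each generator `γ` being counted `c γ` times. -/
def Term.count {Γ : CellExt C} (c : Γ.Gen → ℕ) : ∀ {x y : C.Cell}, Term Γ x y → ℕ
  | _, _, .idn _ => 0
  | _, _, .gen γ => c γ
  | _, _, .top a b => a.count c + b.count c
  | _, _, .low _ _ a b _ _ => a.count c + b.count c

variable {Γ : CellExt C} (c : Γ.Gen → ℕ)

/-- Each axiom of `(n+1)`-categories has the same generators on both sides, identities having none.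
The absence of extra relations matters: `γ ⋆ γ⁻ = 1` would break the count. -/
theorem Rel.count_eq {K : ∀ x y, Term Γ x y → Term Γ x y → Prop} (hK : ∀ x y a b, ¬ K x y a b)
    {x y x' y' : C.Cell} {a : Term Γ x y} {b : Term Γ x' y'} (r : Rel Γ K a b) :
    a.count c = b.count c := by
  induction r with
  | rel h => exact (hK _ _ _ _ h).elim
  | refl => rfl
  | symm _ ih => exact ih.symm
  | trans _ _ ih₁ ih₂ => exact ih₁.trans ih₂
  | top_congr _ _ ih₁ ih₂ => simp only [Term.count, ih₁, ih₂]
  | low_congr _ _ _ _ _ _ _ _ ih₁ ih₂ => simp only [Term.count, ih₁, ih₂]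
  | _ => simp only [Term.count] <;> omega

/-- The number of generators of a cell of the free `(n+1)`-category, each generator `γ` being counted
`c γ` times. -/
def count (a : (free Γ).Cell) : ℕ :=
  Quotient.lift (s := relSetoid Γ fun _ _ _ _ => False) (fun a : PTerm Γ => a.tm.count c)
    (fun _ _ h => Rel.count_eq c (fun _ _ _ _ h => h) h) a

theorem count_incl (x : C.Cell) : count c ((free Γ).incl x) = 0 := rfl

theorem count_gen (γ : Γ.Gen) : count c (freeGen Γ γ) = c γ := rfl

variable {c}

theorem count_sq {a b : (free Γ).Cell} (h : (free Γ).tgt a = (free Γ).src b) :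
    count c ((free Γ).sq a b) = count c a + count c b := by
  induction a using PCell.ind with | @h x y a
  induction b using PCell.ind with | @h y' z b
  obtain rfl : y = y' := h
  exact (congrArg (count c) (sq_mk (K := fun _ _ _ _ => False) a b)).trans rfl

theorem count_cmp {i : ℕ} (hi : i < n) {a b : (free Γ).Cell}
    (h : C.t i ((free Γ).src a) = C.s i ((free Γ).src b)) :
    count c ((free Γ).cmp i a b) = count c a + count c b := by
  have h₁ := h
  have h₂ : C.t i ((free Γ).tgt a) = C.s i ((free Γ).tgt b) := by
    rw [← (free Γ).t_src_tgt i hi, ← (free Γ).s_src_tgt i hi, h]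
  induction a using PCell.ind with | @h x y a
  induction b using PCell.ind with | @h y' z b
  exact (congrArg (count c) (cmp_mk (K := fun _ _ _ _ => False) hi a b h₁ h₂)).trans rfl

theorem count_wl {i : ℕ} (hi : i < n) {x : C.Cell} {a : (free Γ).Cell}
    (h : C.t i x = C.s i ((free Γ).src a)) : count c ((free Γ).wl i x a) = count c a := by
  rw [ExtCat.wl, count_cmp hi (by rwa [ExtCat.src_incl]), count_incl, zero_add]

theorem count_wr {i : ℕ} (hi : i < n) {x : C.Cell} {a : (free Γ).Cell}
    (h : C.t i ((free Γ).src a) = C.s i x) : count c ((free Γ).wr i a x) = count c a := by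
  rw [ExtCat.wr, count_cmp hi (by rwa [ExtCat.src_incl]), count_incl, add_zero]

theorem Whisker.Fits.count_app {W : Whisker C} {k : ℕ} {a : (free Γ).Cell}
    (h : W.Fits k ((free Γ).src a)) : count c (W.app (free Γ) k a) = count c a := by
  induction k with
  | zero => rfl
  | succ k ih =>
    obtain ⟨h, hk, h₁, h₂⟩ := h
    rw [← h.src_app] at h₁ h₂
    rw [Whisker.app, count_wr hk (by rw [ExtCat.src_wl hk h₁, C.t_cmp h₁, h₂]), count_wl hk h₁,
      ih h]

/-! ### Steps -/

theorem isStep_iff {f : (free Γ).Cell} : IsStep Γ f ↔ ∃ γ, Orbit (free Γ) (freeGen Γ γ) f :=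
  ⟨fun ⟨W, γ, h⟩ => ⟨γ, W, h⟩, fun ⟨γ, W, h⟩ => ⟨W, γ, h⟩⟩

theorem IsStep.wl {f : (free Γ).Cell} (h : IsStep Γ f) {i : ℕ} (hi : i < n) {x : C.Cell}
    (hx : C.t i x = C.s i ((free Γ).src f)) : IsStep Γ ((free Γ).wl i x f) := by
  obtain ⟨γ, h⟩ := isStep_iff.1 h
  exact isStep_iff.2 ⟨γ, h.wl hi hx⟩

theorem IsStep.wr {f : (free Γ).Cell} (h : IsStep Γ f) {i : ℕ} (hi : i < n) {x : C.Cell}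
    (hx : C.t i ((free Γ).src f) = C.s i x) : IsStep Γ ((free Γ).wr i f x) := by
  obtain ⟨γ, h⟩ := isStep_iff.1 h
  exact isStep_iff.2 ⟨γ, h.wr hi hx⟩

theorem isPath_free (f : (free Γ).Cell) : IsPath (free Γ) (IsStep Γ) f :=
  isPath_present (fun _ hi _ _ h hx => h.wl hi hx) (fun _ hi _ _ h hx => h.wr hi hx)
    (isStep_freeGen Γ) f

theorem IsStep.count_eq {f : (free Γ).Cell} {W : Whisker C} {γ : Γ.Gen}
    (h : W.Sends (free Γ) (freeGen Γ γ) f) : count c f = c γ := by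
  obtain ⟨hW, rfl⟩ := Whisker.sends_iff.1 h
  rw [hW.count_app, count_gen]

/-- A path with exactly one generator has exactly one step. Since whiskers preserve the count, this
recognises a step after a whisker has been removed from it, as in `IsStep.of_app`. -/
theorem isStep_iff_count {f : (free Γ).Cell} : IsStep Γ f ↔ count (fun _ => 1) f = 1 := by
  constructor
  · rintro ⟨W, γ, h⟩
    exact IsStep.count_eq h
  · intro h
    cases isPath_free f with
    | incl x => rw [count_incl] at h; omega
    | @cons a b hab ha hb =>
      obtain ⟨W, γ, hW⟩ := id ha
      rw [count_sq hab, IsStep.count_eq hW] at h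
      cases hb with
      | incl x => rwa [ExtCat.sq_idn (by rw [hab, ExtCat.src_incl])]
      | @cons b d hbd hb hd =>
        obtain ⟨W, γ, hW⟩ := hb
        rw [count_sq hbd, IsStep.count_eq hW] at h
        omega

theorem eq_incl_of_count {f : (free Γ).Cell} (h : count (fun _ => 1) f = 0) :
    f = (free Γ).incl ((free Γ).src f) := by
  cases isPath_free f with
  | incl x => rw [ExtCat.src_incl]
  | @cons a b hab ha hb =>
    rw [count_sq hab, isStep_iff_count.1 ha] at h
    omega

theorem IsStep.of_app {W : Whisker C} {f : (free Γ).Cell} (h : W.Fits n ((free Γ).src f))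
    (hf : IsStep Γ (W.app (free Γ) n f)) : IsStep Γ f := by
  rwa [isStep_iff_count, h.count_app, ← isStep_iff_count] at hf

theorem IsStep.app {W : Whisker C} {f : (free Γ).Cell} (h : W.Fits n ((free Γ).src f))
    (hf : IsStep Γ f) : IsStep Γ (W.app (free Γ) n f) := by
  rwa [isStep_iff_count, h.count_app, ← isStep_iff_count]

theorem IsStep.ne_incl {f : (free Γ).Cell} (h : IsStep Γ f) (x : C.Cell) :
    f ≠ (free Γ).incl x := by
  rintro rfl
  rw [isStep_iff_count, count_incl] at h
  omega

theorem IsStep.reduces {f : (free Γ).Cell} (h : IsStep Γ f) :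
    Reduces Γ ((free Γ).src f) ((free Γ).tgt f) := ⟨f, rfl, rfl, h.ne_incl _⟩

theorem exists_step_of_ne {f : (free Γ).Cell} (h : f ≠ (free Γ).incl ((free Γ).src f)) :
    ∃ a b, IsStep Γ a ∧ (free Γ).tgt a = (free Γ).src b ∧ f = (free Γ).sq a b := by
  cases isPath_free f with
  | incl x => exact (h (by rw [ExtCat.src_incl])).elim
  | @cons a b hab ha hb => exact ⟨a, b, ha, hab, rfl⟩

/-- A composite can only be an identity if both factors have count zero, hence are identities. -/
theorem Reduces.trans_cell {u : C.Cell} {f : (free Γ).Cell} (h : Reduces Γ u ((free Γ).src f)) :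
    Reduces Γ u ((free Γ).tgt f) := by
  obtain ⟨g, hs, ht, hg⟩ := h
  refine ⟨(free Γ).sq g f, by rw [ExtCat.src_sq ht, hs], by rw [ExtCat.tgt_sq ht], fun h => hg ?_⟩
  have := congrArg (count fun _ => 1) h
  rw [count_sq ht, count_incl] at this
  rw [← hs]
  exact eq_incl_of_count (by omega)

theorem eq_incl_of_irr {f : (free Γ).Cell} (h : (free Γ).src f ∈ Irr Γ) :
    f = (free Γ).incl ((free Γ).src f) := by
  by_contra hf
  exact h _ ⟨f, rfl, rfl, hf⟩

theorem exists_step_of_not_irr {u : C.Cell} (h : u ∉ Irr Γ) :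
    ∃ f, IsStep Γ f ∧ (free Γ).src f = u := by
  simp only [Irr, Set.mem_ofPred_eq, not_forall, not_not] at h
  obtain ⟨v, f, rfl, -, hf⟩ := h
  obtain ⟨a, b, ha, hab, e⟩ := exists_step_of_ne hf
  exact ⟨a, ha, by rw [e, ExtCat.src_sq hab]⟩

theorem IsStep.not_irr {f : (free Γ).Cell} (h : IsStep Γ f) : (free Γ).src f ∉ Irr Γ :=
  fun h' => h' _ h.reduces

theorem Reduces.onBase {W : Whisker C} {u v : C.Cell} (h : W.Fits n u) (huv : Reduces Γ u v) :
    Reduces Γ (W.onBase n u) (W.onBase n v) := by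
  obtain ⟨f, rfl, rfl, hf⟩ := huv
  refine ⟨W.app (free Γ) n f, h.src_app, h.tgt_app, fun e => hf ?_⟩
  have := congrArg (count fun _ => 1) e
  rw [h.count_app, count_incl] at this
  exact eq_incl_of_count this

theorem Terminating.wellFounded (h : Terminating Γ) :
    WellFounded fun v u : C.Cell => Reduces Γ u v := by
  rw [wellFounded_iff_isEmpty_descending_chain]
  exact ⟨fun ⟨f, hf⟩ => h ⟨f, hf⟩⟩

theorem Terminating.exists_normalForm (h : Terminating Γ) (u : C.Cell) :
    ∃ f : (free Γ).Cell, (free Γ).src f = u ∧ (free Γ).tgt f ∈ Irr Γ := by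
  induction u using h.wellFounded.induction with | _ u ih
  by_cases hu : u ∈ Irr Γ
  · exact ⟨(free Γ).incl u, (free Γ).src_incl u, by rwa [(free Γ).tgt_incl]⟩
  · obtain ⟨f, hf, rfl⟩ := exists_step_of_not_irr hu
    obtain ⟨g, hg, hg'⟩ := ih _ hf.reduces
    exact ⟨(free Γ).sq f g, ExtCat.src_sq hg.symm, by rwa [ExtCat.tgt_sq hg.symm]⟩

end Counting

/-! ### Sizes of the cells of a free category -/

section Weights

variable {n : ℕ}

/-- A weight on the cells of an `n`-category: the weight `w j` is additive on `j`-cells, and it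
vanishes exactly on those `(j+1)`-cells that are identities of `j`-cells. -/
structure NCat.Weights (C : NCat.{u} n) where
  w : ℕ → C.Cell → ℕ
  w_cmp : ∀ {i j a b}, i < j → j ≤ n → C.s j a = a → C.s j b = b → C.t i a = C.s i b →
    w j (C.cmp i a b) = w j a + w j b
  w_id : ∀ {j a}, j < n → C.s j a = a → w (j + 1) a = 0
  eq_of_w : ∀ {j a}, j < n → C.s (j + 1) a = a → w (j + 1) a = 0 → C.s j a = a

variable {C : NCat.{u} n}

/-- The weight of the `(j+1)`-source of a cell. -/
def NCat.Weights.size (w : C.Weights) (j : ℕ) (u : C.Cell) : ℕ := w.w (j + 1) (C.s (j + 1) u)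

/-- Comparison of cells by the lexicographic order on their sizes, the highest dimension first. -/
def NCat.Weights.Lt (w : C.Weights) (u v : C.Cell) : Prop :=
  Pi.Lex (β := fun _ : Fin n => ℕ) (· > ·) (fun {_} => (· < ·)) (fun j : Fin n => w.size j u)
    (fun j : Fin n => w.size j v)

theorem NCat.Weights.wellFounded_lt (w : C.Weights) : WellFounded w.Lt :=
  InvImage.wf (fun u (j : Fin n) => w.size j u)
    (Pi.Lex.wellFounded (α := fun _ : Fin n => ℕ) (· > ·) fun _ => Nat.lt_wfRel.wf)

/-! ### Effect of whiskers on sizes. -/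

section Size

variable {W : Whisker C}

/-- A whisker whose layers are all identities. -/
def Whisker.Trivial (W : Whisker C) : Prop :=
  ∀ k < n, C.s k (W.left k) = W.left k ∧ C.s k (W.right k) = W.right k

theorem Whisker.Fits.onBase_succ {k : ℕ} {u : C.Cell} (h : W.Fits (k + 1) u)
    (hl : C.s k (W.left k) = W.left k) (hr : C.s k (W.right k) = W.right k) :
    W.onBase (k + 1) u = W.onBase k u := by
  obtain ⟨h, hk, h₁, h₂⟩ := h
  have e : C.cmp k (W.left k) (W.onBase k u) = W.onBase k u :=
    C.id_cmp (by rw [← h₁, C.t_eq_of_s hl])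
  rw [onBase, e, C.cmp_id (by rw [h₂, hr])]

theorem Whisker.Trivial.app_eq (hW : W.Trivial) {D : ExtCat C} : ∀ {k : ℕ} {a : D.Cell},
    W.Fits k (D.src a) → W.app D k a = a
  | 0, _, _ => rfl
  | k + 1, a, ⟨h, hk, h₁, h₂⟩ => by
    have ih := hW.app_eq h
    rw [← h.src_app, ih] at h₁ h₂
    have e : D.wl k (W.left k) a = a := by
      refine D.id_cmp ?_
      rw [D.s_eq k hk.le, ← h₁, C.t_eq_of_s (hW k hk).1]
    rw [app, ih, e]
    refine D.cmp_id ?_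
    rw [D.t_eq k hk.le, ← D.t_src_tgt k hk, h₂, (hW k hk).2]

theorem Whisker.Fits.s_onBase {k j : ℕ} {u : C.Cell} (h : W.Fits (k + 1) u) (hj : k < j) :
    C.s j (W.onBase (k + 1) u) = C.cmp k (C.cmp k (W.left k) (C.s j (W.onBase k u))) (W.right k) ∧
    C.t k (W.left k) = C.s k (C.s j (W.onBase k u)) ∧
    C.t k (C.cmp k (W.left k) (C.s j (W.onBase k u))) = C.s k (W.right k) := by
  obtain ⟨h, hk, h₁, h₂⟩ := h
  have e : C.t k (C.cmp k (W.left k) (W.onBase k u)) = C.s k (W.right k) := by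
    rw [C.t_cmp h₁, h₂]
  have e₁ : C.t k (W.left k) = C.s k (C.s j (W.onBase k u)) := by rw [C.s_s_lt _ _ _ hj, h₁]
  refine ⟨?_, e₁, ?_⟩
  · rw [onBase, C.s_cmp_high hj e, C.s_cmp_high hj h₁, C.s_eq_of_le hj (W.left_mem k hk),
      C.s_eq_of_le hj (W.right_mem k hk)]
  · rw [C.t_cmp e₁, C.t_s_lt _ _ _ hj, h₂]

/-- Above dimension `k`, taking sources commutes with `⋆ₖ`, so the outer layer contributes the
weights of its two sides. -/
theorem Whisker.Fits.size_onBase_succ (w : C.Weights) {k j : ℕ} {u : C.Cell}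
    (h : W.Fits (k + 1) u) (hj : k ≤ j) (hjn : j < n) :
    w.size j (W.onBase (k + 1) u) =
      w.w (j + 1) (W.left k) + w.size j (W.onBase k u) + w.w (j + 1) (W.right k) := by
  obtain ⟨e, e₁, e₂⟩ := h.s_onBase (Nat.lt_succ_of_le hj)
  obtain ⟨h, hk, h₁, h₂⟩ := h
  have hl := C.s_eq_of_le (Nat.succ_le_succ hj) (W.left_mem k hk)
  have hr := C.s_eq_of_le (Nat.succ_le_succ hj) (W.right_mem k hk)
  have hu : C.s (j + 1) (C.s (j + 1) (W.onBase k u)) = C.s (j + 1) (W.onBase k u) :=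
    C.s_s_le _ _ _ le_rfl
  have hlt : k < j + 1 := Nat.lt_succ_of_le hj
  rw [NCat.Weights.size, e, w.w_cmp hlt hjn (by rw [C.s_cmp_high hlt e₁, hl, hu]) hr e₂,
    w.w_cmp hlt hjn hl hu e₁]
  rfl

/-- The layers below `j` consist of cells of dimension at most `j`, which weigh nothing in dimension
`j+1`. -/
theorem Whisker.Fits.size_onBase_of_le (w : C.Weights) {j : ℕ} {u : C.Cell} (hjn : j < n) :
    ∀ {k : ℕ}, W.Fits k u → k ≤ j → w.size j (W.onBase k u) = w.size j u
  | 0, _, _ => rfl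
  | k + 1, h, hj => by
    obtain ⟨hk, hkn, -, -⟩ := id h
    rw [h.size_onBase_succ w (Nat.le_of_succ_le hj) hjn, hk.size_onBase_of_le w hjn
      (Nat.le_of_succ_le hj), w.w_id hjn (C.s_eq_of_le hj (W.left_mem k hkn)),
      w.w_id hjn (C.s_eq_of_le hj (W.right_mem k hkn)), zero_add, add_zero]

/-- The outermost layer that is not an identity decides the comparison: the sizes of higher index
are unchanged, and that of its own index grows by a positive weight. Hence the order that reads the
highest dimension first. -/
theorem Whisker.Fits.lt_or_eq (w : C.Weights) {u : C.Cell} : ∀ {k : ℕ}, W.Fits k u →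
    (∀ j < k, C.s j (W.left j) = W.left j ∧ C.s j (W.right j) = W.right j) ∨
      w.Lt u (W.onBase k u)
  | 0, _ => .inl fun _ h => (Nat.not_lt_zero _ h).elim
  | k + 1, h => by
    obtain ⟨hk, hkn, -, -⟩ := id h
    by_cases ht : C.s k (W.left k) = W.left k ∧ C.s k (W.right k) = W.right k
    · rw [h.onBase_succ ht.1 ht.2]
      refine hk.lt_or_eq w |>.imp_left fun h' j hj => ?_
      rcases (Nat.lt_succ_iff.1 hj).lt_or_eq with hj | rfl
      · exact h' j hj
      · exact ht
    · refine .inr ⟨⟨k, hkn⟩, fun j hj => ?_, ?_⟩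
      · exact (h.size_onBase_of_le w j.2 (Nat.succ_le_of_lt hj)).symm
      · change w.size k u < w.size k (W.onBase (k + 1) u)
        rw [h.size_onBase_succ w le_rfl hkn, hk.size_onBase_of_le w hkn le_rfl]
        by_contra hlt
        exact ht ⟨w.eq_of_w hkn (W.left_mem k hkn) (by omega),
          w.eq_of_w hkn (W.right_mem k hkn) (by omega)⟩

theorem Whisker.Fits.trivial_or_lt (w : C.Weights) {u : C.Cell} (h : W.Fits n u) :
    W.Trivial ∨ w.Lt u (W.onBase n u) := h.lt_or_eq w

end Size

/-- The weights of the cells of the free `(n+1)`-category. -/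
noncomputable def freeWeights (w : C.Weights) (Γ : CellExt C) : (free Γ).Weights where
  -- Old dimensions are weighed on the source; in the new one, generators are counted, and count
  -- zero characterises identities by `eq_incl_of_count`.
  w j A := if j ≤ n then w.w j ((free Γ).src A) else count (fun _ => 1) A
  w_cmp {i j A B} hij hj hA hB h := by
    rcases hj.lt_or_eq with hj | rfl
    · have hj := Nat.lt_succ_iff.1 hj
      have hi := hij.trans_le hj
      rw [ExtCat.s_eq _ j hj] at hA hB
      have hA' := congrArg (free Γ).src hA
      have hB' := congrArg (free Γ).src hB
      rw [ExtCat.src_incl] at hA' hB'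
      have hc : C.t i ((free Γ).src A) = C.s i ((free Γ).src B) := by
        rw [ExtCat.t_eq _ i hi.le, ExtCat.s_eq _ i hi.le] at h
        rw [ExtCat.t_src_tgt _ i hi, (free Γ).incl_inj h]
      rw [if_pos hj, if_pos hj, if_pos hj, ExtCat.src_cmp hi hc, w.w_cmp hij hj hA' hB' hc]
    · rw [if_neg (Nat.not_succ_le_self n), if_neg (Nat.not_succ_le_self n),
        if_neg (Nat.not_succ_le_self n)]
      rcases (Nat.lt_succ_iff.1 hij).lt_or_eq with hi | rfl
      · refine count_cmp hi ?_
        rw [ExtCat.t_eq _ i hi.le, ExtCat.s_eq _ i hi.le] at h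
        rw [ExtCat.t_src_tgt _ i hi, (free Γ).incl_inj h]
      · refine count_sq ?_
        rw [← ExtCat.incl_src, ← ExtCat.incl_tgt] at h
        exact (free Γ).incl_inj h
  w_id {j A} hj hA := by
    rcases (Nat.lt_succ_iff.1 hj).lt_or_eq with hj | rfl
    · rw [if_pos (Nat.succ_le_of_lt hj)]
      rw [ExtCat.s_eq _ j hj.le] at hA
      have hA' := congrArg (free Γ).src hA
      rw [ExtCat.src_incl] at hA'
      exact w.w_id hj hA'
    · rw [if_neg (Nat.not_succ_le_self j), ← hA, ← ExtCat.incl_src, count_incl]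
  eq_of_w {j A} hj hA h := by
    rcases (Nat.lt_succ_iff.1 hj).lt_or_eq with hj | rfl
    · rw [if_pos (Nat.succ_le_of_lt hj)] at h
      rw [ExtCat.s_eq _ (j + 1) hj] at hA
      have hA' := congrArg (free Γ).src hA
      rw [ExtCat.src_incl] at hA'
      rw [ExtCat.s_eq _ j hj.le, w.eq_of_w hj hA' h, ← hA, ExtCat.src_incl, hA']
    · rw [if_neg (Nat.not_succ_le_self j)] at h
      rw [← ExtCat.incl_src, ← eq_incl_of_count h]

/-- Freeness in every dimension is what provides a generator count in every dimension. -/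
theorem Polygraph.nonempty_weights : ∀ {n : ℕ} (P : Polygraph.{u} n), Nonempty P.cat.Weights
  | 0, _ => ⟨⟨fun _ _ => 0, fun _ _ _ _ _ => rfl, fun _ _ => rfl,
      fun h => (Nat.not_lt_zero _ h).elim⟩⟩
  | _ + 1, P => (nonempty_weights P.base).elim fun w => ⟨freeWeights w P.rules⟩

end Weights

section Invertible

variable {n : ℕ} {C : NCat.{u} n} {Γ : CellExt C}

/-! ### Invertible cells -/

theorem isInverse_gen (Γ : CellExt C) (γ : Γ.Gen) :
    (freeInv Γ).IsInverse (posGen (CellExt.empty C) Γ γ) (negGen (CellExt.empty C) Γ γ) := by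
  refine ExtCat.isInverse_iff.2 ⟨rfl, rfl, ?_, ?_⟩
  · exact (sq_mk (K := InvRel (CellExt.empty C) Γ) (y := Γ.tgt γ) _ _).trans
      (PCell.sound (Rel.rel (InvRel.left γ)))
  · exact (sq_mk (K := InvRel (CellExt.empty C) Γ) (y := Γ.src γ) _ _).trans
      (PCell.sound (Rel.rel (InvRel.right γ)))

theorem ExtCat.IsInverse.cmp {D : ExtCat C} {a b a' b' : D.Cell} (ha : D.IsInverse a a')
    (hb : D.IsInverse b b') {i : ℕ} (hi : i < n) (h : C.t i (D.src a) = C.s i (D.src b)) :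
    ∃ c, D.IsInverse (D.cmp i a b) c := by
  have h' : C.t i (D.tgt a) = C.s i (D.src b) := by rw [← D.t_src_tgt i hi, h]
  rw [ExtCat.cmp_eq_wr_wl hi h]
  exact ⟨_, (ha.wr hi h).sq (hb.wl hi h') (by rw [ExtCat.tgt_wr hi h, ExtCat.src_wl hi h'])⟩

theorem ExtCat.IsInverse.unique {D : ExtCat C} {a b b' : D.Cell} (h : D.IsInverse a b)
    (h' : D.IsInverse a b') : b = b' := by
  rw [ExtCat.isInverse_iff] at h h'
  rw [← ExtCat.sq_idn (a := b) h.2.1, ← h'.2.2.1, ← ExtCat.sq_assoc h.2.1 h'.1, h.2.2.2,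
    ExtCat.idn_sq h'.1]

theorem exists_isInverse (e : (freeInv Γ).Cell) : ∃ e', (freeInv Γ).IsInverse e e' := by
  refine present_induction (p := fun e => ∃ e', (freeInv Γ).IsInverse e e') ?_ ?_ ?_ ?_ e
  · exact fun x => ⟨_, ExtCat.isInverse_incl x⟩
  · rintro (γ | γ | γ)
    · exact γ.elim
    · exact ⟨_, isInverse_gen Γ γ⟩
    · exact ⟨_, (isInverse_gen Γ γ).symm⟩
  · rintro a b h ⟨a', ha⟩ ⟨b', hb⟩
    exact ⟨_, ha.sq hb h⟩
  · rintro i hi a b h ⟨a', ha⟩ ⟨b', hb⟩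
    exact ha.cmp hb hi h

/-- The inverse of a cell of the free `(n+1,n)`-category. -/
noncomputable def inv (e : (freeInv Γ).Cell) : (freeInv Γ).Cell := (exists_isInverse e).choose

theorem isInverse_inv (e : (freeInv Γ).Cell) : (freeInv Γ).IsInverse e (inv e) :=
  (exists_isInverse e).choose_spec

theorem src_inv (e : (freeInv Γ).Cell) : (freeInv Γ).src (inv e) = (freeInv Γ).tgt e :=
  (ExtCat.isInverse_iff.1 (isInverse_inv e)).1.symm

theorem tgt_inv (e : (freeInv Γ).Cell) : (freeInv Γ).tgt (inv e) = (freeInv Γ).src e :=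
  (ExtCat.isInverse_iff.1 (isInverse_inv e)).2.1

theorem sq_inv (e : (freeInv Γ).Cell) :
    (freeInv Γ).sq e (inv e) = (freeInv Γ).incl ((freeInv Γ).src e) :=
  (ExtCat.isInverse_iff.1 (isInverse_inv e)).2.2.1

theorem inv_sq (e : (freeInv Γ).Cell) :
    (freeInv Γ).sq (inv e) e = (freeInv Γ).incl ((freeInv Γ).tgt e) :=
  (ExtCat.isInverse_iff.1 (isInverse_inv e)).2.2.2

theorem isInvStep_iff {e : (freeInv Γ).Cell} : IsInvStep Γ e ↔ ∃ γ,
    Orbit (freeInv Γ) (posGen (CellExt.empty C) Γ γ) e ∨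
      Orbit (freeInv Γ) (negGen (CellExt.empty C) Γ γ) e :=
  ⟨fun ⟨W, γ, h⟩ => ⟨γ, h.imp (fun h => ⟨W, h⟩) (fun h => ⟨W, h⟩)⟩, by
    rintro ⟨γ, ⟨W, h⟩ | ⟨W, h⟩⟩
    exacts [⟨W, γ, .inl h⟩, ⟨W, γ, .inr h⟩]⟩

theorem IsInvStep.wl {e : (freeInv Γ).Cell} (h : IsInvStep Γ e) {i : ℕ} (hi : i < n) {x : C.Cell}
    (hx : C.t i x = C.s i ((freeInv Γ).src e)) : IsInvStep Γ ((freeInv Γ).wl i x e) := by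
  obtain ⟨γ, h⟩ := isInvStep_iff.1 h
  exact isInvStep_iff.2 ⟨γ, h.imp (·.wl hi hx) (·.wl hi hx)⟩

theorem IsInvStep.wr {e : (freeInv Γ).Cell} (h : IsInvStep Γ e) {i : ℕ} (hi : i < n) {x : C.Cell}
    (hx : C.t i ((freeInv Γ).src e) = C.s i x) : IsInvStep Γ ((freeInv Γ).wr i e x) := by
  obtain ⟨γ, h⟩ := isInvStep_iff.1 h
  exact isInvStep_iff.2 ⟨γ, h.imp (·.wr hi hx) (·.wr hi hx)⟩

theorem isPath_freeInv (e : (freeInv Γ).Cell) : IsPath (freeInv Γ) (IsInvStep Γ) e := by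
  refine isPath_present (fun _ hi _ _ h hx => h.wl hi hx) (fun _ hi _ _ h hx => h.wr hi hx) ?_ e
  rintro (γ | γ | γ)
  · exact γ.elim
  · exact isInvStep_iff.2 ⟨γ, .inl (.self _ _)⟩
  · exact isInvStep_iff.2 ⟨γ, .inr (.self _ _)⟩

theorem IsStep.isInvStep {f : (free Γ).Cell} (h : IsStep Γ f) : IsInvStep Γ (toInv Γ f) := by
  obtain ⟨W, γ, h⟩ := h
  obtain ⟨hW, rfl⟩ := Whisker.sends_iff.1 h
  exact ⟨W, γ, .inl (Whisker.sends_iff.2 ⟨hW, hW.toInv_app⟩)⟩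

/-- Whiskers preserve inverses, so `W[γ⁻]` is an inverse of `W[γ]`, and inverses are unique. -/
theorem IsStep.isInvStep_inv {f : (free Γ).Cell} (h : IsStep Γ f) :
    IsInvStep Γ (inv (toInv Γ f)) := by
  obtain ⟨W, γ, h⟩ := h
  obtain ⟨hW, rfl⟩ := Whisker.sends_iff.1 h
  have hW' : W.Fits n ((freeInv Γ).src (posGen (CellExt.empty C) Γ γ)) := hW
  have h₁ := hW'.isInverse (isInverse_gen Γ γ)
  have h₂ := isInverse_inv (toInv Γ (W.app (free Γ) n (freeGen Γ γ)))
  rw [hW.toInv_app] at h₂ ⊢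
  exact ⟨W, γ, .inr (Whisker.sends_iff.2 ⟨hW'.src_tgt, h₂.unique h₁⟩)⟩

theorem IsInvStep.eq_toInv_or {e : (freeInv Γ).Cell} (h : IsInvStep Γ e) :
    ∃ f, IsStep Γ f ∧ (e = toInv Γ f ∨ e = inv (toInv Γ f)) := by
  obtain ⟨W, γ, h | h⟩ := h
  · obtain ⟨hW, rfl⟩ := Whisker.sends_iff.1 h
    have hW : W.Fits n ((free Γ).src (freeGen Γ γ)) := hW
    exact ⟨_, IsStep.app hW (isStep_freeGen Γ γ), .inl hW.toInv_app.symm⟩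
  · obtain ⟨hW, rfl⟩ := Whisker.sends_iff.1 h
    have hW' : W.Fits n ((freeInv Γ).src (posGen (CellExt.empty C) Γ γ)) :=
      Whisker.Fits.src_tgt (a := negGen (CellExt.empty C) Γ γ) hW
    have hW₂ : W.Fits n ((free Γ).src (freeGen Γ γ)) := hW'
    refine ⟨_, IsStep.app hW₂ (isStep_freeGen Γ γ), .inr ?_⟩
    have h₁ := hW'.isInverse (isInverse_gen Γ γ)
    have h₂ := isInverse_inv (toInv Γ (W.app (free Γ) n (freeGen Γ γ)))
    rw [hW₂.toInv_app] at h₂ ⊢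
    exact h₁.unique h₂

/-- Zigzags of steps exhaust `C(Γ)`. There is no case for compositions along lower dimensions, which
have been absorbed in the steps. -/
theorem freeInv_induction {p : (freeInv Γ).Cell → Prop} (incl : ∀ x, p ((freeInv Γ).incl x))
    (step : ∀ f, IsStep Γ f → p (toInv Γ f)) (inv : ∀ e, p e → p (inv e))
    (sq : ∀ a b, (freeInv Γ).tgt a = (freeInv Γ).src b → p a → p b → p ((freeInv Γ).sq a b))
    (e : (freeInv Γ).Cell) : p e := by
  induction isPath_freeInv e with
  | incl x => exact incl x
  | cons h ha _ ih =>
    refine sq _ _ h ?_ ih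
    obtain ⟨f, hf, rfl | rfl⟩ := ha.eq_toInv_or
    exacts [step f hf, inv _ (step f hf)]

/-! ### Local branchings -/

/-- A branching that is not aspherical, Peiffer or minimal is `(W[f'], W[g'])` with `W` non-trivial:
a trivial whisker would give back the same pair. Then `f'` and `g'` are again steps, by counting,
and their source is strictly smaller for the weight order, so the induction applies. -/
theorem local_branching_induction (w : C.Weights) {p : (free Γ).Cell → (free Γ).Cell → Prop}
    (refl : ∀ f, IsStep Γ f → p f f)
    (peiffer : ∀ i < n, ∀ f g, IsStep Γ f → IsStep Γ g →
      C.t i ((free Γ).src f) = C.s i ((free Γ).src g) →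
      p ((free Γ).wr i f ((free Γ).src g)) ((free Γ).wl i ((free Γ).src f) g) ∧
        p ((free Γ).wl i ((free Γ).src f) g) ((free Γ).wr i f ((free Γ).src g)))
    (whisk : ∀ (W : Whisker C) f g, (free Γ).src f = (free Γ).src g →
      W.Fits n ((free Γ).src f) → W.Fits n ((free Γ).src g) → p f g →
      p (W.app (free Γ) n f) (W.app (free Γ) n g))
    (crit : ∀ f g, IsCritical Γ f g → p f g) {f g : (free Γ).Cell} (hf : IsStep Γ f)
    (hg : IsStep Γ g) (h : (free Γ).src f = (free Γ).src g) : p f g := by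
  induction hu : (free Γ).src f using w.wellFounded_lt.induction generalizing f g with | _ u ih
  subst hu
  by_cases h₁ : f = g
  · subst h₁; exact refl f hf
  by_cases h₂ : IsPeiffer Γ f g
  · obtain ⟨i, hi, f₀, g₀, h₀, hf₀, hg₀, rfl, rfl⟩ := h₂
    rw [ExtCat.whiskR_eq_wr, ExtCat.whiskL_eq_wl]
    exact (peiffer i hi f₀ g₀ hf₀ hg₀ h₀).1
  by_cases h₃ : IsPeiffer Γ g f
  · obtain ⟨i, hi, f₀, g₀, h₀, hf₀, hg₀, rfl, rfl⟩ := h₃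
    rw [ExtCat.whiskR_eq_wr, ExtCat.whiskL_eq_wl]
    exact (peiffer i hi f₀ g₀ hf₀ hg₀ h₀).2
  by_cases h₄ : ∀ (W : Whisker C) (f' g' : (free Γ).Cell), (free Γ).src f' = (free Γ).src g' →
      W.Sends (free Γ) f' f → W.Sends (free Γ) g' g → f' = f ∧ g' = g
  · exact crit f g ⟨hf, hg, h, h₁, h₂, h₃, h₄⟩
  push Not at h₄
  obtain ⟨W, f', g', h', hWf, hWg, hne⟩ := h₄
  obtain ⟨Wf, rfl⟩ := Whisker.sends_iff.1 hWf
  obtain ⟨Wg, rfl⟩ := Whisker.sends_iff.1 hWg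
  refine whisk W f' g' h' Wf Wg (ih _ ?_ (hf.of_app Wf) (hg.of_app Wg) h' rfl)
  rcases Wf.trivial_or_lt w with hW | hlt
  · exact (hne (hW.app_eq Wf).symm (hW.app_eq Wg).symm).elim
  · rwa [Wf.src_app]

/-- Both composites are `f ⋆ᵢ g`, so Peiffer branchings close strictly and need no generating cell.
-/
theorem peiffer_confluence {D : ExtCat C} {f g : D.Cell} {i : ℕ} (hi : i < n)
    (h : C.t i (D.src f) = C.s i (D.src g)) :
    D.tgt (D.wr i f (D.src g)) = D.src (D.wl i (D.tgt f) g) ∧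
    D.tgt (D.wl i (D.src f) g) = D.src (D.wr i f (D.tgt g)) ∧
    D.sq (D.wr i f (D.src g)) (D.wl i (D.tgt f) g) =
      D.sq (D.wl i (D.src f) g) (D.wr i f (D.tgt g)) := by
  have h' : C.t i (D.tgt f) = C.s i (D.src g) := by rw [← D.t_src_tgt i hi, h]
  have h'' : C.t i (D.src f) = C.s i (D.tgt g) := by rw [h, D.s_src_tgt i hi]
  exact ⟨by rw [ExtCat.tgt_wr hi h, ExtCat.src_wl hi h'],
    by rw [ExtCat.tgt_wl hi h, ExtCat.src_wr hi h''],
    by rw [← ExtCat.cmp_eq_wr_wl hi h, ← ExtCat.cmp_eq_wl_wr hi h]⟩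

/-! ### Squier's theorem for congruences -/

/-- A congruence on the cells of an `(n+1)`-category that relates parallel cells only. -/
structure Congruence (D : ExtCat C) (r : D.Cell → D.Cell → Prop) : Prop where
  refl : ∀ a, r a a
  symm : ∀ {a b}, r a b → r b a
  trans : ∀ {a b c}, r a b → r b c → r a c
  src_eq : ∀ {a b}, r a b → D.src a = D.src b
  tgt_eq : ∀ {a b}, r a b → D.tgt a = D.tgt b
  sq : ∀ {a b c d}, r a b → r c d → D.tgt a = D.src c → r (D.sq a c) (D.sq b d)
  wl : ∀ {i x a b}, i < n → r a b → C.t i x = C.s i (D.src a) → r (D.wl i x a) (D.wl i x b)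
  wr : ∀ {i x a b}, i < n → r a b → C.t i (D.src a) = C.s i x → r (D.wr i a x) (D.wr i b x)

/-- The critical branchings are confluent up to `r`. -/
def CriticallyCoherent (Γ : CellExt C) (r : (freeInv Γ).Cell → (freeInv Γ).Cell → Prop) : Prop :=
  ∀ f g, IsCritical Γ f g → ∃ f' g', (free Γ).tgt f = (free Γ).src f' ∧
    (free Γ).tgt g = (free Γ).src g' ∧
    r (toInv Γ ((free Γ).sq f f')) (toInv Γ ((free Γ).sq g g'))

variable {r : (freeInv Γ).Cell → (freeInv Γ).Cell → Prop}

theorem Congruence.app {D : ExtCat C} {r : D.Cell → D.Cell → Prop} (hr : Congruence D r)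
    {W : Whisker C} {k : ℕ} {a b : D.Cell} (h : W.Fits k (D.src a)) (hab : r a b) :
    r (W.app D k a) (W.app D k b) :=
  h.app_rel (p := r) (fun a b h => by rw [hr.src_eq h]; exact .refl _)
    (fun _ hi _ _ _ h h' => hr.wl hi h h') (fun _ hi _ _ _ h h' => hr.wr hi h h') hab

/-- The property is stable under whiskers because `r` is, and it is strict in the aspherical and
Peiffer cases; only the critical branchings are an assumption. -/
theorem Congruence.local_confluence (hr : Congruence (freeInv Γ) r) (w : C.Weights)
    (hc : CriticallyCoherent Γ r) {f g : (free Γ).Cell} (hf : IsStep Γ f) (hg : IsStep Γ g)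
    (h : (free Γ).src f = (free Γ).src g) :
    ∃ f' g', (free Γ).tgt f = (free Γ).src f' ∧ (free Γ).tgt g = (free Γ).src g' ∧
      r (toInv Γ ((free Γ).sq f f')) (toInv Γ ((free Γ).sq g g')) := by
  refine local_branching_induction w
    (p := fun f g => ∃ f' g', (free Γ).tgt f = (free Γ).src f' ∧ (free Γ).tgt g = (free Γ).src g' ∧
      r (toInv Γ ((free Γ).sq f f')) (toInv Γ ((free Γ).sq g g'))) ?_ ?_ ?_ hc hf hg h
  · exact fun f _ => ⟨_, _, ((free Γ).src_incl _).symm, ((free Γ).src_incl _).symm, hr.refl _⟩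
  · intro i hi f g _ _ h
    obtain ⟨h₁, h₂, h₃⟩ := peiffer_confluence hi h
    exact ⟨⟨_, _, h₁, h₂, by rw [h₃]; exact hr.refl _⟩, ⟨_, _, h₂, h₁, by rw [h₃]; exact hr.refl _⟩⟩
  · rintro W f g - Wf Wg ⟨f', g', hf', hg', h⟩
    have Wf' : W.Fits n ((free Γ).src f') := hf' ▸ Wf.src_tgt
    have Wg' : W.Fits n ((free Γ).src g') := hg' ▸ Wg.src_tgt
    refine ⟨W.app (free Γ) n f', W.app (free Γ) n g', by rw [Wf.tgt_app, Wf'.src_app, hf'],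
      by rw [Wg.tgt_app, Wg'.src_app, hg'], ?_⟩
    rw [← Wf.app_sq hf', ← Wg.app_sq hg', Whisker.Fits.toInv_app (by rwa [ExtCat.src_sq hf']),
      Whisker.Fits.toInv_app (by rwa [ExtCat.src_sq hg'])]
    exact hr.app (by rwa [src_toInv, ExtCat.src_sq hf']) h

/-- Newman's argument by well-founded induction on the common source, recording the relation `r` for
each of the three diagrams that are pasted. -/
theorem Congruence.newman (hr : Congruence (freeInv Γ) r) (w : C.Weights)
    (hc : CriticallyCoherent Γ r) (ht : Terminating Γ) {f g : (free Γ).Cell}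
    (h : (free Γ).src f = (free Γ).src g) (hf : (free Γ).tgt f ∈ Irr Γ)
    (hg : (free Γ).tgt g ∈ Irr Γ) : r (toInv Γ f) (toInv Γ g) := by
  induction hu : (free Γ).src f using ht.wellFounded.induction generalizing f g with | _ u ih
  subst hu
  by_cases hi : (free Γ).src f ∈ Irr Γ
  · rw [eq_incl_of_irr (f := f) hi, eq_incl_of_irr (f := g) (h ▸ hi), h]
    exact hr.refl _
  have hne : ∀ k : (free Γ).Cell, (free Γ).src f = (free Γ).src k → (free Γ).tgt k ∈ Irr Γ →
      k ≠ (free Γ).incl ((free Γ).src k) := by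
    intro k hk ht e
    rw [e, ExtCat.tgt_incl, ← hk] at ht
    exact hi ht
  obtain ⟨f₁, f₂, hf₁, hf₂, rfl⟩ := exists_step_of_ne (hne f rfl hf)
  obtain ⟨g₁, g₂, hg₁, hg₂, rfl⟩ := exists_step_of_ne (hne g h hg)
  simp only [ExtCat.src_sq hf₂, ExtCat.src_sq hg₂, ExtCat.tgt_sq hf₂, ExtCat.tgt_sq hg₂] at *
  obtain ⟨f', g', hf', hg', hfg⟩ := hr.local_confluence w hc hf₁ hg₁ h
  have e := hr.tgt_eq hfg
  rw [tgt_toInv, tgt_toInv, ExtCat.tgt_sq hf', ExtCat.tgt_sq hg'] at e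
  -- The common target of `f'` and `g'` is normalised by `k`. The induction hypothesis then compares
  -- `f₂` with `f' ⋆ k`, and `g₂` with `g' ⋆ k`, whose sources are reducts.
  obtain ⟨k, hk, hk'⟩ := ht.exists_normalForm ((free Γ).tgt f')
  have i₁ := ih _ hf₁.reduces (f := f₂) (g := (free Γ).sq f' k)
    (by rw [ExtCat.src_sq hk.symm, ← hf', hf₂]) hf (by rwa [ExtCat.tgt_sq hk.symm]) hf₂.symm
  have i₂ := ih _ (h ▸ hg₁.reduces) (f := g₂) (g := (free Γ).sq g' k)
    (by rw [ExtCat.src_sq (by rw [hk, e]), ← hg', hg₂]) hg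
    (by rwa [ExtCat.tgt_sq (by rw [hk, e])]) hg₂.symm
  have j₁ := hr.sq (hr.refl (toInv Γ f₁)) i₁ (by rw [tgt_toInv, src_toInv, hf₂])
  have j₂ := hr.sq (hr.refl (toInv Γ g₁)) i₂ (by rw [tgt_toInv, src_toInv, hg₂])
  have j₃ := hr.sq hfg (hr.refl (toInv Γ k))
    (by rw [tgt_toInv, src_toInv, ExtCat.tgt_sq hf', hk])
  have ek : (free Γ).tgt g' = (free Γ).src k := by rw [← e, hk]
  rw [← toInv_sq hf₂, ← toInv_sq (by rw [ExtCat.src_sq hk.symm, hf']),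
    ← ExtCat.sq_assoc hf' hk.symm] at j₁
  rw [← toInv_sq hg₂, ← toInv_sq (by rw [ExtCat.src_sq ek, hg']), ← ExtCat.sq_assoc hg' ek] at j₂
  rw [← toInv_sq (by rw [ExtCat.tgt_sq hf', hk]), ← toInv_sq (by rw [ExtCat.tgt_sq hg', ek])] at j₃
  exact hr.trans j₁ (hr.trans j₃ (hr.symm j₂))

/-- Squier's theorem: a congruence that fills the critical branchings of a terminating extension
relates all the parallel cells of the free `(n+1,n)`-category. -/
theorem Congruence.total (hr : Congruence (freeInv Γ) r) (w : C.Weights)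
    (hc : CriticallyCoherent Γ r) (ht : Terminating Γ) {a b : (freeInv Γ).Cell}
    (h : (freeInv Γ).src a = (freeInv Γ).src b) (h' : (freeInv Γ).tgt a = (freeInv Γ).tgt b) :
    r a b := by
  choose k hk hk' using ht.exists_normalForm
  have hks : ∀ u, (freeInv Γ).src (toInv Γ (k u)) = u := fun u => by rw [src_toInv, hk]
  -- Every zigzag is, up to `r`, determined by the chosen reductions at its two ends. For a step
  -- this is Newman's lemma; the property passes to inverses and composites.
  have key : ∀ a : (freeInv Γ).Cell, r ((freeInv Γ).sq a (toInv Γ (k ((freeInv Γ).tgt a))))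
      (toInv Γ (k ((freeInv Γ).src a))) := by
    refine freeInv_induction ?_ ?_ ?_ ?_
    · intro x
      rw [ExtCat.src_incl, ExtCat.tgt_incl, ExtCat.idn_sq (hks x).symm]
      exact hr.refl _
    · intro f hf
      rw [tgt_toInv, src_toInv, ← toInv_sq (hk _).symm]
      exact hr.newman w hc ht (by rw [ExtCat.src_sq (hk _).symm, hk])
        (by rw [ExtCat.tgt_sq (hk _).symm]; exact hk' _) (hk' _)
    · intro e he
      have j := hr.sq (hr.refl (inv e)) (hr.symm he) (by rw [tgt_inv, hks])
      rw [← ExtCat.sq_assoc (tgt_inv e) (hks _).symm, inv_sq, ExtCat.idn_sq (hks _).symm] at j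
      rwa [tgt_inv, src_inv]
    · intro a b hab ha hb
      have j := hr.sq (hr.refl a) hb (by rw [ExtCat.src_sq (hks _).symm, hab])
      rw [← ExtCat.sq_assoc hab (hks _).symm, ← hab] at j
      rw [ExtCat.src_sq hab, ExtCat.tgt_sq hab]
      exact hr.trans j ha
  have ka := key a
  have kb := key b
  rw [← h', ← h] at kb
  -- Cancellation of the chosen reduction at the common target, possible because it is invertible
  -- here.
  have j := hr.sq (hr.trans ka (hr.symm kb)) (hr.refl (inv (toInv Γ (k ((freeInv Γ).tgt a)))))
    (by rw [ExtCat.tgt_sq (hks _).symm, src_inv])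
  rwa [ExtCat.sq_assoc (hks _).symm (src_inv _).symm,
    ExtCat.sq_assoc (by rw [hks, h']) (src_inv _).symm, sq_inv, hks, ExtCat.sq_idn rfl,
    ExtCat.sq_idn h'.symm] at j

end Invertible

/-! ### Squier's coherence theorem. -/

section Globular

variable {n : ℕ} {C : NCat.{u} n} {E : CellExt C}

/-- Each closure property is an operation on the cells over `Γ`: identity, inverse, composition,
whiskering. Related cells are parallel because the two faces of such a cell are. -/
theorem congruence_globular (Γ : CellExt (freeInv E).toNCat) :
    Congruence (freeInv E) fun a b =>
      ∃ A : (freeInv Γ).Cell, (freeInv Γ).src A = a ∧ (freeInv Γ).tgt A = b where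
  refl a := ⟨(freeInv Γ).incl a, (freeInv Γ).src_incl a, (freeInv Γ).tgt_incl a⟩
  symm := by
    rintro a b ⟨A, rfl, rfl⟩
    exact ⟨inv A, src_inv A, tgt_inv A⟩
  trans := by
    rintro a b c ⟨A, rfl, h⟩ ⟨B, rfl, rfl⟩
    exact ⟨(freeInv Γ).sq A B, ExtCat.src_sq h, ExtCat.tgt_sq h⟩
  src_eq := by
    rintro a b ⟨A, rfl, rfl⟩
    have h := (freeInv Γ).s_src_tgt n n.lt_succ_self A
    rw [← ExtCat.incl_src, ← ExtCat.incl_src] at h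
    exact (freeInv E).incl_inj h
  tgt_eq := by
    rintro a b ⟨A, rfl, rfl⟩
    have h := (freeInv Γ).t_src_tgt n n.lt_succ_self A
    rw [← ExtCat.incl_tgt, ← ExtCat.incl_tgt] at h
    exact (freeInv E).incl_inj h
  sq := by
    rintro a b c d ⟨A, rfl, rfl⟩ ⟨B, rfl, rfl⟩ h
    have h := (freeInv E).seq_cond h
    exact ⟨(freeInv Γ).cmp n A B, ExtCat.src_cmp n.lt_succ_self h, ExtCat.tgt_cmp n.lt_succ_self h⟩
  wl := by
    rintro i x a b hi ⟨A, rfl, rfl⟩ h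
    have h : (freeInv E).t i ((freeInv E).incl x) = (freeInv E).s i ((freeInv Γ).src A) :=
      (freeInv E).low_cond hi (by rwa [ExtCat.src_incl])
    exact ⟨(freeInv Γ).wl i ((freeInv E).incl x) A, ExtCat.src_wl (hi.trans n.lt_succ_self) h,
      ExtCat.tgt_wl (hi.trans n.lt_succ_self) h⟩
  wr := by
    rintro i x a b hi ⟨A, rfl, rfl⟩ h
    have h : (freeInv E).t i ((freeInv Γ).src A) = (freeInv E).s i ((freeInv E).incl x) :=
      (freeInv E).low_cond hi (by rwa [ExtCat.src_incl])
    exact ⟨(freeInv Γ).wr i A ((freeInv E).incl x), ExtCat.src_wr (hi.trans n.lt_succ_self) h,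
      ExtCat.tgt_wr (hi.trans n.lt_succ_self) h⟩

/-- Squier's coherence theorem. -/
theorem squier (w : C.Weights) (ht : Terminating E) {Γ : CellExt (freeInv E).toNCat}
    (hΓ : IsGlobularCompletion E Γ) : Γ.Acyclic := by
  intro a b h h'
  have hr := congruence_globular Γ
  refine hr.total w ?_ ht h h'
  obtain ⟨φ, hφ⟩ := hΓ
  intro f g hfg
  obtain ⟨e, e', e₁, e₁', k, k', hp, hs, ht⟩ := hφ ⟨s(f, g), f, g, rfl, hfg⟩
  rw [ExtCat.seq_eq_sq] at hs ht
  have key : ∃ A : (freeInv Γ).Cell, (freeInv Γ).src A = toInv E ((free E).sq e e₁) ∧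
      (freeInv Γ).tgt A = toInv E ((free E).sq e' e₁') :=
    ⟨posGen (CellExt.empty _) Γ (φ ⟨s(f, g), f, g, rfl, hfg⟩), hs, ht⟩
  -- Critical branchings are unordered, so the generator may be oriented from `g` to `f`; symmetry
  -- of the congruence repairs this.
  rcases Sym2.eq_iff.1 hp with ⟨rfl, rfl⟩ | ⟨rfl, rfl⟩
  · exact ⟨_, _, k, k', key⟩
  · exact ⟨_, _, k', k, hr.symm key⟩

end Globular

/-! ### Fillable squares -/

section Filled

variable {n : ℕ} {C : NCat.{u} n} {V H : ExtCat C} {X : SqExt V H}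

/-- The square with top `f`, bottom `g`, left `e` and right `e'` is the boundary of a composite of
squares of `X`. -/
def Filled (X : SqExt V H) (f g : H.Cell) (e e' : V.Cell) : Prop :=
  ∃ p : Square V H, Nonempty (Pasting X p) ∧ p.top = f ∧ p.bot = g ∧ p.left = e ∧ p.right = e'

namespace Filled

theorem gen (x : X.Gen) : Filled X (X.bd x).top (X.bd x).bot (X.bd x).left (X.bd x).right :=
  ⟨_, ⟨.gen x⟩, rfl, rfl, rfl, rfl⟩

theorem idH (f : H.Cell) : Filled X f f (V.incl (H.src f)) (V.incl (H.tgt f)) :=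
  ⟨_, ⟨.idH f⟩, rfl, rfl, rfl, rfl⟩

theorem idV (e : V.Cell) : Filled X (H.incl (V.src e)) (H.incl (V.tgt e)) e e :=
  ⟨_, ⟨.idV e⟩, rfl, rfl, rfl, rfl⟩

variable {f f' g g' : H.Cell} {e e' e'' d d' : V.Cell}

theorem tl (h : Filled X f g e e') : V.src e = H.src f := by
  obtain ⟨p, -, rfl, rfl, rfl, rfl⟩ := h; exact p.tl

theorem tr (h : Filled X f g e e') : V.src e' = H.tgt f := by
  obtain ⟨p, -, rfl, rfl, rfl, rfl⟩ := h; exact p.tr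

theorem bl (h : Filled X f g e e') : V.tgt e = H.src g := by
  obtain ⟨p, -, rfl, rfl, rfl, rfl⟩ := h; exact p.bl

theorem br (h : Filled X f g e e') : V.tgt e' = H.tgt g := by
  obtain ⟨p, -, rfl, rfl, rfl, rfl⟩ := h; exact p.br

theorem juxt (h : Filled X f g e e') (h' : Filled X f' g' e' e'') :
    Filled X (H.sq f f') (H.sq g g') e e'' := by
  obtain ⟨p, ⟨a⟩, rfl, rfl, rfl, rfl⟩ := h
  obtain ⟨q, ⟨b⟩, rfl, rfl, hl, rfl⟩ := h'
  exact ⟨_, ⟨a.juxt b hl.symm⟩, ExtCat.seq_eq_sq (Square.tgt_top hl.symm),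
    ExtCat.seq_eq_sq (Square.tgt_bot hl.symm), rfl, rfl⟩

theorem stack (h : Filled X f g e e') (h' : Filled X g g' d d') :
    Filled X f g' (V.sq e d) (V.sq e' d') := by
  obtain ⟨p, ⟨a⟩, rfl, rfl, rfl, rfl⟩ := h
  obtain ⟨q, ⟨b⟩, ht, rfl, rfl, rfl⟩ := h'
  exact ⟨_, ⟨a.stack b ht.symm⟩, rfl, rfl, ExtCat.seq_eq_sq (Square.tgt_left ht.symm),
    ExtCat.seq_eq_sq (Square.tgt_right ht.symm)⟩

theorem flipH (h : Filled X f g e e') (hf : H.IsInverse f f') (hg : H.IsInverse g g') :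
    Filled X f' g' e' e := by
  obtain ⟨p, ⟨a⟩, rfl, rfl, rfl, rfl⟩ := h
  exact ⟨_, ⟨a.invH f' g' hf hg⟩, rfl, rfl, rfl, rfl⟩

theorem flipV (h : Filled X f g e e') (he : V.IsInverse e d) (he' : V.IsInverse e' d') :
    Filled X g f d d' := by
  obtain ⟨p, ⟨a⟩, rfl, rfl, rfl, rfl⟩ := h
  exact ⟨_, ⟨a.invV d d' he he'⟩, rfl, rfl, rfl, rfl⟩

theorem cmp (h : Filled X f g e e') (h' : Filled X f' g' d d') {i : ℕ} (hi : i < n)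
    (hc : C.t i (H.src f) = C.s i (H.src f')) :
    Filled X (H.cmp i f f') (H.cmp i g g') (V.cmp i e d) (V.cmp i e' d') := by
  obtain ⟨p, ⟨a⟩, rfl, rfl, rfl, rfl⟩ := h
  obtain ⟨q, ⟨b⟩, rfl, rfl, rfl, rfl⟩ := h'
  exact ⟨_, ⟨.low i hi a b hc⟩, ExtCat.low_eq_cmp hi hc,
    ExtCat.low_eq_cmp hi (by rw [Square.t_bot i hi, Square.s_bot i hi, hc]),
    ExtCat.low_eq_cmp hi (by rw [p.tl, q.tl, hc]),
    ExtCat.low_eq_cmp hi (by rw [Square.t_right i hi, Square.s_right i hi, hc])⟩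

theorem wl (h : Filled X f g e e') {i : ℕ} (hi : i < n) {x : C.Cell}
    (hc : C.t i x = C.s i (H.src f)) :
    Filled X (H.wl i x f) (H.wl i x g) (V.wl i x e) (V.wl i x e') := by
  have := (idH (X := X) (H.incl x)).cmp h hi (by rwa [H.src_incl])
  rwa [H.src_incl, H.tgt_incl] at this

theorem wr (h : Filled X f g e e') {i : ℕ} (hi : i < n) {x : C.Cell}
    (hc : C.t i (H.src f) = C.s i x) :
    Filled X (H.wr i f x) (H.wr i g x) (V.wr i e x) (V.wr i e' x) := by
  have := h.cmp (idH (X := X) (H.incl x)) hi (by rwa [H.src_incl])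
  rwa [H.src_incl, H.tgt_incl] at this

theorem app (h : Filled X f g e e') {W : Whisker C} : ∀ {k : ℕ}, W.Fits k (H.src f) →
    Filled X (W.app H k f) (W.app H k g) (W.app V k e) (W.app V k e')
  | 0, _ => h
  | k + 1, ⟨hW, hk, h₁, h₂⟩ => by
    rw [← hW.src_app] at h₁ h₂
    exact ((h.app hW).wl hk h₁).wr hk (by rw [ExtCat.src_wl hk h₁, C.t_cmp h₁, h₂])

/-- A square is determined by its faces. -/
theorem acyclic (h : ∀ f g e e', V.src e = H.src f → V.src e' = H.tgt f → V.tgt e = H.src g →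
    V.tgt e' = H.tgt g → Filled X f g e e') : X.Acyclic := by
  intro p
  obtain ⟨q, ⟨a⟩, h₁, h₂, h₃, h₄⟩ := h p.top p.bot p.left p.right p.tl p.tr p.bl p.br
  exact ⟨Quot.mk _ ⟨q, a⟩, Square.ext h₁ h₂ h₃ h₄⟩

end Filled

/-- The squares of `Y` are boundaries of composites of squares of `X`. -/
def Fills (X Y : SqExt V H) : Prop :=
  ∀ y, Filled X (Y.bd y).top (Y.bd y).bot (Y.bd y).left (Y.bd y).right

theorem Fills.refl (X : SqExt V H) : Fills X X := Filled.gen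

theorem Fills.of_union {X Y Z : SqExt V H} (h : Fills Z (X.union Y)) : Fills Z X ∧ Fills Z Y :=
  ⟨fun x => h (.inl x), fun y => h (.inr y)⟩

/-- The vertical cells that are the vertical faces of a fillable square with identities as horizontal
faces. -/
def Globe (X : SqExt V H) (a b : V.Cell) : Prop :=
  Filled X (H.incl (V.src a)) (H.incl (V.tgt a)) a b

/-- With trivial horizontal faces, inversion along vertical cells gives symmetry, juxtaposition
gives transitivity, and stacking gives compatibility with composition. -/
theorem congruence_globe {E : CellExt C} (X : SqExt (freeInv E) H) :
    Congruence (freeInv E) (Globe X) := by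
  have src_eq : ∀ {a b : (freeInv E).Cell}, Globe X a b → (freeInv E).src a = (freeInv E).src b :=
    fun h => by rw [h.tr, H.tgt_incl]
  have tgt_eq : ∀ {a b : (freeInv E).Cell}, Globe X a b → (freeInv E).tgt a = (freeInv E).tgt b :=
    fun h => by rw [h.br, H.tgt_incl]
  refine ⟨fun a => .idV a, fun {a b} h => ?_, fun {a b c} h h' => ?_, src_eq, tgt_eq,
    fun {a b c d} h h' hc => ?_, fun {i x a b} hi h hc => ?_, fun {i x a b} hi h hc => ?_⟩
  · have := h.flipH (ExtCat.isInverse_incl _) (ExtCat.isInverse_incl _)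
    rwa [src_eq h, tgt_eq h] at this
  · have := h.juxt h'
    rwa [src_eq h, tgt_eq h, ExtCat.idn_sq (H.src_incl _).symm,
      ExtCat.idn_sq (H.src_incl _).symm, ← src_eq h, ← tgt_eq h] at this
  · have := Filled.stack h (by rw [hc]; exact h')
    unfold Globe
    rwa [ExtCat.src_sq hc, ExtCat.tgt_sq hc]
  · have := h.wl hi (x := x) (by rwa [H.src_incl])
    unfold Globe
    rw [ExtCat.src_wl hi hc, ExtCat.tgt_wl hi hc]
    rwa [ExtCat.wl, ExtCat.wl, ExtCat.cmp_incl hc, ExtCat.cmp_incl] at this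
    rw [hc, ExtCat.s_src_tgt _ i hi]
  · have := h.wr hi (x := x) (by rwa [H.src_incl])
    unfold Globe
    rw [ExtCat.src_wr hi hc, ExtCat.tgt_wr hi hc]
    rwa [ExtCat.wr, ExtCat.wr, ExtCat.cmp_incl hc, ExtCat.cmp_incl] at this
    rw [← hc, ExtCat.t_src_tgt _ i hi]

/-- If `X` fills a coherent completion of `E`, any two parallel cells of the free
`(n+1,n)`-category on `E` bound a fillable square. -/
theorem globe_of_completion {E : CellExt C} (w : C.Weights) (ht : Terminating E)
    {X Y : SqExt (freeInv E) H} (hY : IsCompletion E Y) (hX : Fills X Y)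
    {a b : (freeInv E).Cell} (h : (freeInv E).src a = (freeInv E).src b)
    (h' : (freeInv E).tgt a = (freeInv E).tgt b) : Globe X a b := by
  have hr := congruence_globe X
  refine hr.total w ?_ ht h h'
  obtain ⟨φ, hφ⟩ := hY
  intro f g hfg
  obtain ⟨e, e', e₁, e₁', k, k', hp, hl, hr', htop, hbot⟩ := hφ ⟨s(f, g), f, g, rfl, hfg⟩
  have key := hX (φ ⟨s(f, g), f, g, rfl, hfg⟩)
  rw [ExtCat.seq_eq_sq] at hl hr'
  rw [hl, hr', htop, hbot] at key
  have key : Globe X (toInv E ((free E).sq e e₁)) (toInv E ((free E).sq e' e₁')) := by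
    unfold Globe
    rwa [src_toInv, tgt_toInv, ExtCat.src_sq k, ExtCat.tgt_sq k]
  rcases Sym2.eq_iff.1 hp with ⟨rfl, rfl⟩ | ⟨rfl, rfl⟩
  · exact ⟨_, _, k, k', key⟩
  · exact ⟨_, _, k', k, hr.symm key⟩

end Filled

section Modulo

variable {n : ℕ} {C : NCat.{u} n}

/-! ### Subcells -/

/-- `x` is obtained from `u` by removing whiskers and by passing to cells related by `r`. -/
inductive Inside (r : C.Cell → C.Cell → Prop) (u : C.Cell) : C.Cell → Prop
  | refl : Inside r u u
  | conv {x y : C.Cell} (h : Inside r u x) (hr : r x y) : Inside r u y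
  | strip {W : Whisker C} {x : C.Cell} (h : Inside r u (W.onBase n x)) (hW : W.Fits n x) :
      Inside r u x

theorem Inside.trans {r : C.Cell → C.Cell → Prop} {u v x : C.Cell} (h : Inside r u v)
    (h' : Inside r v x) : Inside r u x := by
  induction h' with
  | refl => exact h
  | conv _ hr ih => exact ih.conv hr
  | strip _ hW ih => exact ih.strip hW

/-- A reduction performed on a cell inside `u` can be performed in the surrounding `u`: the
conversions are absorbed by the reduction and the whiskers are put back. The result is still inside
the reduct of `u`. The well-foundedness of both orders below rests on this. -/
theorem Inside.lift {r red : C.Cell → C.Cell → Prop}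
    (hr : ∀ {x y z}, r x y → red y z → red x z)
    (hW : ∀ {W : Whisker C} {x z}, W.Fits n x → red x z →
      W.Fits n z ∧ red (W.onBase n x) (W.onBase n z)) {u x z : C.Cell} (h : Inside r u x)
    (hz : red x z) : ∃ v, red u v ∧ Inside r v z := by
  induction h generalizing z with
  | refl => exact ⟨z, hz, .refl⟩
  | conv _ h ih => exact ih (hr h hz)
  | strip _ h ih =>
    obtain ⟨hz', hz⟩ := hW h hz
    obtain ⟨v, hv, hv'⟩ := ih hz
    exact ⟨v, hv, hv'.strip hz'⟩

/-! ### Reduction combined with passage to subcells, and equivalence modulo `E`. -/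

section Below

variable {E : CellExt C}

theorem Reduces.par {u v : C.Cell} (h : Reduces E u v) : C.Par u v := by
  obtain ⟨f, rfl, rfl, -⟩ := h
  exact (free E).par f

/-- `y` is a reduct or a proper subcell of `x`. -/
def Below (E : CellExt C) (y x : C.Cell) : Prop :=
  Reduces E x y ∨ ∃ W : Whisker C, W.Fits n y ∧ ¬ W.Trivial ∧ W.onBase n y = x

/-- Neither the weight nor the reduction order decreases in both cases. The accessible cell `x` is
therefore kept inside an ambient `u`: a reduction of `x` lifts to one of `u` (outer induction),
while stripping a whisker keeps `u` and decreases the weight of `x` (inner induction). -/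
theorem wellFounded_below (w : C.Weights) (ht : Terminating E) : WellFounded (Below E) := by
  have key : ∀ u x, Inside Eq u x → Acc (Below E) x := by
    intro u
    induction u using ht.wellFounded.induction with | _ u ih
    intro x
    induction x using w.wellFounded_lt.induction with | _ x ih'
    intro hx
    refine Acc.intro x fun y hy => ?_
    rcases hy with hy | ⟨W, hW, hW', rfl⟩
    · obtain ⟨v, hv, hv'⟩ := hx.lift (red := Reduces E) (by rintro x y z rfl h; exact h)
        (fun hW h => ⟨(hW.par h.par).1, h.onBase hW⟩) hy
      exact ih v hv y hv'
    · exact ih' y ((hW.trivial_or_lt w).resolve_left hW') (hx.strip hW)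
  exact ⟨fun x => key x x .refl⟩

/-- `u` and `v` are related by a cell of the free `(n+1,n)`-category on `E`. -/
def Equivalent (E : CellExt C) (u v : C.Cell) : Prop :=
  ∃ e : (freeInv E).Cell, (freeInv E).src e = u ∧ (freeInv E).tgt e = v

namespace Equivalent

theorem refl (E : CellExt C) (u : C.Cell) : Equivalent E u u :=
  ⟨(freeInv E).incl u, (freeInv E).src_incl u, (freeInv E).tgt_incl u⟩

theorem symm {u v : C.Cell} (h : Equivalent E u v) : Equivalent E v u := by
  obtain ⟨e, rfl, rfl⟩ := h
  exact ⟨inv e, src_inv e, tgt_inv e⟩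

theorem trans {u v x : C.Cell} (h : Equivalent E u v) (h' : Equivalent E v x) :
    Equivalent E u x := by
  obtain ⟨e, rfl, rfl⟩ := h
  obtain ⟨e', h, rfl⟩ := h'
  exact ⟨(freeInv E).sq e e', ExtCat.src_sq h.symm, ExtCat.tgt_sq h.symm⟩

theorem par {u v : C.Cell} (h : Equivalent E u v) : C.Par u v := by
  obtain ⟨e, rfl, rfl⟩ := h
  exact (freeInv E).par e

theorem onBase {W : Whisker C} {u v : C.Cell} (h : Equivalent E u v) (hW : W.Fits n u) :
    Equivalent E (W.onBase n u) (W.onBase n v) := by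
  obtain ⟨e, rfl, rfl⟩ := h
  exact ⟨W.app (freeInv E) n e, hW.src_app, hW.tgt_app⟩

theorem of_free (f : (free E).Cell) : Equivalent E ((free E).src f) ((free E).tgt f) :=
  ⟨toInv E f, src_toInv E f, tgt_toInv E f⟩

/-- The Church–Rosser property: valleys compose by confluence at the middle cell. -/
theorem exists_joint (hE : Confluent E) {u v : C.Cell} (h : Equivalent E u v) :
    ∃ f g : (free E).Cell, (free E).src f = u ∧ (free E).src g = v ∧
      (free E).tgt f = (free E).tgt g := by
  obtain ⟨e, rfl, rfl⟩ := h
  refine freeInv_induction (p := fun e => ∃ f g : (free E).Cell,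
    (free E).src f = (freeInv E).src e ∧ (free E).src g = (freeInv E).tgt e ∧
      (free E).tgt f = (free E).tgt g) ?_ ?_ ?_ ?_ e
  · exact fun x => ⟨(free E).incl x, (free E).incl x, rfl, rfl, rfl⟩
  · intro f _
    exact ⟨f, (free E).incl ((free E).tgt f), (src_toInv E f).symm,
      ((free E).src_incl _).trans (tgt_toInv E f).symm, ((free E).tgt_incl _).symm⟩
  · rintro e ⟨f, g, hf, hg, h⟩
    exact ⟨g, f, by rw [hg, src_inv], by rw [hf, tgt_inv], h.symm⟩
  · rintro a b hab ⟨f, g, hf, hg, h⟩ ⟨f', g', hf', hg', h'⟩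
    obtain ⟨k, k', hk, hk', hkk⟩ := hE g f' (by rw [hg, hf', hab])
    refine ⟨(free E).sq f k, (free E).sq g' k', ?_, ?_, ?_⟩
    · rw [ExtCat.src_sq (by rw [h, hk]), hf, ExtCat.src_sq hab]
    · rw [ExtCat.src_sq (by rw [← h', hk']), hg', ExtCat.tgt_sq hab]
    · rw [ExtCat.tgt_sq (by rw [h, hk]), ExtCat.tgt_sq (by rw [← h', hk']), hkk]

theorem exists_free (hE : Confluent E) {u v : C.Cell} (h : Equivalent E u v) (hv : v ∈ Irr E) :
    ∃ f : (free E).Cell, (free E).src f = u ∧ (free E).tgt f = v := by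
  obtain ⟨f, g, hf, hg, hfg⟩ := h.exists_joint hE
  subst hg
  rw [eq_incl_of_irr hv, ExtCat.tgt_incl] at hfg
  exact ⟨f, hf, hfg⟩

theorem eq_of_irr (hE : Confluent E) {u v : C.Cell} (h : Equivalent E u v) (hu : u ∈ Irr E)
    (hv : v ∈ Irr E) : u = v := by
  obtain ⟨f, rfl, rfl⟩ := h.exists_free hE hv
  conv_rhs => rw [eq_incl_of_irr hu, ExtCat.tgt_incl]

end Equivalent

end Below

/-! ### Rewriting modulo -/

section Red

variable (R E : CellExt C)

/-- `u` rewrites to `v` by a step of `R`, modulo `E`. -/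
def ModStep (u v : C.Cell) : Prop :=
  ∃ r, IsStep R r ∧ Equivalent E u ((free R).src r) ∧ Equivalent E ((free R).tgt r) v

/-- `u` rewrites to `v` by a non-empty sequence of steps of `R` modulo `E`. -/
def ModRed : C.Cell → C.Cell → Prop := Relation.TransGen (ModStep R E)

variable {R E}

theorem ModStep.reduces {u v : C.Cell} (h : ModStep R E u v) : Reduces (ere R E) u v := by
  obtain ⟨r, hr, ⟨e, rfl, he⟩, ⟨e', he', rfl⟩⟩ := h
  exact (isStep_freeGen (ere R E) ⟨e, r, e', hr, he, he'⟩).reduces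

theorem wellFounded_modStep (h : Terminating (ere R E)) :
    WellFounded fun v u => ModStep R E u v :=
  Subrelation.wf (fun h => ModStep.reduces h) h.wellFounded

theorem ModStep.onBase {W : Whisker C} {u v : C.Cell} (h : ModStep R E u v) (hW : W.Fits n u) :
    W.Fits n v ∧ ModStep R E (W.onBase n u) (W.onBase n v) := by
  obtain ⟨r, hr, h₁, h₂⟩ := h
  have h₃ := (hW.par h₁.par).1
  exact ⟨(h₃.src_tgt.par h₂.par).1, W.app (free R) n r, hr.app h₃,
    by rw [h₃.src_app]; exact h₁.onBase hW, by rw [h₃.tgt_app]; exact h₂.onBase h₃.src_tgt⟩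

theorem ModRed.onBase {W : Whisker C} {u v : C.Cell} (h : ModRed R E u v) (hW : W.Fits n u) :
    W.Fits n v ∧ ModRed R E (W.onBase n u) (W.onBase n v) := by
  induction h with
  | single h => exact ⟨(h.onBase hW).1, .single (h.onBase hW).2⟩
  | tail _ h ih => exact ⟨(h.onBase ih.1).1, ih.2.tail (h.onBase ih.1).2⟩

/-- A modulo step starts with a conversion, into which a further one can be composed.
`ModRed.equivalent` is the same at the other end. -/
theorem Equivalent.modRed {u v x : C.Cell} (h : Equivalent E u v) (h' : ModRed R E v x) :
    ModRed R E u x := by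
  rw [ModRed, Relation.TransGen.head'_iff] at h' ⊢
  obtain ⟨y, ⟨r, hr, h₁, h₂⟩, h₃⟩ := h'
  exact ⟨y, ⟨r, hr, h.trans h₁, h₂⟩, h₃⟩

theorem ModRed.equivalent {u v x : C.Cell} (h : ModRed R E u v) (h' : Equivalent E v x) :
    ModRed R E u x := by
  rw [ModRed, Relation.TransGen.tail'_iff] at h ⊢
  obtain ⟨y, h₃, ⟨r, hr, h₁, h₂⟩⟩ := h
  exact ⟨y, h₃, r, hr, h₁, h₂.trans h'⟩

theorem wellFounded_modRed (h : WellFounded fun v u => ModStep R E u v) :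
    WellFounded fun v u => ModRed R E u v := by
  have e : (fun v u => ModRed R E u v) = Relation.TransGen fun v u => ModStep R E u v := by
    funext v u
    exact propext Relation.transGen_swap.symm
  rw [e]
  exact h.transGen

/-- The order on cells for which coherence modulo is established: `v` precedes `u` if it is a reduct
modulo `E` of a cell inside `u`. -/
def Precedes (R E : CellExt C) (v u : C.Cell) : Prop :=
  ∃ x, Inside (Equivalent E) u x ∧ ModRed R E x v

/-- Every descent contains at least one rewriting step, which lifts to the ambient cell `y`, so an
induction on `y` alone suffices. -/
theorem wellFounded_precedes (h : WellFounded fun v u => ModStep R E u v) :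
    WellFounded (Precedes R E) := by
  have h' := wellFounded_modRed h
  have key : ∀ y u, Inside (Equivalent E) y u → Acc (Precedes R E) u := by
    intro y
    induction y using h'.induction with | _ y ih
    intro u hu
    refine Acc.intro u ?_
    rintro v ⟨x, hx, hv⟩
    obtain ⟨z, hz, hz'⟩ := (hu.trans hx).lift (red := ModRed R E) (fun h h' => h.modRed h')
      (fun hW h => h.onBase hW) hv
    exact ih z hz v hz'
  exact ⟨fun u => key u u .refl⟩

end Red

/-! ### Coherence modulo -/

section Coherence

variable {R E S : CellExt C}

/-- `f` and `g` can be completed into the horizontal faces of a fillable square. -/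
def Coherent (X : SqExt (freeInv E) (freeInv S)) (f g : (free S).Cell) : Prop :=
  ∃ (f' g' : (free S).Cell) (e e' : (freeInv E).Cell), (free S).tgt f = (free S).src f' ∧
    (free S).tgt g = (free S).src g' ∧
    Filled X (toInv S ((free S).sq f f')) (toInv S ((free S).sq g g')) e e'

/-- A square extension of `(E^⊤, S^⊤)` in which the local branchings modulo can be filled; `p`
is the set of those steps of `S` that are steps of `R`. -/
structure CoherentModulo (R E S : CellExt C) (X : SqExt (freeInv E) (freeInv S))
    (p : (free S).Cell → Prop) : Prop where
  convergent : Convergent E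
  wf : WellFounded fun v u => ModStep R E u v
  modStep : ∀ f, IsStep S f → ModStep R E ((free S).src f) ((free S).tgt f)
  exists_step : ∀ r, IsStep R r → ∃ g, IsStep S g ∧ p g ∧ (free S).src g = (free R).src r
  globe : ∀ a b, (freeInv E).src a = (freeInv E).src b → (freeInv E).tgt a = (freeInv E).tgt b →
    Globe X a b
  peifferR : ∀ i < n, ∀ (f : (free S).Cell) (e : (freeInv E).Cell),
    C.t i ((free S).src f) = C.s i ((freeInv E).src e) →
    Filled X (toInv S ((free S).wr i f ((freeInv E).src e)))
      (toInv S ((free S).wr i f ((freeInv E).tgt e)))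
      ((freeInv E).wl i ((free S).src f) e) ((freeInv E).wl i ((free S).tgt f) e)
  peifferL : ∀ i < n, ∀ (f : (free S).Cell) (e : (freeInv E).Cell),
    C.t i ((freeInv E).src e) = C.s i ((free S).src f) →
    Filled X (toInv S ((free S).wl i ((freeInv E).src e) f))
      (toInv S ((free S).wl i ((freeInv E).tgt e) f))
      ((freeInv E).wr i e ((free S).src f)) ((freeInv E).wr i e ((free S).tgt f))
  primary : ∀ f g, IsStep S f → p g → (free S).src f = (free S).src g → Coherent X f g
  modulo : ∀ f e, IsCriticalModulo S E f e → ∃ (f' g : (free S).Cell) (e' : (freeInv E).Cell),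
    (free S).tgt f = (free S).src f' ∧
    Filled X (toInv S ((free S).sq f f')) (toInv S g) e e'

/-- Any two composites of steps of `S` that start in the `E`-class of `u` and end at irreducible
cells are the horizontal faces of a fillable square. -/
def CoherentAt (X : SqExt (freeInv E) (freeInv S)) (u : C.Cell) : Prop :=
  ∀ (h h' : (free S).Cell) (e : (freeInv E).Cell), Equivalent E u ((free S).src h) →
    (freeInv E).src e = (free S).src h → (freeInv E).tgt e = (free S).src h' →
    (free S).tgt h ∈ Irr S → (free S).tgt h' ∈ Irr S →
    ∃ e', Filled X (toInv S h) (toInv S h') e e'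

/-- Coherence at all the cells that precede `u`. -/
def CoherentBelow (R : CellExt C) (X : SqExt (freeInv E) (freeInv S)) (u : C.Cell) : Prop :=
  ∀ v, Precedes R E v u → CoherentAt X v

variable {X : SqExt (freeInv E) (freeInv S)}

/-- The reason for the shape of `Precedes`: the induction hypothesis at `u` is inherited by the
`E`-equivalent cells and by the subcells, on which the transport of steps along `E` also works. -/
theorem CoherentBelow.inside {u x : C.Cell} (h : CoherentBelow R X u)
    (hx : Inside (Equivalent E) u x) : CoherentBelow R X x := by
  rintro v ⟨y, hy, hv⟩
  exact h v ⟨y, hx.trans hy, hv⟩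

theorem CoherentBelow.of_equivalent {u x : C.Cell} (h : CoherentBelow R X u)
    (hx : Equivalent E u x) : CoherentBelow R X x := h.inside (.conv .refl hx)

theorem CoherentBelow.of_onBase {W : Whisker C} {x : C.Cell} (hW : W.Fits n x)
    (h : CoherentBelow R X (W.onBase n x)) : CoherentBelow R X x := h.inside (.strip .refl hW)

theorem CoherentBelow.of_modRed {u v : C.Cell} (h : CoherentBelow R X u) (hv : ModRed R E u v) :
    CoherentAt X v := h v ⟨u, .refl, hv⟩

/-- The right face of the given square joins the sources of `a` and `b`, and it lies strictly below
`u`. The induction hypothesis fills the square next to it, and the two are juxtaposed. -/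
theorem CoherentBelow.extend {u : C.Cell} (hu : CoherentBelow R X u) {F G a b : (free S).Cell}
    {e e' : (freeInv E).Cell} (h : Filled X (toInv S F) (toInv S G) e e')
    (hF : ModRed R E u ((free S).tgt F)) (ha : (free S).tgt F = (free S).src a)
    (hb : (free S).tgt G = (free S).src b) (ha' : (free S).tgt a ∈ Irr S)
    (hb' : (free S).tgt b ∈ Irr S) :
    ∃ e'', Filled X (toInv S ((free S).sq F a)) (toInv S ((free S).sq G b)) e e'' := by
  obtain ⟨e'', h'⟩ := hu.of_modRed hF a b e' (ha ▸ .refl _ _) (by rw [h.tr, tgt_toInv, ha])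
    (by rw [h.br, tgt_toInv, hb]) ha' hb'
  refine ⟨e'', ?_⟩
  rw [toInv_sq ha, toInv_sq hb]
  exact h.juxt h'

namespace Coherent

variable {f g k : (free S).Cell}

theorem refl (X : SqExt (freeInv E) (freeInv S)) (f : (free S).Cell) : Coherent X f f :=
  ⟨_, _, _, _, ((free S).src_incl _).symm, ((free S).src_incl _).symm, .idH _⟩

theorem symm (h : Coherent X f g) : Coherent X g f := by
  obtain ⟨f', g', e, e', hf, hg, h⟩ := h
  exact ⟨g', f', _, _, hg, hf, h.flipV (isInverse_inv e) (isInverse_inv e')⟩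

theorem of_filled {e e' : (freeInv E).Cell} (h : Filled X (toInv S f) (toInv S g) e e') :
    Coherent X f g :=
  ⟨(free S).incl ((free S).tgt f), (free S).incl ((free S).tgt g), e, e',
    ((free S).src_incl _).symm, ((free S).src_incl _).symm, by
      rwa [ExtCat.sq_idn rfl, ExtCat.sq_idn rfl]⟩

theorem of_sq_eq {f' g' : (free S).Cell} (hf : (free S).tgt f = (free S).src f')
    (hg : (free S).tgt g = (free S).src g') (h : (free S).sq f f' = (free S).sq g g') :
    Coherent X f g := ⟨f', g', _, _, hf, hg, by rw [h]; exact .idH _⟩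

theorem equivalent (h : Coherent X f g) : Equivalent E ((free S).src f) ((free S).src g) := by
  obtain ⟨f', g', e, e', hf, hg, h⟩ := h
  exact ⟨e, by rw [h.tl, src_toInv, ExtCat.src_sq hf], by rw [h.bl, src_toInv, ExtCat.src_sq hg]⟩

theorem app {W : Whisker C} (h : Coherent X f g) (hf : W.Fits n ((free S).src f)) :
    Coherent X (W.app (free S) n f) (W.app (free S) n g) := by
  have hg := (hf.par h.equivalent.par).1
  obtain ⟨f', g', e, e', hf', hg', h⟩ := h
  have hf'' : W.Fits n ((free S).src f') := hf' ▸ hf.src_tgt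
  have hg'' : W.Fits n ((free S).src g') := hg' ▸ hg.src_tgt
  refine ⟨W.app (free S) n f', W.app (free S) n g', W.app (freeInv E) n e, W.app (freeInv E) n e',
    by rw [hf.tgt_app, hf''.src_app, hf'], by rw [hg.tgt_app, hg''.src_app, hg'], ?_⟩
  rw [← hf.app_sq hf', ← hg.app_sq hg', Whisker.Fits.toInv_app (by rwa [ExtCat.src_sq hf']),
    Whisker.Fits.toInv_app (by rwa [ExtCat.src_sq hg'])]
  exact h.app (by rwa [src_toInv, ExtCat.src_sq hf'])

end Coherent

namespace CoherentModulo

variable {p : (free S).Cell → Prop} (M : CoherentModulo R E S X p)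

include M

theorem irrefl (u : C.Cell) : ¬ ModRed R E u u :=
  (wellFounded_modRed M.wf).irrefl.irrefl u

theorem modRed_path {u : C.Cell} {a : (free S).Cell} (h : ModRed R E u ((free S).src a)) :
    ModRed R E u ((free S).tgt a) := by
  induction isPath_free a with
  | incl x => rwa [ExtCat.tgt_incl, ← (free S).src_incl x]
  | @cons a b hab ha _ ih =>
    rw [ExtCat.src_sq hab] at h
    rw [ExtCat.tgt_sq hab]
    exact ih (hab ▸ h.tail (M.modStep a ha))

theorem modRed_step {f a : (free S).Cell} (hf : IsStep S f)
    (h : (free S).tgt f = (free S).src a) : ModRed R E ((free S).src f) ((free S).tgt a) :=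
  M.modRed_path (h ▸ .single (M.modStep f hf))

/-- A non-identity cell of `S^*` begins with a step, which is a modulo step, so `S`-reductions are
reductions of `R` modulo `E`. -/
theorem terminating : Terminating S := by
  rintro ⟨u, hu⟩
  have key : ∀ k, ModRed R E (u k) (u (k + 1)) := by
    intro k
    obtain ⟨f, hf, hf', hne⟩ := hu k
    rw [← hf] at hne
    obtain ⟨a, b, ha, hab, rfl⟩ := exists_step_of_ne hne
    rw [← hf, ← hf', ExtCat.src_sq hab, ExtCat.tgt_sq hab]
    exact M.modRed_step ha hab
  have := wellFounded_modRed M.wf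
  rw [wellFounded_iff_isEmpty_descending_chain] at this
  exact this.false ⟨u, key⟩

/-- The two squares may extend the middle step `g` differently. Both are first extended so that all
horizontal faces end at irreducible cells; the two continuations of `g` then start at its target,
strictly below its source, and the induction hypothesis provides the square between them. -/
theorem trans {f g k : (free S).Cell} (hB : CoherentBelow R X ((free S).src g))
    (hf : IsStep S f) (hg : IsStep S g) (h : Coherent X f g) (h' : Coherent X g k) :
    Coherent X f k := by
  have heq := h.equivalent
  obtain ⟨f₁, g₁, e, e₁, hf₁, hg₁, h⟩ := h
  obtain ⟨g₂, k₂, d, d₁, hg₂, hk₂, h'⟩ := h'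
  obtain ⟨a, ha, ha'⟩ := M.terminating.exists_normalForm ((free S).tgt f₁)
  obtain ⟨b₁, hb₁, hb₁'⟩ := M.terminating.exists_normalForm ((free S).tgt g₁)
  obtain ⟨b₂, hb₂, hb₂'⟩ := M.terminating.exists_normalForm ((free S).tgt g₂)
  obtain ⟨c, hc, hc'⟩ := M.terminating.exists_normalForm ((free S).tgt k₂)
  obtain ⟨_, F₁⟩ := hB.extend h
    (by rw [ExtCat.tgt_sq hf₁]; exact heq.symm.modRed (M.modRed_step hf hf₁))
    (by rw [ExtCat.tgt_sq hf₁, ha]) (by rw [ExtCat.tgt_sq hg₁, hb₁]) ha' hb₁'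
  obtain ⟨_, F₂⟩ := hB.extend h' (by rw [ExtCat.tgt_sq hg₂]; exact M.modRed_step hg hg₂)
    (by rw [ExtCat.tgt_sq hg₂, hb₂]) (by rw [ExtCat.tgt_sq hk₂, hc]) hb₂' hc'
  have i₁ : (free S).tgt g = (free S).src ((free S).sq g₁ b₁) := by
    rw [ExtCat.src_sq hb₁.symm, hg₁]
  have i₂ : (free S).tgt g = (free S).src ((free S).sq g₂ b₂) := by
    rw [ExtCat.src_sq hb₂.symm, hg₂]
  -- The connecting square, of top `g ⋆ (g₁ ⋆ b₁)` and bottom `g ⋆ (g₂ ⋆ b₂)`.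
  obtain ⟨_, F₃⟩ := hB.extend (F := g) (G := g) (.idH _) (.single (M.modStep g hg)) i₁ i₂
    (by rwa [ExtCat.tgt_sq hb₁.symm]) (by rwa [ExtCat.tgt_sq hb₂.symm])
  rw [ExtCat.sq_assoc hf₁ ha.symm, ExtCat.sq_assoc hg₁ hb₁.symm] at F₁
  rw [ExtCat.sq_assoc hg₂ hb₂.symm, ExtCat.sq_assoc hk₂ hc.symm] at F₂
  exact ⟨_, _, _, _, by rw [ExtCat.src_sq ha.symm, hf₁], by rw [ExtCat.src_sq hc.symm, hk₂],
    (F₁.stack F₃).stack F₂⟩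

/-- A Peiffer pair is closed by a Peiffer square, whose bottom is a step. A critical pair is closed
by the completion, with the first step of the bottom face as `g`. In the remaining case the pair is
not minimal, and a non-trivial whisker comes off. -/
theorem cross {f : (free S).Cell} {e : (freeInv E).Cell} (hf : IsStep S f) (he : IsInvStep E e)
    (h : (free S).src f = (freeInv E).src e) :
    (∃ g, IsStep S g ∧ (free S).src g = (freeInv E).tgt e ∧ Coherent X f g) ∨
      ∃ (W : Whisker C) (f' : (free S).Cell) (e' : (freeInv E).Cell), ¬ W.Trivial ∧ IsStep S f' ∧
        (free S).src f' = (freeInv E).src e' ∧ W.Fits n ((free S).src f') ∧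
        f = W.app (free S) n f' ∧ e = W.app (freeInv E) n e' := by
  by_cases h₁ : IsPeifferModulo S E f e
  · left
    obtain ⟨i, hi, f₀, e₀, hf₀, -, ⟨h₀, rfl, rfl⟩ | ⟨h₀, rfl, rfl⟩⟩ := h₁
    · rw [ExtCat.whiskR_eq_wr, ExtCat.whiskL_eq_wl]
      have h₀' : C.t i ((free S).src f₀) = C.s i ((freeInv E).tgt e₀) := by
        rw [h₀, ExtCat.s_src_tgt _ i hi]
      refine ⟨(free S).wr i f₀ ((freeInv E).tgt e₀), hf₀.wr hi h₀', ?_,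
        .of_filled (M.peifferR i hi f₀ e₀ h₀)⟩
      rw [ExtCat.src_wr hi h₀', ExtCat.tgt_wl hi h₀]
    · rw [ExtCat.whiskR_eq_wr, ExtCat.whiskL_eq_wl]
      have h₀' : C.t i ((freeInv E).tgt e₀) = C.s i ((free S).src f₀) := by
        rw [← h₀, ExtCat.t_src_tgt _ i hi]
      refine ⟨(free S).wl i ((freeInv E).tgt e₀) f₀, hf₀.wl hi h₀', ?_,
        .of_filled (M.peifferL i hi f₀ e₀ h₀)⟩
      rw [ExtCat.src_wl hi h₀', ExtCat.tgt_wr hi h₀]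
  by_cases h₂ : ∀ (W : Whisker C) (f' : (free S).Cell) (e' : (freeInv E).Cell),
      (free S).src f' = (freeInv E).src e' →
      W.Sends (free S) f' f → W.Sends (freeInv E) e' e → f' = f ∧ e' = e
  · left
    obtain ⟨f', g, e', hf', F⟩ := M.modulo f e ⟨hf, he, h, h₁, h₂⟩
    -- With a trivial bottom, the source of `f` would be equivalent to the end of the top face, a
    -- strict reduct of it: a cycle modulo `E`.
    have hg : g ≠ (free S).incl ((free S).src g) := by
      intro hg
      have h₃ := M.modRed_step hf hf'
      have h₄ : Equivalent E ((free S).tgt f') ((free S).tgt g) :=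
        ⟨e', by rw [F.tr, tgt_toInv, ExtCat.tgt_sq hf'], by rw [F.br, tgt_toInv]⟩
      have h₅ : Equivalent E ((free S).src f) ((free S).src g) :=
        ⟨e, h.symm, by rw [F.bl, src_toInv]⟩
      rw [hg, ExtCat.tgt_incl] at h₄
      exact M.irrefl _ (h₃.equivalent (h₄.trans h₅.symm))
    obtain ⟨g₁, g₂, hg₁, hg₂, rfl⟩ := exists_step_of_ne hg
    exact ⟨g₁, hg₁, by rw [F.bl, src_toInv, ExtCat.src_sq hg₂], f', g₂, e, e', hf', hg₂, F⟩
  · right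
    push Not at h₂
    obtain ⟨W, f', e', h', hWf, hWe, hne⟩ := h₂
    obtain ⟨Wf, rfl⟩ := Whisker.sends_iff.1 hWf
    obtain ⟨We, rfl⟩ := Whisker.sends_iff.1 hWe
    exact ⟨W, f', e', fun hW => hne (hW.app_eq Wf).symm (hW.app_eq We).symm, hf.of_app Wf, h', Wf,
      rfl, rfl⟩

/-- A step of `S` is coherent with a step of `S` on the `E`-normal form of its source. -/
theorem exists_coherent_normalForm (w : C.Weights) {f : (free S).Cell} (hf : IsStep S f)
    (hB : CoherentBelow R X ((free S).src f)) {y : C.Cell} (hy : y ∈ Irr E)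
    (hfy : Equivalent E ((free S).src f) y) :
    ∃ g, IsStep S g ∧ (free S).src g = y ∧ Coherent X f g := by
  induction hx : (free S).src f using (wellFounded_below w M.convergent.1).induction
    generalizing f y with | _ x ih
  subst hx
  by_cases hx : (free S).src f ∈ Irr E
  · exact ⟨f, hf, hfy.eq_of_irr M.convergent.2 hx hy, .refl X f⟩
  obtain ⟨e, he, hef⟩ := exists_step_of_not_irr hx
  have hred : Reduces E ((free S).src f) ((free E).tgt e) := hef ▸ he.reduces
  rcases M.cross hf he.isInvStep (by rw [src_toInv, hef]) with
    ⟨g, hg, hge, hfg⟩ | ⟨W, f', e', hW, hf', h, Wf, rfl, hWe⟩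
  · rw [tgt_toInv] at hge
    have hBg := hB.of_equivalent hfg.equivalent
    obtain ⟨k, hk, hky, hgk⟩ := ih _ (.inl hred) hg hBg hy (hfg.equivalent.symm.trans hfy) hge
    exact ⟨k, hk, hky, M.trans hBg hf hg hfg hgk⟩
  · rw [Wf.src_app] at hB hfy hred hef
    have We : W.Fits n ((freeInv E).src e') := h ▸ Wf
    have hB' := hB.of_onBase Wf
    -- Otherwise, by confluence, the target of `e'` would reduce positively to the source of `f'`.
    -- After whiskering, this reduction composed with `e` would be a loop of `E`.
    have hu : (free S).src f' ∉ Irr E := by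
      intro hu
      have h₁ : Equivalent E ((freeInv E).tgt e') ((free S).src f') :=
        Equivalent.symm ⟨e', h.symm, rfl⟩
      obtain ⟨a, ha, ha'⟩ := h₁.exists_free M.convergent.2 hu
      have Wa : W.Fits n ((free E).src a) := ha ▸ We.src_tgt
      have h₂ : (free E).tgt e = (free E).src (W.app (free E) n a) := by
        rw [Wa.src_app, ha, ← We.tgt_app, ← hWe, tgt_toInv]
      rw [h₂] at hred
      have h₃ := hred.trans_cell
      rw [Wa.tgt_app, ha'] at h₃
      exact M.convergent.1.wellFounded.irrefl.irrefl _ h₃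
    obtain ⟨a, ha, ha'⟩ := M.convergent.1.exists_normalForm ((free S).src f')
    have h₁ : Equivalent E ((free S).src f') ((free E).tgt a) := ha ▸ .of_free a
    have h₂ : Reduces E ((free S).src f') ((free E).tgt a) :=
      ⟨a, ha, rfl, fun e => hu (by rwa [e, ExtCat.tgt_incl] at ha')⟩
    -- The induction is used twice: on the proper subcell carrying `f'`, to bring that subcell to
    -- its `E`-normal form, and then on the whiskered result, whose source is a strict `E`-reduct.
    obtain ⟨g, hg, hgy, hfg⟩ := ih ((free S).src f')
      (.inr ⟨W, Wf, hW, Wf.src_app.symm⟩) hf' hB' ha' h₁ rfl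
    have Wg : W.Fits n ((free S).src g) := (Wf.par hfg.equivalent.par).1
    have h₃ := hfg.app Wf
    have h₄ : CoherentBelow R X ((free S).src (W.app (free S) n g)) := by
      rw [Wg.src_app]
      exact hB.of_equivalent (hfg.equivalent.onBase Wf)
    have h₅ : Reduces E (W.onBase n ((free S).src f')) ((free S).src (W.app (free S) n g)) := by
      rw [Wg.src_app, hgy]
      exact h₂.onBase Wf
    have h₆ := h₃.equivalent
    rw [Wf.src_app] at h₆
    obtain ⟨k, hk, hky, hgk⟩ := ih _ (.inl (by rw [Wf.src_app]; exact h₅)) (hg.app Wg) h₄ hy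
      (h₆.symm.trans hfy) rfl
    exact ⟨k, hk, hky, M.trans h₄ hf (hg.app Wg) h₃ hgk⟩

/-- A step of `S` on the `E`-normal form of `x` is coherent with a step of `S` on `x`. -/
theorem exists_coherent_expansion (w : C.Weights) {g : (free S).Cell} (hg : IsStep S g)
    (hy : (free S).src g ∈ Irr E) (x : C.Cell) (hB : CoherentBelow R X x)
    (hx : Equivalent E x ((free S).src g)) :
    ∃ f, IsStep S f ∧ (free S).src f = x ∧ Coherent X g f := by
  induction x using (wellFounded_below w M.convergent.1).induction generalizing g with | _ x ih
  by_cases hi : x ∈ Irr E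
  · exact ⟨g, hg, (hx.eq_of_irr M.convergent.2 hi hy).symm, .refl X g⟩
  obtain ⟨e, he, rfl⟩ := exists_step_of_not_irr hi
  have hze : Equivalent E ((free E).src e) ((free E).tgt e) := .of_free e
  have hBz := hB.of_equivalent hze
  obtain ⟨h, hh, hhs, hgh⟩ := ih _ (.inl he.reduces) hg hy hBz (hze.symm.trans hx)
  rw [← hhs] at hBz
  -- The step `h` lives on the reduct of `x`; crossing it with the inverse of `e` leads back to `x`.
  rcases M.cross hh he.isInvStep_inv (by rw [src_inv, tgt_toInv, hhs]) with
    ⟨k, hk, hke, hhk⟩ | ⟨W, h', e', hW, hh', hs, Wh, rfl, hWe⟩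
  · rw [tgt_inv, src_toInv] at hke
    exact ⟨k, hk, hke, M.trans hBz hg hh hgh hhk⟩
  · have We : W.Fits n ((freeInv E).src e') := hs ▸ Wh
    have hv : W.onBase n ((freeInv E).tgt e') = (free E).src e := by
      rw [← We.tgt_app, ← hWe, tgt_inv, src_toInv]
    have hB' : CoherentBelow R X ((free S).src h') := by
      rw [Wh.src_app] at hBz
      exact hBz.of_onBase Wh
    obtain ⟨a, ha, ha'⟩ := M.convergent.1.exists_normalForm ((free S).src h')
    have h₁ : Equivalent E ((free S).src h') ((free E).tgt a) := ha ▸ .of_free a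
    -- After the whisker is removed, `h'` goes down to the `E`-normal form of its source, then up to
    -- the target of `e'`. That target is a proper subcell of `x`, so the induction hypothesis
    -- allows the second move.
    obtain ⟨g', hg', hgy, hhg⟩ := M.exists_coherent_normalForm w hh' hB' ha' h₁
    have h₂ : Equivalent E ((freeInv E).tgt e') ((free S).src g') := by
      rw [hgy]
      exact Equivalent.trans (Equivalent.symm ⟨e', hs.symm, rfl⟩) h₁
    have hB₂ : CoherentBelow R X ((freeInv E).tgt e') := by
      rw [← hv] at hB
      exact hB.of_onBase We.src_tgt
    obtain ⟨f', hf', hfs, hgf⟩ := ih _ (.inr ⟨W, We.src_tgt, hW, hv⟩) hg' (hgy ▸ ha') hB₂ h₂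
    have h₃ := M.trans (hB'.of_equivalent hhg.equivalent) hh' hg' hhg hgf
    have Wf : W.Fits n ((free S).src f') := hfs ▸ We.src_tgt
    exact ⟨W.app (free S) n f', hf'.app Wf, by rw [Wf.src_app, hfs, hv],
      M.trans hBz hg hh hgh (h₃.app Wh)⟩

/-- The common `E`-normal form serves as relay between the two equivalent sources. -/
theorem exists_coherent_step (w : C.Weights) {f : (free S).Cell} (hf : IsStep S f)
    (hB : CoherentBelow R X ((free S).src f)) {x : C.Cell}
    (hx : Equivalent E ((free S).src f) x) :
    ∃ g, IsStep S g ∧ (free S).src g = x ∧ Coherent X f g := by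
  obtain ⟨a, ha, ha'⟩ := M.convergent.1.exists_normalForm ((free S).src f)
  obtain ⟨k, hk, hka, hfk⟩ := M.exists_coherent_normalForm w hf hB ha' (ha ▸ .of_free a)
  obtain ⟨g, hg, hgx, hkg⟩ := M.exists_coherent_expansion w hk (hka ▸ ha') x (hB.of_equivalent hx)
    (hx.symm.trans hfk.equivalent)
  exact ⟨g, hg, hgx, M.trans (hB.of_equivalent hfk.equivalent) hf hk hfk hkg⟩

/-- Branchings of two arbitrary steps of `S` are not in the completion, so both are compared with a
step `k` coming from `R`. Each step is transported along `E` onto the source of `k`, where it forms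
with `k` a branching that is covered. -/
theorem coherent_of_equivalent (w : C.Weights) {f g : (free S).Cell} (hf : IsStep S f)
    (hg : IsStep S g) (hB : CoherentBelow R X ((free S).src f))
    (h : Equivalent E ((free S).src f) ((free S).src g)) : Coherent X f g := by
  obtain ⟨r, hr, h₁, -⟩ := M.modStep f hf
  obtain ⟨k, hk, hp, hks⟩ := M.exists_step r hr
  rw [← hks] at h₁
  have hBk := hB.of_equivalent h₁
  have key : ∀ f, IsStep S f → Equivalent E ((free S).src k) ((free S).src f) →
      Coherent X f k := by
    intro f hf h
    obtain ⟨f', hf', hf's, hff'⟩ := M.exists_coherent_step w hf (hBk.of_equivalent h) h.symm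
    exact M.trans (hf's ▸ hBk) hf hf' hff' (M.primary f' k hf' hp hf's)
  exact M.trans hBk hf hk (key f hf h₁.symm) (key g hg (h₁.symm.trans h)).symm

/-- Newman's pasting modulo `E`: the first steps are coherent, and the three remaining comparisons
take place at strict reducts. -/
theorem coherentAt (w : C.Weights) (u : C.Cell) : CoherentAt X u := by
  induction u using (wellFounded_precedes M.wf).induction with | _ u ih
  intro h h' e hu he he' hh hh'
  have hB : CoherentBelow R X ((free S).src h) := CoherentBelow.of_equivalent ih hu
  have heq : Equivalent E ((free S).src h) ((free S).src h') := ⟨e, he, he'⟩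
  by_cases hi : (free S).src h ∈ Irr S
  · have hi' : (free S).src h' ∈ Irr S := by
      by_contra hi'
      obtain ⟨f, hf, hfs⟩ := exists_step_of_not_irr hi'
      obtain ⟨g, hg, hgs, -⟩ := M.exists_coherent_step w hf (hfs ▸ hB.of_equivalent heq)
        (hfs ▸ heq.symm)
      exact hg.not_irr (hgs ▸ hi)
    rw [eq_incl_of_irr hi, eq_incl_of_irr hi', toInv_incl, toInv_incl, ← he, ← he']
    exact ⟨e, .idV e⟩
  have hi' : (free S).src h' ∉ Irr S := by
    intro hi'
    obtain ⟨f, hf, hfs⟩ := exists_step_of_not_irr hi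
    obtain ⟨g, hg, hgs, -⟩ := M.exists_coherent_step w hf (hfs ▸ hB) (hfs ▸ heq)
    exact hg.not_irr (hgs ▸ hi')
  have hne : ∀ k : (free S).Cell, (free S).src k ∉ Irr S → (free S).tgt k ∈ Irr S →
      k ≠ (free S).incl ((free S).src k) := by
    intro k hk ht e
    rw [e, ExtCat.tgt_incl] at ht
    exact hk ht
  obtain ⟨f, h₁, hf, hfh, rfl⟩ := exists_step_of_ne (hne h hi hh)
  obtain ⟨g, h₂, hg, hgh, rfl⟩ := exists_step_of_ne (hne h' hi' hh')
  rw [ExtCat.src_sq hfh] at hu he hB heq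
  rw [ExtCat.src_sq hgh] at he' heq
  rw [ExtCat.tgt_sq hfh] at hh
  rw [ExtCat.tgt_sq hgh] at hh'
  obtain ⟨f', g', d, d', hf', hg', F⟩ := M.coherent_of_equivalent w hf hg hB heq
  obtain ⟨a, ha, ha'⟩ := M.terminating.exists_normalForm ((free S).tgt f')
  obtain ⟨b, hb, hb'⟩ := M.terminating.exists_normalForm ((free S).tgt g')
  obtain ⟨_, F₂⟩ := hB.extend F (by rw [ExtCat.tgt_sq hf']; exact M.modRed_step hf hf')
    (by rw [ExtCat.tgt_sq hf', ha]) (by rw [ExtCat.tgt_sq hg', hb]) ha' hb'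
  have i₁ : (free S).tgt f = (free S).src ((free S).sq f' a) := by rw [ExtCat.src_sq ha.symm, hf']
  have i₂ : (free S).tgt g = (free S).src ((free S).sq g' b) := by rw [ExtCat.src_sq hb.symm, hg']
  obtain ⟨_, F₁⟩ := hB.extend (F := f) (G := f) (.idH _) (.single (M.modStep f hf)) hfh i₁ hh
    (by rwa [ExtCat.tgt_sq ha.symm])
  obtain ⟨_, F₃⟩ := (hB.of_equivalent heq).extend (F := g) (G := g) (.idH _)
    (.single (M.modStep g hg)) i₂ hgh (by rwa [ExtCat.tgt_sq hb.symm]) hh'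
  rw [ExtCat.sq_assoc hf' ha.symm, ExtCat.sq_assoc hg' hb.symm] at F₂
  obtain ⟨d₀, d₁, F₄⟩ : ∃ d₀ d₁,
      Filled X (toInv S ((free S).sq f h₁)) (toInv S ((free S).sq g h₂)) d₀ d₁ :=
    ⟨_, _, (F₁.stack F₂).stack F₃⟩
  -- The pasting has an uncontrolled left face `d₀`, parallel to the prescribed `e`; a globe
  -- corrects it.
  have G := (M.globe e d₀ (by rw [he, F₄.tl, src_toInv, ExtCat.src_sq hfh])
    (by rw [he', F₄.bl, src_toInv, ExtCat.src_sq hgh])).juxt F₄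
  rw [ExtCat.idn_sq (by rw [he, src_toInv, ExtCat.src_sq hfh]),
    ExtCat.idn_sq (by rw [he', src_toInv, ExtCat.src_sq hgh])] at G
  exact ⟨_, G⟩

/-- Each horizontal zigzag is compared with the chosen reductions at its ends, as in
`Congruence.total`, the comparison now being a square with trivial left face. Squares between chosen
reductions are filled by `coherentAt`. -/
theorem acyclic (w : C.Weights) : X.Acyclic := by
  choose k hk hk' using M.terminating.exists_normalForm
  have hks : ∀ u, (freeInv S).src (toInv S (k u)) = u := fun u => by rw [src_toInv, hk]
  have key : ∀ f : (freeInv S).Cell, ∃ a,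
      Filled X ((freeInv S).sq f (toInv S (k ((freeInv S).tgt f))))
        (toInv S (k ((freeInv S).src f))) ((freeInv E).incl ((freeInv S).src f)) a := by
    refine freeInv_induction ?_ ?_ ?_ ?_
    · intro x
      rw [ExtCat.src_incl, ExtCat.tgt_incl, ExtCat.idn_sq (hks x).symm]
      have := Filled.idH (X := X) (toInv S (k x))
      rw [hks] at this
      exact ⟨_, this⟩
    · intro f hf
      rw [tgt_toInv, src_toInv, ← toInv_sq (hk _).symm]
      refine M.coherentAt w ((free S).src f) _ _ _ ?_ ?_ ?_ ?_ ?_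
      · rw [ExtCat.src_sq (hk _).symm]; exact .refl _ _
      · rw [ExtCat.src_sq (hk _).symm, ExtCat.src_incl]
      · rw [ExtCat.tgt_incl, hk]
      · rw [ExtCat.tgt_sq (hk _).symm]; exact hk' _
      · exact hk' _
    · rintro f ⟨a, F⟩
      have G := ((Filled.idH (X := X) (inv f)).juxt (by rw [tgt_inv]; exact F)).flipV
        (by rw [src_inv]; exact ExtCat.isInverse_incl _) (isInverse_inv a)
      rw [← ExtCat.sq_assoc (tgt_inv f) (hks _).symm, inv_sq, ExtCat.idn_sq (hks _).symm] at G
      rw [src_inv, tgt_inv]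
      exact ⟨_, G⟩
    · rintro f g hfg ⟨a, F⟩ ⟨b, G⟩
      have L := ((Filled.idH (X := X) f).juxt (by rw [hfg]; exact G)).stack
        (by rw [← hfg]; exact F)
      rw [← ExtCat.sq_assoc hfg (hks _).symm, ExtCat.idn_sq (by rw [ExtCat.src_incl])] at L
      rw [ExtCat.src_sq hfg, ExtCat.tgt_sq hfg]
      exact ⟨_, L⟩
  refine Filled.acyclic fun f g e e' tl tr bl br => ?_
  obtain ⟨a, F⟩ := key f
  obtain ⟨b, G⟩ := key g
  obtain ⟨c, L⟩ := M.coherentAt w ((freeInv E).src e) (k ((freeInv S).src f))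
    (k ((freeInv S).src g)) e (by rw [hk, tl]; exact .refl _ _) (by rw [hk, tl]) (by rw [hk, bl])
    (hk' _) (hk' _)
  obtain ⟨d, N⟩ := M.coherentAt w ((freeInv E).src e') (k ((freeInv S).tgt f))
    (k ((freeInv S).tgt g)) e' (by rw [hk, tr]; exact .refl _ _) (by rw [hk, tr])
    (by rw [hk, br]) (hk' _) (hk' _)
  have G' := G.flipV (ExtCat.isInverse_incl _) (isInverse_inv b)
  -- This square has top `f ⋆ k (tgt f)`, bottom `g ⋆ k (tgt g)` and left face `e`.
  have P := (F.stack L).stack G'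
  rw [ExtCat.idn_sq tl.symm, ExtCat.sq_idn bl] at P
  have N' := N.flipH (isInverse_inv _) (isInverse_inv _)
  -- The right face of `P` is only parallel to the right face `d` of `N`; a globe joins them. The
  -- inverse `N'` of `N` then cancels the two reductions and leaves `e'` on the right.
  have Q := M.globe _ d (by
      rw [P.tr, N.tr, ExtCat.tgt_sq (hks _).symm] : (freeInv E).src _ = _) (by
      rw [P.br, N.br, ExtCat.tgt_sq (hks _).symm] : (freeInv E).tgt _ = _)
  have Z := (P.juxt Q).juxt N'
  rw [P.tr, P.br] at Z
  rwa [ExtCat.sq_idn rfl, ExtCat.sq_idn rfl, ExtCat.sq_assoc (hks _).symm (src_inv _).symm,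
    ExtCat.sq_assoc (hks _).symm (src_inv _).symm, sq_inv, sq_inv, hks, hks, ExtCat.sq_idn rfl,
    ExtCat.sq_idn rfl] at Z

end CoherentModulo

end Coherence

end Modulo

/-! ### From coherent completions to the abstract hypotheses. -/

section PolygraphsModulo

variable {n : ℕ} {C : NCat.{u} n} {R E : CellExt C} {S : Set (ere R E).Gen}

theorem IsPrimaryStep.isStep {hS : ContainsRules S} {g : (free ((ere R E).restrict S)).Cell}
    (h : IsPrimaryStep S hS g) : IsStep ((ere R E).restrict S) g := by
  obtain ⟨W, γ, h⟩ := h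
  exact ⟨W, _, h⟩

open Classical in
-- Counting only the generators that are rules of `R` gives an invariant under whiskers, so a
-- primary step remains primary when a whisker is removed.
theorem exists_isPrimaryStep_iff_count (hS : ContainsRules S) :
    ∃ c : ((ere R E).restrict S).Gen → ℕ, ∀ g, IsPrimaryStep S hS g ↔
      IsStep ((ere R E).restrict S) g ∧ count c g = 1 := by
  refine ⟨fun γ => if ∃ ρ, γ = ⟨ModRule.ofRule R E ρ, hS ρ⟩ then 1 else 0, fun g => ⟨?_, ?_⟩⟩
  · rintro ⟨W, ρ, h⟩
    exact ⟨⟨W, _, h⟩, (IsStep.count_eq h).trans (if_pos ⟨ρ, rfl⟩)⟩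
  · rintro ⟨⟨W, γ, h⟩, hc⟩
    rw [IsStep.count_eq h] at hc
    split_ifs at hc with hγ
    obtain ⟨ρ, rfl⟩ := hγ
    exact ⟨W, ρ, h⟩

theorem IsPrimaryStep.of_app {hS : ContainsRules S} {W : Whisker C}
    {g : (free ((ere R E).restrict S)).Cell}
    (hW : W.Fits n ((free ((ere R E).restrict S)).src g))
    (h : IsPrimaryStep S hS (W.app (free ((ere R E).restrict S)) n g)) : IsPrimaryStep S hS g := by
  obtain ⟨c, hc⟩ := exists_isPrimaryStep_iff_count hS
  rw [hc, hW.count_app] at h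
  exact (hc g).2 ⟨h.1.of_app hW, h.2⟩

theorem IsStep.modStep {f : (free ((ere R E).restrict S)).Cell}
    (h : IsStep ((ere R E).restrict S) f) :
    ModStep R E ((free ((ere R E).restrict S)).src f) ((free ((ere R E).restrict S)).tgt f) := by
  obtain ⟨W, γ, h⟩ := h
  obtain ⟨hW, rfl⟩ := Whisker.sends_iff.1 h
  rw [hW.src_app, hW.tgt_app]
  have hγ : ModStep R E ((freeInv E).src γ.1.left) ((freeInv E).tgt γ.1.right) :=
    ⟨γ.1.mid, γ.1.step, ⟨γ.1.left, rfl, γ.1.tgt_left⟩, ⟨γ.1.right, γ.1.src_right, rfl⟩⟩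
  exact (hγ.onBase hW).2

theorem exists_isPrimaryStep (hS : ContainsRules S) {r : (free R).Cell} (h : IsStep R r) :
    ∃ g, IsPrimaryStep S hS g ∧ (free ((ere R E).restrict S)).src g = (free R).src r := by
  obtain ⟨W, γ, h⟩ := h
  obtain ⟨hW, rfl⟩ := Whisker.sends_iff.1 h
  have hW' : W.Fits n ((free ((ere R E).restrict S)).src
    (freeGen ((ere R E).restrict S) ⟨ModRule.ofRule R E γ, hS γ⟩)) := hW
  exact ⟨_, ⟨W, γ, Whisker.sends_iff.2 ⟨hW', rfl⟩⟩, by rw [hW'.src_app, hW.src_app]; rfl⟩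

/-- A square of `Γ` is a square of `E ⋊ Γ`. -/
theorem filled_semidirect {Γ : SqExt (freeInv E) (free ((ere R E).restrict S))} (x : Γ.Gen)
    {X : SqExt (freeInv E) (freeInv ((ere R E).restrict S))} (hX : Fills X (semidirect Γ).toInv) :
    Filled X (toInv _ (Γ.bd x).top) (toInv _ (Γ.bd x).bot) (Γ.bd x).left (Γ.bd x).right := by
  have key := hX
    { A := x
      e₁ := (freeInv E).incl ((freeInv E).src (Γ.bd x).left)
      e₂ := (freeInv E).incl ((freeInv E).tgt (Γ.bd x).left)
      e₂' := (freeInv E).incl ((freeInv E).tgt (Γ.bd x).left)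
      top := (Γ.bd x).top
      bot := (Γ.bd x).bot
      tgt_e₁ := (freeInv E).tgt_incl _
      src_e₂ := ((freeInv E).src_incl _).symm
      inv := ExtCat.isInverse_incl _
      act_top := .inl ⟨congrArg _ (Γ.bd x).tl, rfl⟩
      act_bot := .inl ⟨congrArg _ (Γ.bd x).bl, rfl⟩ }
  dsimp only [SqExt.toInv, semidirect, Square.map, id] at key
  rwa [ExtCat.seq_eq_sq, ExtCat.seq_eq_sq, ExtCat.sq_idn rfl, ExtCat.idn_sq rfl] at key

/-- The three parts of the extension supply respectively the primary and modulo branchings, the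
Peiffer squares, and the vertical globes. -/
theorem coherentModulo_of_completion (w : C.Weights) (hE : Convergent E)
    (ht : Terminating (ere R E)) {hS : ContainsRules S}
    {Γ : SqExt (freeInv E) (free ((ere R E).restrict S))} (hΓ : IsCompletionModulo S hS Γ)
    {Y : SqExt (freeInv E) (freeInv ((ere R E).restrict S))} (hY : IsCompletion E Y) :
    CoherentModulo R E ((ere R E).restrict S)
      (((semidirect Γ).toInv.union (peiffer (freeInv E) (free ((ere R E).restrict S))).toInv).union
        Y) (IsPrimaryStep S hS) := by
  obtain ⟨hX, fillY⟩ := Fills.of_union (Fills.refl (((semidirect Γ).toInv.union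
    (peiffer (freeInv E) (free ((ere R E).restrict S))).toInv).union Y))
  obtain ⟨fillΓ, fillP⟩ := hX.of_union
  obtain ⟨φ, h₁, h₂⟩ := hΓ
  refine ⟨hE, wellFounded_modStep ht, fun f hf => hf.modStep, fun r hr => ?_,
    fun a b h h' => globe_of_completion w hE.1 hY fillY h h',
    fun i hi f e h => ?_, fun i hi f e h => ?_, fun f g hf hg h => ?_, fun f e h => ?_⟩
  · obtain ⟨g, hg, hgr⟩ := exists_isPrimaryStep hS hr
    exact ⟨g, hg.isStep, hg, hgr⟩
  · have := fillP ⟨Square.peifferR i hi f e h, i, hi, f, e, .inl ⟨h, rfl⟩⟩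
    dsimp only [SqExt.toInv, peiffer, Square.map, id,
      Square.peifferR] at this
    rwa [ExtCat.whiskR_eq_wr, ExtCat.whiskR_eq_wr, ExtCat.whiskL_eq_wl,
      ExtCat.whiskL_eq_wl] at this
  · have := fillP ⟨Square.peifferL i hi f e h, i, hi, f, e, .inr ⟨h, rfl⟩⟩
    dsimp only [SqExt.toInv, peiffer, Square.map, id,
      Square.peifferL] at this
    rwa [ExtCat.whiskR_eq_wr, ExtCat.whiskR_eq_wr, ExtCat.whiskL_eq_wl,
      ExtCat.whiskL_eq_wl] at this
  -- Primality of `g` is part of the induction predicate, as it has to be passed on to the stripped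
  -- branchings.
  · refine local_branching_induction w (p := fun f g => IsPrimaryStep S hS g → Coherent _ f g)
      (fun f _ _ => .refl _ f) (fun i hi f g _ _ h => ?_) (fun W f g _ Wf Wg ih hg => ?_)
      (fun f g hfg hg => ?_) hf hg.isStep h hg
    · obtain ⟨k₁, k₂, k₃⟩ := peiffer_confluence hi h
      exact ⟨fun _ => .of_sq_eq k₁ k₂ k₃, fun _ => .of_sq_eq k₂ k₁ k₃.symm⟩
    · exact (ih (.of_app Wg hg)).app Wf
    · obtain ⟨f₁, g₁, f', g', k, k', hp, -, htop, hbot, -⟩ := h₁ ⟨s(f, g), f, g, rfl, hfg, hg⟩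
      have key := filled_semidirect (φ (.inl ⟨s(f, g), f, g, rfl, hfg, hg⟩)) fillΓ
      rw [htop, hbot, ExtCat.seq_eq_sq, ExtCat.seq_eq_sq] at key
      rcases Sym2.eq_iff.1 hp with ⟨rfl, rfl⟩ | ⟨rfl, rfl⟩
      · exact ⟨f', g', _, _, k, k', key⟩
      · exact Coherent.symm ⟨f', g', _, _, k, k', key⟩
  · obtain ⟨f', k, htop, hleft⟩ := h₂ ⟨(f, e), h⟩
    have key := filled_semidirect (φ (.inr ⟨(f, e), h⟩)) fillΓ
    rw [htop, hleft, ExtCat.seq_eq_sq] at key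
    exact ⟨f', _, _, k, key⟩

end PolygraphsModulo

end PolyMod

theorem corollaryC :
    (∀ (m : ℕ) (P : PolyMod.PolygraphModulo.{u} m), P.Diconvergent →
      PolyMod.IsNormalizing P.ext P.E (PolyMod.Irr P.E) →
      ∀ (Γ : PolyMod.SqExt (PolyMod.freeInv P.E) (PolyMod.free P.ext)), P.IsCoherentCompletion Γ →
      ∀ (X : PolyMod.SqExt (PolyMod.freeInv P.E) (PolyMod.freeInv P.ext)),
        PolyMod.IsCompletion P.E X → (P.extend Γ X).Acyclic) ∧
    (∀ (m : ℕ) (P : PolyMod.Polygraph.{u} (m + 1)), PolyMod.Convergent P.rules →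
      ∀ (Γ : PolyMod.CellExt (PolyMod.freeInv P.rules).toNCat),
        PolyMod.IsGlobularCompletion P.rules Γ → Γ.Acyclic) := by
  refine ⟨fun m P hP _ Γ hΓ X hX => ?_, fun m P hP Γ hΓ => ?_⟩
  -- The base category is free on a polygraph, hence weighted; from here on only the weight is used.
  · obtain ⟨w⟩ := P.R.base.nonempty_weights
    exact (PolyMod.coherentModulo_of_completion w hP.1 hP.2.1 hΓ hX).acyclic w
  · obtain ⟨w⟩ := P.base.nonempty_weights
    exact PolyMod.squier w hP.1 hΓ
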